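/- For $N,m,k\in\mathbb N$, $m\ge 1$, let $\mathcal L_{N,m,k}=\{kx+y : x,y\in\mathbb Z/m\mathbb Z,\ xy=N\}\subseteq\mathbb Z/m\mathbb Z$. Let $N$ be an odd composite number, $\Lambda\in\mathbb N$, and let $B_1<B_2$ be natural numbers such that, with $r$ running over primes, $$m_1=\prod_{2<r\le B_1}r,\qquad m_2=\prod_{B_1<r\le B_2}r,\qquad M=m_1m_2>\Lambda .$$ Let $a,b\in\mathbb N$ with $a,b<N$ and $\gcd(ab,MN)=1$. Put $L=\lceil 2\sqrt{abN}\rceil$, and for $m\mid M$ let $\bar{\mathcal L}_m=\{s-L \bmod m: s\in\mathcal L_{N,m,ab}\}$, identified with a set of integers in $[0,m)$. Let $$N_1=\{(x\,m_2^{-1}\bmod m_1)\,m_2 : x\in\bar{\mathcal L}_{m_1}\},\qquad N_2=\{(x\,m_1^{-1}\bmod m_2)\,m_1 : x\in\bar{\mathcal L}_{m_2}\},\qquad \bar{\mathcal L}=\{s\in\bar{\mathcal L}_M: s<\Lambda\},$$ $$\Lambda_{a,b}=\min\Big\{\frac{(au-bv)^2}{4\sqrt{abN}} : u,v\in\mathbb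 N,\ N=uv,\ u,v\ne 1\Big\}.$$ Consider the following algorithm for the input $N,\Lambda$ and the choices $B_1,B_2,a,b$. 1. Compute the primes $r\le B_2$ dividing $M$ by trial division, and $m_1,m_2,M$. Compute $g=\gcd(N,M)$. If $1<g<N$, return $g$. If $g=N$, return a prime $r\mid M$ that divides $N$. 2. Otherwise compute $L$, $k=ab\bmod M$, and for every prime $r\mid M$ the set $\bar{\mathcal L}_r$ from its definition. 3. Compute $\bar{\mathcal L}_{m_1}$ and $\bar{\mathcal L}_{m_2}$ from the sets $\bar{\mathcal L}_r$ by Chinese remaindering: for $m=m_1,m_2$, with $M_r=\frac mr\cdot\big((\frac mr)^{-1}\bmod r\big)$ for the primes $r\mid m$, run through all sums $\sum_{r\mid m} a_rM_r\bmod m$ with $a_r\in\bar{\mathcal L}_r$ in the order of an odometer, each obtained from the preceding one by adding precomputed distances (differences of cyclically consecutive elements of $\bar{\mathcal L}_r$, times $M_r$). 4. Compute the lists $N_1$ and $N_2$ and sort them (merge sort). 5. For every $\alpha_1\in N_1$ and every $\alpha_2\in N_2$ with $0\le\alpha_2<\Lambda-\alpha_1$ or $M-\alpha_1\le\alpha_2<M+\Lambda-\alpha_1$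 (these ranges of the sorted list $N_2$ are found by binary search), let $\alpha=(\alpha_1+\alpha_2)\bmod M$; if $(\alpha+L)^2-4abN=y^2$ for some integer $y\ge 0$ and $\gcd(\alpha+L-y,N)$ is a proper factor of $N$, return it. 6. If no proper factor was found, return "$\Lambda$ is too small". Then the following hold. (i) If $\Lambda>\Lambda_{a,b}$, the algorithm returns a proper factor of $N$, that is, a divisor $d$ of $N$ with $1<d<N$. (ii) Its runtime is $\widetilde O(|N_1|+|N_2|+|\bar{\mathcal L}|)$ bit operations, up to factors polynomial in $\log N$ and $\log\Lambda$. Precisely, there are absolute constants $C,c$ such that for all $N,\Lambda,B_1,B_2,a,b$ as above the number of bit operations is at most $$C\,S\,(\log N+\log\Lambda+\log S)^c,\qquad S=|N_1|+|N_2|+|\bar{\mathcal L}|,$$ with the convention $\log 0=0$ (for $\Lambda=0$). Here bit operations are counted on a random access machine with logarithmic cost: addition, subtraction and comparison of integers cost the sum, multiplication and division with remainder the product of the binary lengths of the operands, and a memory access costs the length of the number moved plus, in an array, that of the address. -/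

import Mathlib

/-! ## The sieve sets -/

namespace HypSieve

/-- The modular hyperbola `{(x, y) : x y = N}` in `(ℤ/m)²`. -/
def hyperbola (N m : ℕ) : Set (ZMod m × ZMod m) :=
  {p | p.1 * p.2 = (N : ZMod m)}

/-- The sieve set `{k x + y : (x, y) on the modular hyperbola}`. -/
def sieve (N m k : ℕ) : Set (ZMod m) :=
  {s | ∃ p ∈ hyperbola N m, s = (k : ZMod m) * p.1 + p.2}

/-- `L = ⌈2 √(abN)⌉`. -/
noncomputable def shift (N a b : ℕ) : ℕ := ⌈2 * Real.sqrt ((a : ℝ) * b * N)⌉₊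

/-- The shifted sieve set `{s - L : s ∈ sieve}` for the linear forms `a u + b v`, where `k = a b`. -/
noncomputable def shiftedSieve (N m a b : ℕ) : Set (ZMod m) :=
  {t | ∃ s ∈ sieve N m (a * b), t = s - (shift N a b : ZMod m)}

/-- The product of all primes `r` with `lo < r ≤ hi`. -/
def primeProd (lo hi : ℕ) : ℕ := ∏ r ∈ (Finset.Ioc lo hi).filter Nat.Prime, r

/-- `{j m' : j = x m'⁻¹ mod m, x in the shifted sieve set modulo m}`, a set of integers in
`[0, m m')`. It is the set `N₁` for `(m, m') = (m₁, m₂)` and `N₂` for `(m, m') = (m₂, m₁)`. -/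
noncomputable def weights (N m m' a b : ℕ) : Set ℕ :=
  {w | ∃ x ∈ shiftedSieve N m a b, w = (x * (m' : ZMod m)⁻¹).val * m'}

/-- Least nonnegative residues below `Λ` of the shifted sieve set modulo `M`. -/
noncomputable def smallSieve (N M a b Λ : ℕ) : Set ℕ :=
  {s | s < Λ ∧ ∃ x ∈ shiftedSieve N M a b, s = x.val}

/-- `Λ_{a,b}`: the minimum of `(au - bv)² / (4 √(abN))` over the nontrivial decompositions
`N = u v`. (For composite `N` this set is finite and nonempty, so that `sInf` is its minimum.) -/
noncomputable def fermatBound (N a b : ℕ) : ℝ :=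
  sInf {x : ℝ | ∃ u v : ℕ, N = u * v ∧ u ≠ 1 ∧ v ≠ 1 ∧
    x = ((a : ℝ) * u - b * v) ^ 2 / (4 * Real.sqrt ((a : ℝ) * b * N))}

end HypSieve

/-! ## Programs with a count of bit operations

A random access machine under logarithmic (bit) cost. The data are natural numbers in binary, lists
of them that are read and written sequentially, and arrays with random access. All arithmetic,
comparisons and memory accesses of the programs below go through the primitives of this section.
Addition, subtraction and comparison cost the total length of the operands, multiplication
and division the product of the lengths (the schoolbook methods), a memory access costs the length
of the number that is moved and, for an array, that of the address.
Greatest common divisors, modular inverses, square roots, sorting and searching are programs. -/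

/-- The result of a computation together with the number of bit operations it took. -/
structure Timed (α : Type) where
  val : α
  cost : ℕ

namespace Timed

instance : Monad Timed where
  pure x := ⟨x, 0⟩
  bind p f := ⟨(f p.val).val, p.cost + (f p.val).cost⟩

/-- Length of a number in memory: its binary digits and one end marker. -/
def len (n : ℕ) : ℕ := n.size + 1

def add (x y : ℕ) : Timed ℕ := ⟨x + y, len x + len y⟩
/-- Truncated subtraction. -/
def sub (x y : ℕ) : Timed ℕ := ⟨x - y, len x + len y⟩
def mul (x y : ℕ) : Timed ℕ := ⟨x * y, len x * len y⟩
def quo (x y : ℕ) : Timed ℕ := ⟨x / y, len x * len y⟩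
def rem (x y : ℕ) : Timed ℕ := ⟨x % y, len x * len y⟩
def lt (x y : ℕ) : Timed Bool := ⟨decide (x < y), len x + len y⟩
def eq (x y : ℕ) : Timed Bool := ⟨decide (x = y), len x + len y⟩
/-- Read the number `x` at the head of a list, or test and update the counter `x` of a loop. -/
def read (x : ℕ) : Timed Unit := ⟨(), len x⟩
/-- Write the number `x` at the head of a list. -/
def cons (x : ℕ) (l : List ℕ) : Timed (List ℕ) := ⟨x :: l, len x⟩
/-- Random access to an array. -/
def get (A : Array ℕ) (i : ℕ) : Timed ℕ := ⟨A.getD i 0, len i + len (A.getD i 0)⟩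
/-- Append an entry to an array. -/
def push (A : Array ℕ) (x : ℕ) : Timed (Array ℕ) := ⟨A.push x, len A.size + len x⟩
/-- Read the length of an array. -/
def length (A : Array ℕ) : Timed ℕ := ⟨A.size, len A.size⟩

end Timed

/-! ## The time-space tradeoff algorithm

In some of the recursions a first argument `fuel` bounds the depth, only so that they are
structural; the initial values are large enough for the bound never to be reached. -/

namespace Tradeoff

open Timed

/-! ### Arithmetic -/

/-- Euclid's algorithm. -/
def gcdAux : (fuel : ℕ) → ℕ → ℕ → Timed ℕ
  | 0, x, _ => pure x
  | f + 1, x, y => do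
    if (← eq y 0) then pure x
    else
      let z ← rem x y
      gcdAux f y z

def gcd (x y : ℕ) : Timed ℕ := gcdAux (y + 1) x y

/-- The extended Euclidean algorithm for remainders `r₀, r₁` and cofactors `t₀, t₁` modulo `m`. -/
def invAux (m : ℕ) : (fuel : ℕ) → (r₀ r₁ t₀ t₁ : ℕ) → Timed ℕ
  | 0, _, _, t₀, _ => pure t₀
  | f + 1, r₀, r₁, t₀, t₁ => do
    if (← eq r₁ 0) then pure t₀
    else
      let q ← quo r₀ r₁
      let r₂ ← rem r₀ r₁
      let p ← mul q t₁
      let p' ← rem p m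
      let n ← sub m p'
      let s ← add t₀ n
      let t₂ ← rem s m
      invAux m f r₁ r₂ t₁ t₂

/-- The inverse of `x` modulo `m`, for coprime `x` and `m`. -/
def inv (x m : ℕ) : Timed ℕ := do
  let r ← rem x m
  invAux m (m + 1) m r 0 1

/-- `⌊√n⌋`, two binary digits of `n` at a time. -/
def sqrtAux : (fuel : ℕ) → ℕ → Timed ℕ
  | 0, _ => pure 0
  | f + 1, n => do
    if (← eq n 0) then pure 0
    else
      let n' ← quo n 4
      let s ← sqrtAux f n'
      let s₀ ← mul 2 s
      let s₁ ← add s₀ 1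
      let q ← mul s₁ s₁
      if (← lt n q) then pure s₀ else pure s₁

def sqrt (n : ℕ) : Timed ℕ := sqrtAux n n

/-- `⌈√n⌉`. -/
def sqrtUp (n : ℕ) : Timed ℕ := do
  let s ← sqrt n
  let q ← mul s s
  if (← eq q n) then pure s else add s 1

/-! ### The moduli -/

/-- Is `n` divisible by no number in `[2, d]`? -/
def noDivisor (n : ℕ) : (d : ℕ) → Timed Bool
  | 0 => pure true
  | 1 => pure true
  | d + 2 => do
    let s ← rem n (d + 2)
    if (← eq s 0) then pure false
    else
      read (d + 2)
      noDivisor n (d + 1)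

def isPrime (n : ℕ) : Timed Bool := do
  if (← lt n 2) then pure false
  else
    let d ← sub n 1
    noDivisor n d

/-- The primes `r` with `lo < r ≤ n`, in descending order. -/
def primesIn (lo : ℕ) : (n : ℕ) → Timed (List ℕ)
  | 0 => pure []
  | n + 1 => do
    read (n + 1)
    if (← lt lo (n + 1)) then
      let p ← isPrime (n + 1)
      let l ← primesIn lo n
      if p then cons (n + 1) l else pure l
    else pure []

def prod : List ℕ → Timed ℕ
  | [] => pure 1
  | x :: l => do
    read x
    let p ← prod l
    mul x p

/-- The first number in the list that divides `N`. -/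
def firstDivisor (N : ℕ) : List ℕ → Timed (Option ℕ)
  | [] => pure none
  | x :: l => do
    read x
    let s ← rem N x
    if (← eq s 0) then pure (some x) else firstDivisor N l

/-! ### The sieve modulo a prime -/

/-- Is there `y' < y` with `x y' ≡ N` and `k x + y' ≡ t + L` modulo `r`? -/
def existsY (r N k L t x : ℕ) : (y : ℕ) → Timed Bool
  | 0 => pure false
  | y + 1 => do
    read (y + 1)
    let p ← mul x y
    let p' ← rem p r
    let n ← rem N r
    let q ← mul k x
    let q' ← add q y
    let q'' ← rem q' r
    let u ← add t L
    let u' ← rem u r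
    if (← eq p' n) && (← eq q'' u') then pure true
    else existsY r N k L t x y

/-- Are there `x' < x` and `y < r` with `x' y ≡ N` and `k x' + y ≡ t + L` modulo `r`? -/
def existsXY (r N k L t : ℕ) : (x : ℕ) → Timed Bool
  | 0 => pure false
  | x + 1 => do
    read (x + 1)
    if (← existsY r N k L t x r) then pure true else existsXY r N k L t x

/-- The `t' < t` that lie in the shifted sieve set modulo `r`. -/
def residuesBelow (r N k L : ℕ) : (t : ℕ) → Timed (List ℕ)
  | 0 => pure []
  | t + 1 => do
    read (t + 1)
    let e ← existsXY r N k L t r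
    let l ← residuesBelow r N k L t
    if e then cons t l else pure l

/-- The shifted sieve set modulo `r`, as a list, for each `r` in the given list. -/
def residues (N k L : ℕ) : List ℕ → Timed (List (ℕ × List ℕ))
  | [] => pure []
  | r :: l => do
    read r
    let A ← residuesBelow r N k L r
    let R ← residues N k L l
    pure ((r, A) :: R)

/-! ### Chinese remaindering -/

/-- One residue class system: the current index, the number `κ` of residues, and the distances
`Δ₀, …, Δ_{κ-1}`. -/
structure Wheel where
  idx : ℕ
  num : ℕ
  dist : Array ℕ

/-- For a list `a₁, a₂, …` and a number `p`, append to `D` the distances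
`(a₁ - p) c mod m, (a₂ - a₁) c mod m, …`; here all `aᵢ, p < r` and `m ∣ r c`. -/
def distances (r c m : ℕ) : (p : ℕ) → List ℕ → Array ℕ → Timed (Array ℕ)
  | _, [], D => pure D
  | p, x :: l, D => do
    read x
    let n ← sub r p
    let s ← add x n
    let q ← mul s c
    let q' ← rem q m
    let D' ← push D q'
    distances r c m x l D'

/-- The last element of the list `p :: l`. -/
def lastOf : (p : ℕ) → List ℕ → Timed ℕ
  | p, [] => pure p
  | _, x :: l => do
    read x
    lastOf x l

/-- The precomputation: the start value `∑ a_{i,1} Mᵢ mod m`, the number `∏ κᵢ` of elements, and the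
wheels. -/
def wheels (m : ℕ) : List (ℕ × List ℕ) → Timed (ℕ × ℕ × List Wheel)
  | [] => pure (0, 1, [])
  | (_, []) :: _ => pure (0, 0, [])
  | (r, a :: A) :: R => do
    read r
    read a
    let h ← quo m r
    let i ← inv h r
    let c ← mul h i
    let z ← lastOf a A
    let D ← distances r c m z (a :: A) #[]
    let κ ← length D
    let (x, n, W) ← wheels m R
    let p ← mul a c
    let s ← add p x
    let x' ← rem s m
    let n' ← mul κ n
    pure (x', n', ⟨0, κ, D⟩ :: W)

/-- Advance the first wheel by one, and the following wheel as long as the index returns to `0`;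
add all distances passed to `x`, modulo `m`. -/
def turn (m : ℕ) : (x : ℕ) → List Wheel → Timed (ℕ × List Wheel)
  | x, [] => pure (x, [])
  | x, w :: W => do
    let i ← add w.idx 1
    let i' ← rem i w.num
    let d ← get w.dist i'
    let s ← add x d
    let x' ← rem s m
    if (← eq i' 0) then
      let (x'', W') ← turn m x' W
      pure (x'', ⟨i', w.num, w.dist⟩ :: W')
    else pure (x', ⟨i', w.num, w.dist⟩ :: W)

/-- The next `n` elements after `x`. -/
def cycle (m : ℕ) : (n : ℕ) → (x : ℕ) → List Wheel → Timed (List ℕ)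
  | 0, _, _ => pure []
  | n + 1, x, W => do
    read (n + 1)
    let (x', W') ← turn m x W
    let l ← cycle m n x' W'
    cons x' l

/-- The set of residues modulo `m` that is determined, by the Chinese Remainder Theorem, by sets of
residues modulo the pairwise coprime factors of `m`. -/
def chinese (m : ℕ) (R : List (ℕ × List ℕ)) : Timed (List ℕ) := do
  let (x, n, W) ← wheels m R
  if (← eq n 0) then pure []
  else
    let n' ← sub n 1
    let l ← cycle m n' x W
    cons x l

/-! ### Sorting and searching -/

def split : List ℕ → Timed (List ℕ × List ℕ)
  | [] => pure ([], [])
  | [x] => do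
    read x
    let l ← cons x []
    pure (l, [])
  | x :: y :: l => do
    read x
    read y
    let (l₁, l₂) ← split l
    let l₁' ← cons x l₁
    let l₂' ← cons y l₂
    pure (l₁', l₂')

def merge : List ℕ → List ℕ → Timed (List ℕ)
  | [], l => pure l
  | l, [] => pure l
  | x :: l, y :: l' => do
    read x
    read y
    if (← lt y x) then
      let t ← merge (x :: l) l'
      cons y t
    else
      let t ← merge l (y :: l')
      cons x t
termination_by l l' => l.length + l'.length

/-- Merge sort. -/
def sortAux : (fuel : ℕ) → List ℕ → Timed (List ℕ)
  | 0, l => pure l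
  | _ + 1, [] => pure []
  | _ + 1, [x] => pure [x]
  | f + 1, x :: y :: l => do
    let (l₁, l₂) ← split (x :: y :: l)
    let s₁ ← sortAux f l₁
    let s₂ ← sortAux f l₂
    merge s₁ s₂

def sort (l : List ℕ) : Timed (List ℕ) := sortAux l.length l

def toArray : List ℕ → Array ℕ → Timed (Array ℕ)
  | [], A => pure A
  | x :: l, A => do
    read x
    let A' ← push A x
    toArray l A'

/-- Binary search: the number of entries `< t` of a sorted array, known to lie in `[lo, hi]`. -/
def searchAux (A : Array ℕ) (t : ℕ) : (fuel : ℕ) → (lo hi : ℕ) → Timed ℕ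
  | 0, lo, _ => pure lo
  | f + 1, lo, hi => do
    if (← lt lo hi) then
      let s ← add lo hi
      let i ← quo s 2
      let x ← get A i
      if (← lt x t) then
        let i' ← add i 1
        searchAux A t f i' hi
      else searchAux A t f lo i
    else pure lo

def search (A : Array ℕ) (t : ℕ) : Timed ℕ := do
  let n ← length A
  searchAux A t A.size 0 n

/-! ### The algorithm -/

/-- The list of all `j m'` with `j = x i mod m`, for `x` in the given list. -/
def weightList (m m' i : ℕ) : List ℕ → Timed (List ℕ)
  | [] => pure []
  | x :: l => do
    read x
    let p ← mul x i
    let j ← rem p m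
    let w ← mul j m'
    let t ← weightList m m' i l
    cons w t

/-- If `(α + L)² - f` is a square `y²`, compute `gcd(α + L - y, N)` and return it if it is a proper
factor of `N`; here `f = 4abN`. -/
def try_ (N f L α : ℕ) : Timed (Option ℕ) := do
  let t ← add α L
  let q ← mul t t
  let d ← sub q f
  let y ← sqrt d
  let y2 ← mul y y
  if (← eq y2 d) then
    let v ← sub t y
    let g ← gcd v N
    if (← lt 1 g) && (← lt g N) then pure (some g) else pure none
  else pure none

/-- Try `α = α₁ + α₂ mod M` for the `n` entries `α₂` of the array `A` from the index `i` on, until a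
proper factor is found. -/
def scan (N f L M α₁ : ℕ) (A : Array ℕ) : (n i : ℕ) → Timed (Option ℕ)
  | 0, _ => pure none
  | n + 1, i => do
    read (n + 1)
    let α₂ ← get A i
    let s ← add α₁ α₂
    let α ← rem s M
    match (← try_ N f L α) with
    | some d => pure (some d)
    | none =>
      let i' ← add i 1
      scan N f L M α₁ A n i'

/-- For each `α₁` in the list, scan the entries `α₂` of the sorted array `A` with
`0 ≤ α₂ < Λ - α₁`, then those with `M - α₁ ≤ α₂ < M + Λ - α₁`, until a proper factor is found. -/
def meet (N f L M Λ : ℕ) (A : Array ℕ) : List ℕ → Timed (Option ℕ)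
  | [] => pure none
  | α₁ :: l => do
    read α₁
    let t₁ ← sub Λ α₁
    let n₁ ← search A t₁
    match (← scan N f L M α₁ A n₁ 0) with
    | some d => pure (some d)
    | none =>
      let t₂ ← sub M α₁
      let i₂ ← search A t₂
      let s ← add M Λ
      let t₃ ← sub s α₁
      let i₃ ← search A t₃
      let n₂ ← sub i₃ i₂
      match (← scan N f L M α₁ A n₂ i₂) with
      | some d => pure (some d)
      | none => meet N f L M Λ A l

/-- The time-space tradeoff algorithm for the input `N, Λ` and the choices `B₁, B₂, a, b`. The
output `none` stands for `Λ is too small`. In the degenerate case that `N` divides `M`, where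
`gcd(N, M) = N`, a prime of the list that divides `N` is returned. -/
def factor (N Λ B₁ B₂ a b : ℕ) : Timed (Option ℕ) := do
  let P₁ ← primesIn 2 B₁
  let P₂ ← primesIn B₁ B₂
  let m₁ ← prod P₁
  let m₂ ← prod P₂
  let M ← mul m₁ m₂
  let g ← gcd N M
  if (← lt 1 g) then
    if (← lt g N) then pure (some g)
    else
      match (← firstDivisor N P₁) with
      | some d => pure (some d)
      | none => firstDivisor N P₂
  else
    let ab ← mul a b
    let abN ← mul ab N
    let f ← mul 4 abN
    let L ← sqrtUp f
    let k ← rem ab M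
    let R₁ ← residues N k L P₁
    let R₂ ← residues N k L P₂
    let X₁ ← chinese m₁ R₁
    let X₂ ← chinese m₂ R₂
    let i₁ ← inv m₂ m₁
    let W₁ ← weightList m₁ m₂ i₁ X₁
    let N₁ ← sort W₁
    let i₂ ← inv m₁ m₂
    let W₂ ← weightList m₂ m₁ i₂ X₂
    let N₂ ← sort W₂
    let A ← toArray N₂ #[]
    meet N f L M Λ A N₁

end Tradeoff

/-! Correctness. Let `N = uv` be a nontrivial decomposition with `(au - bv)² / (4√(abN)) < Λ`, and
put `s = au + bv`. From `s² - 4abN = (au - bv)²` and `s ≥ 2√(abN)` one gets `0 ≤ s - 2√(abN) = (au -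
bv)² / (s + 2√(abN)) < Λ`, so `α = s - L` lies in `[0, Λ)` (`shift_le_and_lt`). Modulo `M` the point
`(u/b, bv)` lies on the hyperbola and `ab · u/b + bv = s`, so `α` lies in the shifted sieve
(`inSieve_linear`). By the Chinese Remainder Theorem `α ≡ α₁ + α₂` with `α₁` in `N₁` (zero modulo
`m₂`) and `α₂` in `N₂` (zero modulo `m₁`). As `α < Λ`, the integer `α₁ + α₂` lies in `[0, Λ)` or in
`[M, M + Λ)`, which are the ranges searched. At this `α` the discriminant is the square of `|au -
bv|`, and `s - |au - bv|` is `2bv` or `2au`, whose gcd with `N` is `v` or `u`, because `N` is odd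
and coprime to `ab` (`try_ne_none_of_le`).

Running time. The pairs `(α₁, α₂)` in the searched ranges are mapped injectively into the small
sieve set by `(α₁ + α₂) mod M`, so at most `|L̄|` candidates are tried (`sum_tries_le`). The
odometer lists each residue once, so that chaining, sorting and searching are quasilinear in `|N₁| +
|N₂|`. All remaining work (primality tests, brute force modulo each prime, precomputation) is
`O(B₂⁴)` up to powers of the binary length of the numbers involved.

It remains to bound `B₂⁴` and this length in terms of `S`. Modulo a prime `r` the map `x ↦ kx + N/x`
is at most two-to-one on nonzero `x`, so the sieve set has at least `(r - 1)/2` elements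
(`pred_le_two_mul_residues`). Hence `mᵢ ≤ 6 |Nᵢ|³` (`prod_le_length_pow`) and `M ≤ 36 S⁶`, so that
`log M` is `O(1 + log S)`. By Bertrand's postulate the product of the primes up to `n` exceeds every
fixed power of `n` up to a constant (`exists_pow_le_primeProd`); since it is at most `2M` for `n =
B₂`, this gives `B₂²⁴ = O(S⁶)`, that is `B₂⁴ = O(S)`. -/

namespace Timed

/-! ### Values and costs of the primitives, and binary lengths. -/

variable {α β : Type}

@[simp] lemma val_pure (x : α) : (pure x : Timed α).val = x := rfl
@[simp] lemma cost_pure (x : α) : (pure x : Timed α).cost = 0 := rfl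
@[simp] lemma val_bind (p : Timed α) (f : α → Timed β) : (p >>= f).val = (f p.val).val := rfl
@[simp] lemma cost_bind (p : Timed α) (f : α → Timed β) :
    (p >>= f).cost = p.cost + (f p.val).cost := rfl
@[simp] lemma val_ite (c : Prop) {_ : Decidable c} (p q : Timed α) :
    (if c then p else q).val = if c then p.val else q.val := by split_ifs <;> rfl
@[simp] lemma cost_ite (c : Prop) {_ : Decidable c} (p q : Timed α) :
    (if c then p else q).cost = if c then p.cost else q.cost := by split_ifs <;> rfl
@[simp] lemma val_add (x y : ℕ) : (add x y).val = x + y := rfl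
@[simp] lemma val_sub (x y : ℕ) : (sub x y).val = x - y := rfl
@[simp] lemma val_mul (x y : ℕ) : (mul x y).val = x * y := rfl
@[simp] lemma val_quo (x y : ℕ) : (quo x y).val = x / y := rfl
@[simp] lemma val_rem (x y : ℕ) : (rem x y).val = x % y := rfl
@[simp] lemma val_lt (x y : ℕ) : (lt x y).val = decide (x < y) := rfl
@[simp] lemma val_eq (x y : ℕ) : (eq x y).val = decide (x = y) := rfl
@[simp] lemma val_cons (x : ℕ) (l : List ℕ) : (cons x l).val = x :: l := rfl
@[simp] lemma val_get (A : Array ℕ) (i : ℕ) : (get A i).val = A.getD i 0 := rfl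
@[simp] lemma val_push (A : Array ℕ) (x : ℕ) : (push A x).val = A.push x := rfl
@[simp] lemma val_length (A : Array ℕ) : (length A).val = A.size := rfl

lemma len_pos (x : ℕ) : 1 ≤ len x := by simp [len]

lemma len_mono {x y : ℕ} (h : x ≤ y) : len x ≤ len y := by
  simpa [len] using Nat.size_le_size h

lemma len_le_of_lt_two_pow {x n : ℕ} (h : x < 2 ^ n) : len x ≤ n + 1 := by
  simpa [len] using Nat.size_le.2 h

lemma len_mul_le (x y : ℕ) : len (x * y) ≤ len x + len y := by
  have h : x * y < 2 ^ (x.size + y.size) := by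
    rw [pow_add]
    exact Nat.mul_lt_mul'' (Nat.lt_size_self x) (Nat.lt_size_self y)
  have := len_le_of_lt_two_pow h
  simp only [len] at *
  omega

/-- Cruder than the maximum plus one, but linear in the lengths like the bound for products, so that
`omega` can chain such bounds in the cost estimates. -/
lemma len_add_le (x y : ℕ) : len (x + y) ≤ len x + len y := by
  have h : x + y < 2 ^ (x.size + y.size + 1) := by
    have hx := (Nat.lt_size_self x).trans_le
      (Nat.pow_le_pow_right (n := 2) (by norm_num) (Nat.le_add_right x.size y.size))
    have hy := (Nat.lt_size_self y).trans_le
      (Nat.pow_le_pow_right (n := 2) (by norm_num) (Nat.le_add_left y.size x.size))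
    rw [pow_succ]; omega
  have := len_le_of_lt_two_pow h
  simp only [len] at *
  omega

lemma len_div_le (x y : ℕ) : len (x / y) ≤ len x := len_mono (Nat.div_le_self x y)

lemma len_mod_le (x y : ℕ) : len (x % y) ≤ len x := len_mono (Nat.mod_le x y)

lemma len_sub_le (x y : ℕ) : len (x - y) ≤ len x := len_mono (Nat.sub_le x y)

@[simp] lemma len_zero : len 0 = 1 := by simp [len]
@[simp] lemma len_one : len 1 = 2 := by simp [len]
lemma len_two : len 2 = 3 := by decide
lemma len_four : len 4 = 4 := by decide

/-- A bound for the cost of a primitive operation on numbers of length at most `ℓ`. -/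
def unit (ℓ : ℕ) : ℕ := 2 * ℓ ^ 2

variable {ℓ x y : ℕ}

/-- This is why a single quantity `unit ℓ` serves both for the linear operations and for the
quadratic ones. -/
lemma two_mul_le_unit (ℓ : ℕ) : 2 * ℓ ≤ unit ℓ := by
  unfold unit
  rcases Nat.eq_zero_or_pos ℓ with rfl | h
  · simp
  · nlinarith

lemma cost_add_le (hx : len x ≤ ℓ) (hy : len y ≤ ℓ) : (add x y).cost ≤ unit ℓ := by
  have := two_mul_le_unit ℓ
  simp only [add]; omega

lemma cost_sub_le (hx : len x ≤ ℓ) (hy : len y ≤ ℓ) : (sub x y).cost ≤ unit ℓ := by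
  have := two_mul_le_unit ℓ
  simp only [sub]; omega

lemma cost_lt_le (hx : len x ≤ ℓ) (hy : len y ≤ ℓ) : (lt x y).cost ≤ unit ℓ := by
  have := two_mul_le_unit ℓ
  simp only [lt]; omega

lemma cost_eq_le (hx : len x ≤ ℓ) (hy : len y ≤ ℓ) : (eq x y).cost ≤ unit ℓ := by
  have := two_mul_le_unit ℓ
  simp only [eq]; omega

lemma cost_mul_le (hx : len x ≤ ℓ) (hy : len y ≤ ℓ) : (mul x y).cost ≤ unit ℓ := by
  have := Nat.mul_le_mul hx hy
  simp only [mul, unit]; nlinarith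

lemma cost_quo_le (hx : len x ≤ ℓ) (hy : len y ≤ ℓ) : (quo x y).cost ≤ unit ℓ := by
  have := Nat.mul_le_mul hx hy
  simp only [quo, unit]; nlinarith

lemma cost_rem_le (hx : len x ≤ ℓ) (hy : len y ≤ ℓ) : (rem x y).cost ≤ unit ℓ := by
  have := Nat.mul_le_mul hx hy
  simp only [rem, unit]; nlinarith

lemma cost_read_le (hx : len x ≤ ℓ) : (read x).cost ≤ unit ℓ := by
  have := two_mul_le_unit ℓ
  simp only [read]; omega

lemma cost_cons_le (hx : len x ≤ ℓ) (l : List ℕ) : (cons x l).cost ≤ unit ℓ := by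
  have := two_mul_le_unit ℓ
  simp only [cons]; omega

lemma cost_get_le {A : Array ℕ} {i : ℕ} (hi : len i ≤ ℓ) (hx : len (A.getD i 0) ≤ ℓ) :
    (get A i).cost ≤ unit ℓ := by
  have := two_mul_le_unit ℓ
  simp only [get]; omega

lemma cost_push_le {A : Array ℕ} (hA : len A.size ≤ ℓ) (hx : len x ≤ ℓ) :
    (push A x).cost ≤ unit ℓ := by
  have := two_mul_le_unit ℓ
  simp only [push]; omega

lemma cost_length_le {A : Array ℕ} (hA : len A.size ≤ ℓ) : (length A).cost ≤ unit ℓ := by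
  have := two_mul_le_unit ℓ
  simp only [length]; omega

end Timed

namespace Tradeoff

open Timed

/-! ### Euclid's algorithm -/

lemma gcdAux_val : ∀ {f x y : ℕ}, y < f → (gcdAux f x y).val = Nat.gcd x y
  | 0, _, _, h => by omega
  | f + 1, x, y, h => by
    rw [gcdAux]
    by_cases hy : y = 0
    · simp [hy]
    · have := Nat.mod_lt x (Nat.pos_of_ne_zero hy)
      simp only [val_bind, val_eq, hy, decide_false, Bool.false_eq_true, if_false, val_rem]
      rw [gcdAux_val (by omega), Nat.gcd_comm, ← Nat.gcd_rec, Nat.gcd_comm]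

lemma gcd_val (x y : ℕ) : (gcd x y).val = Nat.gcd x y := gcdAux_val (Nat.lt_succ_self y)

/-- As `y ≤ x`, the quotient is at least one and the remainder is at most `x / 2`. Hence the product
of the two current numbers at least halves in each Euclidean step; it is the potential that bounds
the number of steps by a length. -/
lemma mul_mod_lt {x y n : ℕ} (hy : 0 < y) (hyx : y ≤ x) (h : x * y < 2 ^ (n + 1)) :
    y * (x % y) < 2 ^ n := by
  have h1 : 2 * (x % y) ≤ x := by
    have := Nat.mod_lt x hy
    have h2 := Nat.div_add_mod x y
    have h3 : 1 ≤ x / y := Nat.div_pos hyx hy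
    nlinarith
  have h2 : 2 * (y * (x % y)) ≤ x * y := by nlinarith
  rw [pow_succ] at h
  omega

lemma gcdAux_cost {ℓ : ℕ} : ∀ {f n x y : ℕ}, y ≤ x → x * y < 2 ^ n → len x ≤ ℓ →
    (gcdAux f x y).cost ≤ (n + 1) * (2 * unit ℓ)
  | 0, _, _, _, _, _, _ => by simp [gcdAux]
  | f + 1, n, x, y, hyx, h, hx => by
    have hy : len y ≤ ℓ := (len_mono hyx).trans hx
    have h0 : len 0 ≤ ℓ := (len_mono (Nat.zero_le _)).trans hx
    have e := cost_eq_le hy h0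
    rw [gcdAux]
    by_cases hy0 : y = 0
    · simp only [cost_bind, val_eq, hy0, decide_true, if_true, cost_pure] at e ⊢
      nlinarith
    · simp only [cost_bind, val_eq, hy0, decide_false, Bool.false_eq_true, if_false, val_rem]
      have r := cost_rem_le hx hy
      obtain _ | n := n
      · have : 0 < x * y := Nat.mul_pos (by omega) (by omega)
        omega
      · have hlt := Nat.mod_lt x (Nat.pos_of_ne_zero hy0)
        have := gcdAux_cost (f := f) hlt.le (mul_mod_lt (Nat.pos_of_ne_zero hy0) hyx h) hy
        linarith

lemma gcd_cost {ℓ x y : ℕ} (hx : len x ≤ ℓ) (hy : len y ≤ ℓ) :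
    (gcd x y).cost ≤ (4 * ℓ + 4) * unit ℓ := by
  have h0 : len 0 ≤ ℓ := (len_mono (Nat.zero_le _)).trans hx
  have hsz : ∀ z, len z ≤ ℓ → z < 2 ^ ℓ := fun z hz =>
    (Nat.lt_size_self z).trans_le (Nat.pow_le_pow_right (by norm_num) (by simp [len] at hz; omega))
  have e := cost_eq_le hy h0
  have r := cost_rem_le hx hy
  -- One step is unfolded by hand: `gcdAux_cost` needs its arguments in descending order, which is
  -- guaranteed only after the first division.
  rw [gcd, gcdAux]
  by_cases hy0 : y = 0
  · simp only [cost_bind, val_eq, hy0, decide_true, if_true, cost_pure] at e ⊢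
    nlinarith
  · simp only [cost_bind, val_eq, hy0, decide_false, Bool.false_eq_true, if_false, val_rem]
    have hlt := Nat.mod_lt x (Nat.pos_of_ne_zero hy0)
    have h2 : y * (x % y) < 2 ^ (ℓ + ℓ) := by
      rw [pow_add]
      exact Nat.mul_lt_mul'' (hsz _ hy) (hlt.trans (hsz _ hy))
    have := gcdAux_cost (f := y) hlt.le h2 hy
    linarith

/-! ### Modular inverses -/

/-- The invariant is `tᵢ x ≡ rᵢ` modulo `m`. The new cofactor `t₀ - q t₁` is formed in natural
numbers by adding `m - (q t₁ mod m)`. -/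
lemma invAux_val {x m : ℕ} (hm : 0 < m) : ∀ {f r₀ r₁ t₀ t₁ : ℕ}, r₁ < f →
    t₀ * x ≡ r₀ [MOD m] → t₁ * x ≡ r₁ [MOD m] →
    (invAux m f r₀ r₁ t₀ t₁).val * x ≡ Nat.gcd r₀ r₁ [MOD m]
  | 0, _, _, _, _, h, _, _ => by omega
  | f + 1, r₀, r₁, t₀, t₁, h, h₀, h₁ => by
    rw [invAux]
    by_cases hr : r₁ = 0
    · simpa [hr] using h₀
    · simp only [val_bind, val_eq, hr, decide_false, Bool.false_eq_true, if_false, val_rem, val_quo,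
        val_mul, val_sub, val_add]
      have hlt := Nat.mod_lt r₀ (Nat.pos_of_ne_zero hr)
      rw [Nat.gcd_comm, Nat.gcd_rec, Nat.gcd_comm]
      refine invAux_val hm (by omega) h₁ ?_
      have hle : r₀ / r₁ * t₁ % m ≤ m := (Nat.mod_lt _ hm).le
      rw [← ZMod.natCast_eq_natCast_iff] at h₀ h₁ ⊢
      have hd : ((r₁ * (r₀ / r₁) + r₀ % r₁ : ℕ) : ZMod m) = r₀ := by rw [Nat.div_add_mod]
      push_cast at h₀ h₁ hd ⊢
      simp only [ZMod.natCast_mod]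
      rw [Nat.cast_add, Nat.cast_sub hle]
      simp only [ZMod.natCast_mod, ZMod.natCast_self]
      push_cast
      linear_combination h₀ - ((r₀ / r₁ : ℕ) : ZMod m) * h₁ - hd

/-- The alternative `r₁ = 0` covers `m = 1`: the start value `t₁ = 1` is not reduced there, but it
is never returned. -/
lemma invAux_lt {m : ℕ} (hm : 0 < m) : ∀ {f r₀ r₁ t₀ t₁ : ℕ}, t₀ < m → (t₁ < m ∨ r₁ = 0) →
    (invAux m f r₀ r₁ t₀ t₁).val < m
  | 0, _, _, _, _, h₀, _ => by simpa [invAux] using h₀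
  | f + 1, r₀, r₁, t₀, t₁, h₀, h₁ => by
    rw [invAux]
    by_cases hr : r₁ = 0
    · simpa [hr] using h₀
    · simp only [val_bind, val_eq, hr, decide_false, Bool.false_eq_true, if_false, val_rem, val_quo,
        val_mul, val_sub, val_add]
      exact invAux_lt hm (by tauto) (.inl (Nat.mod_lt _ hm))

lemma inv_val {x m : ℕ} (hm : 0 < m) (h : Nat.Coprime x m) : (inv x m).val * x ≡ 1 [MOD m] := by
  have h1 : (inv x m).val * x ≡ Nat.gcd m (x % m) [MOD m] := by
    simp only [inv, val_bind, val_rem]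
    refine invAux_val hm ((Nat.mod_lt x hm).trans (Nat.lt_succ_self m)) ?_ ?_
    · simpa using ((Nat.modEq_zero_iff_dvd (n := m)).2 dvd_rfl).symm
    · simpa using (Nat.mod_modEq x m).symm
  have h2 : Nat.gcd m (x % m) = 1 := by
    rwa [Nat.gcd_comm, ← Nat.gcd_rec, Nat.gcd_comm]
  rwa [h2] at h1

lemma inv_lt {m : ℕ} (x : ℕ) (hm : 0 < m) : (inv x m).val < m := by
  simp only [inv, val_bind, val_rem]
  refine invAux_lt hm hm ?_
  rcases Nat.lt_or_ge 1 m with h | h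
  · exact .inl h
  · exact .inr (by have := Nat.mod_lt x hm; omega)

lemma invAux_cost {m ℓ : ℕ} (hm : 0 < m) : ∀ {f n r₀ r₁ t₀ t₁ : ℕ}, r₁ ≤ r₀ → r₀ * r₁ < 2 ^ n →
    r₀ ≤ m → t₀ ≤ m → t₁ ≤ m → 2 * len m ≤ ℓ →
    (invAux m f r₀ r₁ t₀ t₁).cost ≤ (n + 1) * (8 * unit ℓ)
  | 0, _, _, _, _, _, _, _, _, _, _, _ => by simp [invAux]
  | f + 1, n, r₀, r₁, t₀, t₁, hr, h, h₀, ht₀, ht₁, hl => by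
    have lm := len_pos m
    have l0 : len 0 ≤ ℓ := by have := len_mono (Nat.zero_le m); omega
    have lr₀ := len_mono h₀
    have lr₁ := len_mono (hr.trans h₀)
    have lt₀ := len_mono ht₀
    have lt₁ := len_mono ht₁
    have e := cost_eq_le (x := r₁) (ℓ := ℓ) (by omega) l0
    rw [invAux]
    by_cases hr0 : r₁ = 0
    · simp only [cost_bind, val_eq, hr0, decide_true, if_true, cost_pure] at e ⊢
      nlinarith
    · simp only [cost_bind, val_eq, hr0, decide_false, Bool.false_eq_true, if_false, val_rem,
        val_quo, val_mul, val_sub, val_add]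
      have hq := len_div_le r₀ r₁
      have hp := len_mul_le (r₀ / r₁) t₁
      have hp' := len_mono (Nat.mod_lt (r₀ / r₁ * t₁) hm).le
      have hn := len_sub_le m (r₀ / r₁ * t₁ % m)
      have hs := len_add_le t₀ (m - r₀ / r₁ * t₁ % m)
      have c1 := cost_quo_le (x := r₀) (y := r₁) (ℓ := ℓ) (by omega) (by omega)
      have c2 := cost_rem_le (x := r₀) (y := r₁) (ℓ := ℓ) (by omega) (by omega)
      have c3 := cost_mul_le (x := r₀ / r₁) (y := t₁) (ℓ := ℓ) (by omega) (by omega)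
      have c4 := cost_rem_le (x := r₀ / r₁ * t₁) (y := m) (ℓ := ℓ) (by omega) (by omega)
      have c5 := cost_sub_le (x := m) (y := r₀ / r₁ * t₁ % m) (ℓ := ℓ) (by omega) (by omega)
      have c6 := cost_add_le (x := t₀) (y := m - r₀ / r₁ * t₁ % m) (ℓ := ℓ) (by omega) (by omega)
      have c7 := cost_rem_le (x := t₀ + (m - r₀ / r₁ * t₁ % m)) (y := m) (ℓ := ℓ)
        (by omega) (by omega)
      obtain _ | n := n
      · have : 0 < r₀ * r₁ := Nat.mul_pos (by omega) (by omega)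
        omega
      · have hlt := Nat.mod_lt r₀ (Nat.pos_of_ne_zero hr0)
        have := invAux_cost (f := f) (t₀ := t₁) hm hlt.le
          (mul_mod_lt (Nat.pos_of_ne_zero hr0) hr h) (hr.trans h₀) ht₁
          (Nat.mod_lt (t₀ + (m - r₀ / r₁ * t₁ % m)) hm).le hl
        linarith

lemma inv_cost {x m ℓ : ℕ} (hm : 0 < m) (hx : len x ≤ ℓ) (hl : 2 * len m ≤ ℓ) :
    (inv x m).cost ≤ (16 * ℓ + 9) * unit ℓ := by
  have lm := len_pos m
  have hlt := Nat.mod_lt x hm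
  have h2 : m * (x % m) < 2 ^ (ℓ + ℓ) := by
    have hm2 : m < 2 ^ ℓ :=
      (Nat.lt_size_self m).trans_le (Nat.pow_le_pow_right (by norm_num) (by simp [len] at hl; omega))
    rw [pow_add]
    exact Nat.mul_lt_mul'' hm2 (hlt.trans hm2)
  have c := cost_rem_le (x := x) (y := m) hx (by omega)
  have := invAux_cost (f := m + 1) (t₀ := 0) (t₁ := 1) hm hlt.le h2 le_rfl (Nat.zero_le _) hm hl
  simp only [inv, cost_bind, val_rem]
  linarith

/-! ### Square roots -/

/-- If `s = ⌊√⌊n/4⌋⌋`, then `(2s)² ≤ n < (2s + 2)²`, so one comparison with `(2s + 1)²` decides. -/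
lemma sqrtAux_val : ∀ {f n : ℕ}, n ≤ f → (sqrtAux f n).val = Nat.sqrt n
  | 0, n, h => by simp [sqrtAux, Nat.le_zero.1 h]
  | f + 1, n, h => by
    rw [sqrtAux]
    by_cases hn : n = 0
    · simp [hn]
    · simp only [val_bind, val_eq, hn, decide_false, Bool.false_eq_true, if_false, val_quo, val_mul,
        val_add, val_lt, val_ite, val_pure, decide_eq_true_eq]
      rw [sqrtAux_val (by omega)]
      have h1 := Nat.sqrt_le (n / 4)
      have h3 := Nat.lt_succ_sqrt (n / 4)
      set s := Nat.sqrt (n / 4)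
      have h4 := Nat.div_add_mod n 4
      have h5 := Nat.mod_lt n (show 0 < 4 by norm_num)
      have h6 : 4 * (n / 4) ≤ n := by omega
      simp only [Nat.succ_eq_add_one] at h3
      split_ifs with hc
      · rw [Nat.eq_sqrt]
        constructor <;> nlinarith
      · rw [Nat.eq_sqrt]
        constructor <;> nlinarith

lemma sqrt_val (n : ℕ) : (sqrt n).val = Nat.sqrt n := sqrtAux_val le_rfl

/-- Holds for every fuel, as the induction in `sqrtAux_cost` requires. -/
lemma sqrtAux_le : ∀ {f n : ℕ}, (sqrtAux f n).val ≤ n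
  | 0, n => by simp [sqrtAux]
  | f + 1, n => by
    rw [sqrtAux]
    by_cases hn : n = 0
    · simp [hn]
    · simp only [val_bind, val_eq, hn, decide_false, Bool.false_eq_true, if_false, val_quo, val_mul,
        val_add, val_lt, val_ite, val_pure, decide_eq_true_eq]
      have := sqrtAux_le (f := f) (n := n / 4)
      split_ifs <;> omega

lemma sqrtAux_cost {ℓ : ℕ} : ∀ {f k n : ℕ}, n < 2 ^ k → 2 * len n + 4 ≤ ℓ →
    (sqrtAux f n).cost ≤ (k + 1) * (6 * unit ℓ)
  | 0, _, _, _, _ => by simp [sqrtAux]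
  | f + 1, k, n, h, hl => by
    have l0 : len 0 ≤ ℓ := by simp; omega
    have e := cost_eq_le (x := n) (ℓ := ℓ) (by omega) l0
    rw [sqrtAux]
    by_cases hn : n = 0
    · simp only [cost_bind, val_eq, hn, decide_true, if_true, cost_pure] at e ⊢
      nlinarith
    · simp only [cost_bind, val_eq, hn, decide_false, Bool.false_eq_true, if_false, val_quo, val_mul,
        val_add, val_lt, decide_eq_true_eq, cost_ite, cost_pure, ite_self]
      obtain _ | k := k
      · omega
      have hs := sqrtAux_le (f := f) (n := n / 4)
      have ih := sqrtAux_cost (ℓ := ℓ) (f := f) (k := k) (n := n / 4) (by rw [pow_succ] at h; omega)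
        (by have := len_div_le n 4; omega)
      set s := (sqrtAux f (n / 4)).val
      have l1 := len_mono (show 2 * s ≤ n by omega)
      have l2 := len_mono (show 2 * s + 1 ≤ n by omega)
      have l3 := len_mono (show s ≤ n by omega)
      have l4 := len_mul_le (2 * s + 1) (2 * s + 1)
      have c1 := cost_quo_le (x := n) (y := 4) (ℓ := ℓ) (by omega) (by rw [len_four]; omega)
      have c2 := cost_mul_le (x := 2) (y := s) (ℓ := ℓ) (by rw [len_two]; omega) (by omega)
      have c3 := cost_add_le (x := 2 * s) (y := 1) (ℓ := ℓ) (by omega) (by rw [len_one]; omega)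
      have c4 := cost_mul_le (x := 2 * s + 1) (y := 2 * s + 1) (ℓ := ℓ) (by omega) (by omega)
      have c5 := cost_lt_le (x := n) (y := (2 * s + 1) * (2 * s + 1)) (ℓ := ℓ) (by omega) (by omega)
      linarith

lemma sqrt_cost {ℓ n : ℕ} (hl : 2 * len n + 4 ≤ ℓ) :
    (sqrt n).cost ≤ (6 * ℓ + 6) * unit ℓ := by
  have := sqrtAux_cost (f := n) (k := ℓ) (n := n) ((Nat.lt_size_self n).trans_le
    (Nat.pow_le_pow_right (by norm_num) (by simp [len] at hl; omega))) hl
  rw [sqrt]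
  linarith

lemma sqrtUp_val (n : ℕ) :
    (sqrtUp n).val = if Nat.sqrt n * Nat.sqrt n = n then Nat.sqrt n else Nat.sqrt n + 1 := by
  simp [sqrtUp, sqrt_val]

lemma sqrtUp_eq_ceil (n : ℕ) : (sqrtUp n).val = ⌈√(n : ℝ)⌉₊ := by
  rw [sqrtUp_val]
  have h1 : (Nat.sqrt n : ℝ) * Nat.sqrt n ≤ n := by exact_mod_cast Nat.sqrt_le n
  have h2 : (n : ℝ) < (Nat.sqrt n + 1) * (Nat.sqrt n + 1) := by
    exact_mod_cast Nat.lt_succ_sqrt n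
  have h0 : (0 : ℝ) ≤ Nat.sqrt n := Nat.cast_nonneg _
  split_ifs with h
  · have h3 : (Nat.sqrt n : ℝ) * Nat.sqrt n = n := by exact_mod_cast h
    rw [← h3, Real.sqrt_mul_self h0, Nat.ceil_natCast]
  · symm
    rw [Nat.ceil_eq_iff (by omega)]
    constructor
    · rw [Nat.add_sub_cancel]
      apply Real.lt_sqrt_of_sq_lt
      rw [sq]
      exact lt_of_le_of_ne h1 (by exact_mod_cast h)
    · push_cast
      rw [Real.sqrt_le_left (by linarith), sq]
      exact h2.le

lemma sqrtUp_eq_shift (N a b : ℕ) : (sqrtUp (4 * (a * b * N))).val = HypSieve.shift N a b := by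
  rw [sqrtUp_eq_ceil, HypSieve.shift]
  push_cast
  rw [Real.sqrt_mul (by norm_num), show (4 : ℝ) = 2 ^ 2 by norm_num,
    Real.sqrt_sq (by norm_num)]

lemma sqrtUp_le (n : ℕ) : (sqrtUp n).val ≤ n := by
  rw [sqrtUp_val]
  have h := Nat.sqrt_le_self n
  split_ifs with h1
  · exact h
  · rcases h.lt_or_eq with h2 | h2
    · exact h2
    · have h3 := Nat.sqrt_le n
      rw [h2] at h3 h1
      rcases Nat.lt_or_ge n 2 with h4 | h4
      · interval_cases n <;> simp at h1
      · nlinarith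

lemma sqrtUp_cost {ℓ n : ℕ} (hl : 2 * len n + 4 ≤ ℓ) :
    (sqrtUp n).cost ≤ (6 * ℓ + 9) * unit ℓ := by
  have c := sqrt_cost hl
  have h := len_mono (Nat.sqrt_le_self n)
  have h' := len_mono (Nat.sqrt_le n)
  have c1 := cost_mul_le (x := Nat.sqrt n) (y := Nat.sqrt n) (ℓ := ℓ) (by omega) (by omega)
  have c2 := cost_eq_le (x := Nat.sqrt n * Nat.sqrt n) (y := n) (ℓ := ℓ) (by omega) (by omega)
  have c3 := cost_add_le (x := Nat.sqrt n) (y := 1) (ℓ := ℓ) (by omega) (by rw [len_one]; omega)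
  simp only [sqrtUp, cost_bind, sqrt_val, val_mul, cost_ite, cost_pure]
  split_ifs <;> linarith

/-! ### Primes -/

lemma noDivisor_val (n : ℕ) : ∀ d : ℕ, (noDivisor n d).val = true ↔ ∀ e, 2 ≤ e → e ≤ d → ¬ e ∣ n
  | 0 => by simp [noDivisor]; intros; omega
  | 1 => by simp [noDivisor]; intros; omega
  | d + 2 => by
    rw [noDivisor]
    simp only [val_bind, val_eq, val_rem, val_ite, val_pure, decide_eq_true_eq,
      ← Nat.dvd_iff_mod_eq_zero]
    split_ifs with h
    · simp only [false_iff]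
      exact fun H => H _ (by omega) le_rfl h
    · rw [noDivisor_val n (d + 1)]
      refine ⟨fun H e he he' => ?_, fun H e he he' => H e he (by omega)⟩
      rcases he'.lt_or_eq with h1 | rfl
      · exact H e he (by omega)
      · exact h

lemma isPrime_val (n : ℕ) : (isPrime n).val = decide n.Prime := by
  rw [isPrime]
  simp only [val_bind, val_lt, val_ite, val_pure, decide_eq_true_eq, val_sub]
  split_ifs with h
  · have : ¬ n.Prime := fun hp => by have := hp.two_le; omega
    simp [this]
  · rw [Bool.eq_iff_iff, noDivisor_val, decide_eq_true_eq, Nat.prime_def_lt']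
    refine ⟨fun H => ⟨by omega, fun e he he' => H e he (by omega)⟩,
      fun H e he he' => H.2 e he (by omega)⟩

lemma noDivisor_cost {n ℓ : ℕ} (hn : len n ≤ ℓ) : ∀ {d : ℕ}, d < n →
    (noDivisor n d).cost ≤ d * (3 * unit ℓ)
  | 0, _ => by simp [noDivisor]
  | 1, _ => by simp [noDivisor]
  | d + 2, h => by
    have ld := len_mono h.le
    have l0 : len 0 ≤ ℓ := (len_mono (Nat.zero_le _)).trans hn
    have c1 := cost_rem_le (x := n) (y := d + 2) (ℓ := ℓ) hn (by omega)
    have c2 := cost_eq_le (x := n % (d + 2)) (ℓ := ℓ) ((len_mod_le _ _).trans hn) l0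
    have c3 := cost_read_le (x := d + 2) (ℓ := ℓ) (by omega)
    have ih := noDivisor_cost hn (d := d + 1) (by omega)
    rw [noDivisor]
    simp only [cost_bind, val_eq, val_rem, decide_eq_true_eq, cost_ite, cost_pure]
    split_ifs <;> linarith

lemma isPrime_cost {n ℓ : ℕ} (hl : len n + 3 ≤ ℓ) :
    (isPrime n).cost ≤ (n + 1) * (3 * unit ℓ) := by
  have c1 := cost_lt_le (x := n) (y := 2) (ℓ := ℓ) (by omega) (by rw [len_two]; omega)
  have c2 := cost_sub_le (x := n) (y := 1) (ℓ := ℓ) (by omega) (by rw [len_one]; omega)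
  rw [isPrime]
  simp only [cost_bind, val_lt, decide_eq_true_eq, cost_ite, cost_pure, val_sub]
  split_ifs with h
  · nlinarith
  · have c3 := noDivisor_cost (n := n) (ℓ := ℓ) (by omega) (d := n - 1) (by omega)
    have : (n - 1) * (3 * unit ℓ) ≤ n * (3 * unit ℓ) := Nat.mul_le_mul_right _ (by omega)
    linarith

lemma mem_primesIn (lo : ℕ) : ∀ n r : ℕ, r ∈ (primesIn lo n).val ↔ lo < r ∧ r ≤ n ∧ r.Prime
  | 0, r => by
    simp only [primesIn, val_pure, List.not_mem_nil, false_iff]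
    rintro ⟨h1, h2, h3⟩; omega
  | n + 1, r => by
    have ih := mem_primesIn lo n r
    rw [primesIn]
    simp only [val_bind, val_lt, val_ite, val_pure, decide_eq_true_eq, isPrime_val, val_cons]
    split_ifs with h1 h2
    · rw [List.mem_cons, ih]
      constructor
      · rintro (rfl | ⟨h3, h4, h5⟩)
        · exact ⟨h1, le_rfl, h2⟩
        · exact ⟨h3, by omega, h5⟩
      · rintro ⟨h3, h4, h5⟩
        rcases h4.lt_or_eq with h6 | h6
        · exact .inr ⟨h3, by omega, h5⟩
        · exact .inl h6
    · rw [ih]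
      constructor
      · rintro ⟨h3, h4, h5⟩
        exact ⟨h3, by omega, h5⟩
      · rintro ⟨h3, h4, h5⟩
        rcases h4.lt_or_eq with h6 | rfl
        · exact ⟨h3, by omega, h5⟩
        · exact absurd h5 h2
    · simp only [List.not_mem_nil, false_iff]
      rintro ⟨h3, h4, h5⟩; omega

lemma nodup_primesIn (lo : ℕ) : ∀ n : ℕ, (primesIn lo n).val.Nodup
  | 0 => by simp [primesIn]
  | n + 1 => by
    have ih := nodup_primesIn lo n
    rw [primesIn]
    simp only [val_bind, val_lt, val_ite, val_pure, decide_eq_true_eq, isPrime_val, val_cons]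
    split_ifs with h1 h2
    · refine List.nodup_cons.2 ⟨fun h => ?_, ih⟩
      have := ((mem_primesIn lo n _).1 h).2.1
      omega
    · exact ih
    · exact List.nodup_nil

lemma prod_val : ∀ l : List ℕ, (prod l).val = l.prod
  | [] => by simp [prod]
  | x :: l => by simp [prod, prod_val l]

lemma prod_primesIn (lo n : ℕ) : (primesIn lo n).val.prod = HypSieve.primeProd lo n := by
  have h : (Finset.Ioc lo n).filter Nat.Prime = (primesIn lo n).val.toFinset := by
    ext r
    simp [mem_primesIn, and_assoc]
  rw [HypSieve.primeProd, h, List.prod_toFinset _ (nodup_primesIn lo n)]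
  simp

lemma primesIn_cost {B ℓ lo : ℕ} (hl : len B + 3 ≤ ℓ) (hlo : lo ≤ B) : ∀ {n : ℕ}, n ≤ B →
    (primesIn lo n).cost ≤ n * ((B + 2) * (3 * unit ℓ))
  | 0, _ => by simp [primesIn]
  | n + 1, h => by
    have ln := len_mono h
    have llo := len_mono hlo
    have c1 := cost_read_le (x := n + 1) (ℓ := ℓ) (by omega)
    have c2 := cost_lt_le (x := lo) (y := n + 1) (ℓ := ℓ) (by omega) (by omega)
    have c3 := isPrime_cost (n := n + 1) (ℓ := ℓ) (by omega)
    have c4 := cost_cons_le (x := n + 1) (ℓ := ℓ) (by omega) (primesIn lo n).val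
    have ih := primesIn_cost hl hlo (n := n) (by omega)
    have : (n + 1 + 1) * (3 * unit ℓ) ≤ (B + 1) * (3 * unit ℓ) := Nat.mul_le_mul_right _ (by omega)
    rw [primesIn]
    simp only [cost_bind, val_lt, decide_eq_true_eq, cost_ite, cost_pure]
    split_ifs <;> linarith

lemma prod_cost {ℓ : ℕ} : ∀ {l : List ℕ}, (∀ x ∈ l, 0 < x) → len l.prod ≤ ℓ →
    (prod l).cost ≤ l.length * (2 * unit ℓ)
  | [], _, _ => by simp [prod]
  | x :: l, h, hl => by
    have hx : 0 < x := h x (by simp)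
    have hp : 0 < l.prod := List.prod_pos (fun y hy => h y (by simp [hy]))
    rw [List.prod_cons] at hl
    have l1 := len_mono (show x ≤ x * l.prod from Nat.le_mul_of_pos_right _ hp)
    have l2 := len_mono (show l.prod ≤ x * l.prod from Nat.le_mul_of_pos_left _ hx)
    have c1 := cost_read_le (x := x) (ℓ := ℓ) (by omega)
    have c2 := cost_mul_le (x := x) (y := l.prod) (ℓ := ℓ) (by omega) (by omega)
    have ih := prod_cost (ℓ := ℓ) (l := l) (fun y hy => h y (by simp [hy])) (by omega)
    rw [prod]
    simp only [cost_bind, prod_val, List.length_cons]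
    linarith

lemma firstDivisor_val (N : ℕ) : ∀ l : List ℕ,
    (firstDivisor N l).val = l.find? (fun x => decide (x ∣ N))
  | [] => by simp [firstDivisor]
  | x :: l => by
    rw [firstDivisor]
    simp only [val_bind, val_rem, val_eq, val_ite, val_pure, decide_eq_true_eq,
      firstDivisor_val N l, List.find?_cons, ← Nat.dvd_iff_mod_eq_zero]
    split_ifs with h <;> simp [h]

lemma firstDivisor_cost {N ℓ : ℕ} (hN : len N ≤ ℓ) : ∀ {l : List ℕ}, (∀ x ∈ l, len x ≤ ℓ) →
    (firstDivisor N l).cost ≤ l.length * (3 * unit ℓ)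
  | [], _ => by simp [firstDivisor]
  | x :: l, h => by
    have hx := h x (by simp)
    have l0 : len 0 ≤ ℓ := (len_mono (Nat.zero_le _)).trans hN
    have c1 := cost_read_le hx
    have c2 := cost_rem_le hN hx
    have c3 := cost_eq_le (x := N % x) (ℓ := ℓ) ((len_mod_le _ _).trans hN) l0
    have ih := firstDivisor_cost hN (l := l) (fun y hy => h y (by simp [hy]))
    rw [firstDivisor]
    simp only [cost_bind, val_rem, cost_ite, cost_pure, List.length_cons]
    split_ifs <;> linarith

/-! ### The sieve modulo a prime -/

/-- The least nonnegative integer representatives `t` of the shifted sieve set: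
`x y ≡ N` and `k x + y ≡ t + L` modulo `m` are solvable. -/
def InSieve (m N k L t : ℕ) : Prop :=
  ∃ x y : ℕ, x * y ≡ N [MOD m] ∧ k * x + y ≡ t + L [MOD m]

lemma existsY_val (r N k L t x : ℕ) : ∀ y : ℕ, (existsY r N k L t x y).val = true ↔
    ∃ y' < y, x * y' ≡ N [MOD r] ∧ k * x + y' ≡ t + L [MOD r]
  | 0 => by simp [existsY]
  | y + 1 => by
    have ih := existsY_val r N k L t x y
    rw [existsY]
    simp only [val_bind, val_mul, val_rem, val_add, val_eq, val_ite, val_pure, Bool.and_eq_true,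
      decide_eq_true_eq]
    split_ifs with h
    · simp only [true_iff]
      exact ⟨y, by omega, h⟩
    · rw [ih]
      constructor
      · rintro ⟨y', h1, h2⟩
        exact ⟨y', by omega, h2⟩
      · rintro ⟨y', h1, h2⟩
        rcases Nat.lt_succ_iff_lt_or_eq.1 h1 with h3 | rfl
        · exact ⟨y', h3, h2⟩
        · exact absurd h2 h

lemma existsXY_val (r N k L t : ℕ) : ∀ x : ℕ, (existsXY r N k L t x).val = true ↔
    ∃ x' < x, ∃ y < r, x' * y ≡ N [MOD r] ∧ k * x' + y ≡ t + L [MOD r]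
  | 0 => by simp [existsXY]
  | x + 1 => by
    have ih := existsXY_val r N k L t x
    rw [existsXY]
    simp only [val_bind, val_ite, val_pure, existsY_val]
    split_ifs with h
    · simp only [true_iff]
      exact ⟨x, by omega, h⟩
    · rw [ih]
      constructor
      · rintro ⟨x', h1, h2⟩
        exact ⟨x', by omega, h2⟩
      · rintro ⟨x', h1, h2⟩
        rcases Nat.lt_succ_iff_lt_or_eq.1 h1 with h3 | rfl
        · exact ⟨x', h3, h2⟩
        · exact absurd h2 h

/-- Both congruences depend only on `x` and `y` modulo `r`, so a search among least residues is
exhaustive. -/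
lemma existsXY_self {r : ℕ} (hr : 0 < r) (N k L t : ℕ) :
    (existsXY r N k L t r).val = true ↔ InSieve r N k L t := by
  rw [existsXY_val]
  constructor
  · rintro ⟨x, _, y, _, h⟩
    exact ⟨x, y, h⟩
  · rintro ⟨x, y, h1, h2⟩
    refine ⟨x % r, Nat.mod_lt _ hr, y % r, Nat.mod_lt _ hr, ?_, ?_⟩
    · exact ((Nat.mod_modEq x r).mul (Nat.mod_modEq y r)).trans h1
    · exact (((Nat.mod_modEq x r).mul_left k).add (Nat.mod_modEq y r)).trans h2

lemma mem_residuesBelow {r : ℕ} (hr : 0 < r) (N k L : ℕ) : ∀ t s : ℕ,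
    s ∈ (residuesBelow r N k L t).val ↔ s < t ∧ InSieve r N k L s
  | 0, s => by simp [residuesBelow]
  | t + 1, s => by
    have ih := mem_residuesBelow hr N k L t s
    rw [residuesBelow]
    simp only [val_bind, val_ite, val_pure, val_cons]
    split_ifs with h <;> rw [existsXY_self hr] at h
    · rw [List.mem_cons, ih]
      constructor
      · rintro (rfl | h1)
        · exact ⟨by omega, h⟩
        · exact ⟨by omega, h1.2⟩
      · rintro ⟨h1, h2⟩
        rcases Nat.lt_succ_iff_lt_or_eq.1 h1 with h3 | h3
        · exact .inr ⟨h3, h2⟩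
        · exact .inl h3
    · rw [ih]
      constructor
      · rintro ⟨h1, h2⟩
        exact ⟨by omega, h2⟩
      · rintro ⟨h1, h2⟩
        rcases Nat.lt_succ_iff_lt_or_eq.1 h1 with h3 | rfl
        · exact ⟨h3, h2⟩
        · exact absurd h2 h

lemma nodup_residuesBelow {r : ℕ} (hr : 0 < r) (N k L : ℕ) : ∀ t : ℕ,
    (residuesBelow r N k L t).val.Nodup
  | 0 => by simp [residuesBelow]
  | t + 1 => by
    have ih := nodup_residuesBelow hr N k L t
    rw [residuesBelow]
    simp only [val_bind, val_ite, val_pure, val_cons]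
    split_ifs with h
    · refine List.nodup_cons.2 ⟨fun h => ?_, ih⟩
      have := ((mem_residuesBelow hr N k L t _).1 h).1
      omega
    · exact ih

lemma residues_val (N k L : ℕ) : ∀ l : List ℕ,
    (residues N k L l).val = l.map (fun r => (r, (residuesBelow r N k L r).val))
  | [] => by simp [residues]
  | r :: l => by simp [residues, residues_val N k L l]

lemma existsY_cost {r N k L t x ℓ : ℕ} (ht : t < r) (hx : x < r)
    (hl : len r + len N + len k + len L + 2 * len r ≤ ℓ) : ∀ {y : ℕ}, y ≤ r →
    (existsY r N k L t x y).cost ≤ y * (11 * unit ℓ)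
  | 0, _ => by simp [existsY]
  | y + 1, h => by
    have ih := existsY_cost ht hx hl (y := y) (by omega)
    have p1 := len_pos r
    have p2 := len_pos N
    have p3 := len_pos k
    have p4 := len_pos L
    have lt := len_mono ht.le
    have lx := len_mono hx.le
    have ly := len_mono h
    have ly' := len_mono (show y ≤ r by omega)
    have l1 := len_mul_le x y
    have l2 := len_mul_le k x
    have l3 := len_add_le (k * x) y
    have l4 := len_add_le t L
    have l5 := len_mod_le (x * y) r
    have l6 := len_mod_le N r
    have l7 := len_mod_le (k * x + y) r
    have l8 := len_mod_le (t + L) r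
    have c0 := cost_read_le (x := y + 1) (ℓ := ℓ) (by omega)
    have c1 := cost_mul_le (x := x) (y := y) (ℓ := ℓ) (by omega) (by omega)
    have c2 := cost_rem_le (x := x * y) (y := r) (ℓ := ℓ) (by omega) (by omega)
    have c3 := cost_rem_le (x := N) (y := r) (ℓ := ℓ) (by omega) (by omega)
    have c4 := cost_mul_le (x := k) (y := x) (ℓ := ℓ) (by omega) (by omega)
    have c5 := cost_add_le (x := k * x) (y := y) (ℓ := ℓ) (by omega) (by omega)
    have c6 := cost_rem_le (x := k * x + y) (y := r) (ℓ := ℓ) (by omega) (by omega)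
    have c7 := cost_add_le (x := t) (y := L) (ℓ := ℓ) (by omega) (by omega)
    have c8 := cost_rem_le (x := t + L) (y := r) (ℓ := ℓ) (by omega) (by omega)
    have c9 := cost_eq_le (x := x * y % r) (y := N % r) (ℓ := ℓ) (by omega) (by omega)
    have c10 := cost_eq_le (x := (k * x + y) % r) (y := (t + L) % r) (ℓ := ℓ) (by omega) (by omega)
    rw [existsY]
    simp only [cost_bind, val_mul, val_rem, val_add, val_eq, Bool.and_eq_true,
      decide_eq_true_eq, cost_ite, cost_pure]
    split_ifs <;> linarith

lemma existsXY_cost {r N k L t ℓ : ℕ} (ht : t < r)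
    (hl : len r + len N + len k + len L + 2 * len r ≤ ℓ) : ∀ {x : ℕ}, x ≤ r →
    (existsXY r N k L t x).cost ≤ x * ((r + 1) * (11 * unit ℓ))
  | 0, _ => by simp [existsXY]
  | x + 1, h => by
    have ih := existsXY_cost ht hl (x := x) (by omega)
    have lx := len_mono h
    have c0 := cost_read_le (x := x + 1) (ℓ := ℓ) (by omega)
    have c1 := existsY_cost ht (show x < r by omega) hl le_rfl
    rw [existsXY]
    simp only [cost_bind, cost_ite, cost_pure]
    split_ifs <;> linarith

lemma residuesBelow_cost {r N k L ℓ : ℕ}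
    (hl : len r + len N + len k + len L + 2 * len r ≤ ℓ) : ∀ {t : ℕ}, t ≤ r →
    (residuesBelow r N k L t).cost ≤ t * ((r + 1) ^ 2 * (11 * unit ℓ))
  | 0, _ => by simp [residuesBelow]
  | t + 1, h => by
    have ih := residuesBelow_cost hl (t := t) (by omega)
    have l1 := len_mono h
    have l2 := len_mono (show t ≤ r by omega)
    have c0 := cost_read_le (x := t + 1) (ℓ := ℓ) (by omega)
    have c1 := existsXY_cost (show t < r by omega) hl le_rfl
    have c2 := cost_cons_le (x := t) (ℓ := ℓ) (by omega) (residuesBelow r N k L t).val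
    rw [residuesBelow]
    simp only [cost_bind, cost_ite, cost_pure]
    split_ifs <;> nlinarith

/-- Three nested loops, over `t`, `x` and `y`, cost a cube per prime. This brute force is harmless
because even the fourth power of `B₂` turns out to be `O(S)`. -/
lemma residues_cost {B N k L ℓ : ℕ} (hl : len B + len N + len k + len L + 2 * len B ≤ ℓ) :
    ∀ {l : List ℕ}, (∀ r ∈ l, r ≤ B) →
    (residues N k L l).cost ≤ l.length * ((B + 1) ^ 3 * (11 * unit ℓ))
  | [], _ => by simp [residues]
  | r :: l, h => by
    have ih := residues_cost hl (l := l) (fun y hy => h y (by simp [hy]))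
    have hr := h r (by simp)
    have l1 := len_mono hr
    have c0 := cost_read_le (x := r) (ℓ := ℓ) (by omega)
    have c1 := residuesBelow_cost (r := r) (N := N) (k := k) (L := L) (ℓ := ℓ) (by omega) le_rfl
    have h1 : r * (r + 1) ^ 2 + 1 ≤ (B + 1) ^ 3 := by
      have : r * (r + 1) ^ 2 + 1 ≤ (r + 1) ^ 3 := by nlinarith
      exact this.trans (Nat.pow_le_pow_left (by omega) 3)
    have h2 := Nat.mul_le_mul_right (11 * unit ℓ) h1
    rw [residues]
    simp only [cost_bind, cost_pure, List.length_cons]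
    nlinarith

/-! ### Chinese remaindering of the sieve -/

lemma InSieve.mono {m m' N k L t : ℕ} (h : InSieve m N k L t) (hm : m' ∣ m) :
    InSieve m' N k L t := by
  obtain ⟨x, y, h1, h2⟩ := h
  exact ⟨x, y, h1.of_dvd hm, h2.of_dvd hm⟩

/-- The points on the two hyperbolas are glued coordinate by coordinate. -/
lemma InSieve.mul {m m' N k L t : ℕ} (co : Nat.Coprime m m') (h : InSieve m N k L t)
    (h' : InSieve m' N k L t) : InSieve (m * m') N k L t := by
  obtain ⟨x, y, h1, h2⟩ := h
  obtain ⟨x', y', h1', h2'⟩ := h'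
  obtain ⟨X, hX, hX'⟩ := Nat.chineseRemainder co x x'
  obtain ⟨Y, hY, hY'⟩ := Nat.chineseRemainder co y y'
  refine ⟨X, Y, ?_, ?_⟩
  · rw [← Nat.modEq_and_modEq_iff_modEq_mul co]
    exact ⟨(hX.mul hY).trans h1, (hX'.mul hY').trans h1'⟩
  · rw [← Nat.modEq_and_modEq_iff_modEq_mul co]
    exact ⟨((hX.mul_left k).add hY).trans h2, ((hX'.mul_left k).add hY').trans h2'⟩

lemma InSieve.congr {m N k L t t' : ℕ} (h : InSieve m N k L t) (ht : t ≡ t' [MOD m]) :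
    InSieve m N k L t' := by
  obtain ⟨x, y, h1, h2⟩ := h
  exact ⟨x, y, h1, h2.trans (ht.add_right L)⟩

lemma InSieve.congr_coeff {m N k k' L t : ℕ} (h : InSieve m N k L t) (hk : k ≡ k' [MOD m]) :
    InSieve m N k' L t := by
  obtain ⟨x, y, h1, h2⟩ := h
  exact ⟨x, y, h1, ((hk.symm.mul_right x).add_right y).trans h2⟩

lemma exists_inSieve {m : ℕ} (hm : 0 < m) (N k L : ℕ) : ∃ t < m, InSieve m N k L t := by
  -- The residue of `k + N - L`, from the point `(1, N)`; the term `m * L - L` stands for `-L`.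
  refine ⟨(k + N + (m * L - L)) % m, Nat.mod_lt _ hm, ?_⟩
  refine InSieve.congr (t := k + N + (m * L - L)) ⟨1, N, by simp [Nat.ModEq], ?_⟩
    (Nat.mod_modEq _ _).symm
  have : L ≤ m * L := Nat.le_mul_of_pos_left _ hm
  rw [add_assoc (k + N), Nat.sub_add_cancel this, mul_one]
  simp [Nat.ModEq]

lemma inSieve_prod_iff {N k L t : ℕ} : ∀ {l : List ℕ}, l.Pairwise Nat.Coprime →
    (InSieve l.prod N k L t ↔ ∀ r ∈ l, InSieve r N k L t)
  | [], _ => by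
    simp only [List.prod_nil, List.not_mem_nil, false_implies, implies_true, iff_true]
    exact ⟨0, 0, Nat.modEq_one, Nat.modEq_one⟩
  | r :: l, h => by
    rw [List.pairwise_cons] at h
    have ih := inSieve_prod_iff (N := N) (k := k) (L := L) (t := t) h.2
    rw [List.prod_cons, List.forall_mem_cons, ← ih]
    exact ⟨fun H => ⟨H.mono (dvd_mul_right _ _), H.mono (dvd_mul_left _ _)⟩,
      fun H => H.1.mul (Nat.coprime_list_prod_right_iff.2 h.1) H.2⟩

/-! ### The odometer -/

/-- The idempotent that is `1` modulo `r` and `0` modulo `m / r`. -/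
def coef (m r : ℕ) : ℕ := m / r * (inv (m / r) r).val

/-- The distances of consecutive elements of `p :: l`, times `c`, modulo `m`. -/
def steps (r c m : ℕ) : ℕ → List ℕ → List ℕ
  | _, [] => []
  | p, x :: l => (x + (r - p)) * c % m :: steps r c m x l

/-- The distances of cyclically consecutive elements of `A`. -/
def dists (m r : ℕ) (A : List ℕ) : Array ℕ := (steps r (coef m r) m (A.getLastD 0) A).toArray

/-- The combination of residues whose indices are the digits of `j` in the mixed radix system given
by the numbers of residues. -/
def combination (m : ℕ) : List (ℕ × List ℕ) → ℕ → ℕ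
  | [], _ => 0
  | (r, A) :: R, j => A.getD (j % A.length) 0 * coef m r + combination m R (j / A.length)

/-- The position of the wheels after `j` turns. -/
def wheelsAt (m : ℕ) : List (ℕ × List ℕ) → ℕ → List Wheel
  | [], _ => []
  | (r, A) :: R, j => ⟨j % A.length, A.length, dists m r A⟩ :: wheelsAt m R (j / A.length)

/-- The number of combinations of residues. -/
def combinations (R : List (ℕ × List ℕ)) : ℕ := (R.map (fun p => p.2.length)).prod

@[simp] lemma length_steps (r c m : ℕ) : ∀ (p : ℕ) (l : List ℕ), (steps r c m p l).length = l.length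
  | _, [] => rfl
  | _, x :: l => by simp [steps, length_steps r c m x l]

lemma getD_steps (r c m : ℕ) : ∀ (p : ℕ) (l : List ℕ) (i : ℕ), i < l.length →
    (steps r c m p l).getD i 0 = (l.getD i 0 + (r - (p :: l).getD i 0)) * c % m
  | _, [], i, h => by simp at h
  | p, x :: l, 0, _ => by simp [steps]
  | p, x :: l, i + 1, h => by
    have := getD_steps r c m x l i (by simpa using h)
    simpa [steps] using this

lemma lastOf_val : ∀ (p : ℕ) (l : List ℕ), (lastOf p l).val = l.getLastD p
  | p, [] => by simp [lastOf]
  | p, x :: l => by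
    rw [lastOf, val_bind, lastOf_val x l, List.getLastD_cons]

lemma getLastD_eq_getD : ∀ (p : ℕ) (l : List ℕ), l.getLastD p = (p :: l).getD l.length 0
  | p, [] => by simp
  | p, x :: l => by
    rw [List.getLastD_cons, getLastD_eq_getD x l, List.length_cons, List.getD_cons_succ]

lemma distances_val (r c m : ℕ) : ∀ (p : ℕ) (l : List ℕ) (D : Array ℕ),
    (distances r c m p l D).val = D ++ (steps r c m p l).toArray
  | _, [], D => by simp [distances, steps]
  | p, x :: l, D => by
    rw [distances]
    simp only [val_bind, val_sub, val_add, val_mul, val_rem, val_push]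
    rw [distances_val r c m x l]
    simp [steps]

/-- Entry `i` of the distances is the step that leads to index `i` from its cyclic predecessor.
Subtraction of a residue `p` is replaced by addition of `r - p`; the surplus `r * coef m r` vanishes
modulo `m`. -/
lemma getD_dists {m r j : ℕ} {A : List ℕ} (hA : A ≠ []) (hr : ∀ a ∈ A, a ≤ r)
    (hm : m ∣ r * coef m r) :
    A.getD (j % A.length) 0 * coef m r + (dists m r A).getD ((j + 1) % A.length) 0 ≡
      A.getD ((j + 1) % A.length) 0 * coef m r [MOD m] := by
  have hpos : 0 < A.length := List.length_pos_of_ne_nil hA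
  have hlt := Nat.mod_lt (j + 1) hpos
  have hlt' := Nat.mod_lt j hpos
  have h1 : (dists m r A).getD ((j + 1) % A.length) 0 =
      (steps r (coef m r) m (A.getLastD 0) A).getD ((j + 1) % A.length) 0 := by
    simp [dists]
  -- With the last element put in front, the cyclic predecessor is the entry one place earlier, also
  -- when the index wraps to `0`.
  have h2 : (A.getLastD 0 :: A).getD ((j + 1) % A.length) 0 = A.getD (j % A.length) 0 := by
    rcases Nat.eq_zero_or_pos ((j + 1) % A.length) with h | h
    · have h3 : j % A.length = A.length - 1 := by
        have := Nat.add_mod j 1 A.length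
        rcases Nat.lt_or_ge (j % A.length + 1) A.length with h4 | h4
        · rw [Nat.add_mod, Nat.mod_eq_of_lt (a := 1) (by omega), Nat.mod_eq_of_lt h4] at h
          omega
        · omega
      rw [h, h3, List.getD_cons_zero, getLastD_eq_getD]
      obtain ⟨a, A', rfl⟩ := List.exists_cons_of_ne_nil hA
      simp
    · have h3 : (j + 1) % A.length = j % A.length + 1 := by
        have h5 : 1 % A.length = 1 := by
          rcases Nat.lt_or_ge 1 A.length with h6 | h6
          · exact Nat.mod_eq_of_lt h6
          · have h7 : A.length = 1 := by omega
            rw [h7, Nat.mod_one] at h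
            omega
        rcases Nat.lt_or_ge (j % A.length + 1) A.length with h4 | h4
        · rw [Nat.add_mod, h5, Nat.mod_eq_of_lt h4]
        · have h6 : j % A.length + 1 = A.length := by omega
          rw [Nat.add_mod, h5, h6, Nat.mod_self] at h
          omega
      rw [h3, List.getD_cons_succ]
  have hle : A.getD (j % A.length) 0 ≤ r := by
    rw [List.getD_eq_getElem _ _ hlt']
    exact hr _ (List.getElem_mem hlt')
  rw [h1, getD_steps _ _ _ _ _ _ hlt, h2]
  refine ((Nat.mod_modEq _ m).add_left _).trans ?_
  obtain ⟨d, rfl⟩ := Nat.exists_eq_add_of_le hle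
  generalize A.getD (j % A.length) 0 = u at *
  generalize A.getD ((j + 1) % A.length) 0 = v at *
  rw [Nat.add_sub_cancel_left, ← add_mul, show u + (v + d) = v + (u + d) by ring, add_mul]
  simpa using ((Nat.modEq_zero_iff_dvd.2 hm).add_left (v * coef m (u + d)))

/-- The carry rule: the quotient, which indexes the later wheels, moves exactly when the digit
returns to `0`; this is the test made by `turn`. -/
lemma succ_div_mod (κ j : ℕ) :
    (j % κ + 1) % κ = (j + 1) % κ ∧
      (((j + 1) % κ = 0 ∧ (j + 1) / κ = j / κ + 1) ∨ ((j + 1) % κ ≠ 0 ∧ (j + 1) / κ = j / κ)) := by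
  refine ⟨by simp, ?_⟩
  rw [Nat.succ_div]
  by_cases h : κ ∣ j + 1
  · exact .inl ⟨Nat.mod_eq_zero_of_dvd h, by simp [h]⟩
  · exact .inr ⟨fun h' => h (Nat.dvd_of_mod_eq_zero h'), by simp [h]⟩

/-- Admissible input for the odometer modulo `m`. -/
def Admissible (m : ℕ) (R : List (ℕ × List ℕ)) : Prop :=
  ∀ p ∈ R, p.2 ≠ [] ∧ (∀ a ∈ p.2, a < p.1) ∧ p.2.Nodup ∧ p.1 ∣ m

lemma Admissible.tail {m : ℕ} {p : ℕ × List ℕ} {R : List (ℕ × List ℕ)}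
    (h : Admissible m (p :: R)) : Admissible m R := fun q hq => h q (by simp [hq])

lemma dvd_mul_coef {m r : ℕ} (h : r ∣ m) : m ∣ r * coef m r := by
  rw [coef, ← mul_assoc, Nat.mul_div_cancel' h]
  exact dvd_mul_right _ _

/-- The offset `e` collects the contribution of the wheels already passed, which makes the induction
over the wheels possible. -/
lemma turn_val {m : ℕ} (hm : 0 < m) : ∀ {R : List (ℕ × List ℕ)} {e x j : ℕ}, Admissible m R →
    x < m → x ≡ e + combination m R j [MOD m] →
    (turn m x (wheelsAt m R j)).val.2 = wheelsAt m R (j + 1) ∧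
    (turn m x (wheelsAt m R j)).val.1 < m ∧
    (turn m x (wheelsAt m R j)).val.1 ≡ e + combination m R (j + 1) [MOD m]
  | [], e, x, j, _, hx, h => by simpa [turn, wheelsAt, combination] using ⟨hx, h⟩
  | (r, A) :: R, e, x, j, hR, hx, h => by
    obtain ⟨hA, hr, -, hrm⟩ := hR (r, A) (by simp)
    have key := getD_dists (j := j) hA (fun a ha => (hr a ha).le) (dvd_mul_coef hrm)
    obtain ⟨e1, e2⟩ := succ_div_mod A.length j
    simp only [combination] at h
    have hx' : (x + (dists m r A).getD ((j + 1) % A.length) 0) % m ≡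
        (e + A.getD ((j + 1) % A.length) 0 * coef m r) + combination m R (j / A.length)
          [MOD m] := by
      refine (Nat.mod_modEq _ _).trans ((h.add_right _).trans ?_)
      have := (key.add_left e).add_right (combination m R (j / A.length))
      convert this using 1
      ring
    have hlt := Nat.mod_lt (x + (dists m r A).getD ((j + 1) % A.length) 0) hm
    simp only [wheelsAt, combination]
    rw [turn]
    simp only [val_bind, val_add, val_rem, val_get, val_eq, e1, decide_eq_true_eq, val_ite]
    rcases e2 with ⟨h0, h1⟩ | ⟨h0, h1⟩
    · rw [if_pos h0, h1]
      obtain ⟨ih1, ih2, ih3⟩ := turn_val hm hR.tail hlt hx'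
      simp only [val_pure]
      exact ⟨by rw [ih1], ih2, by rw [← add_assoc]; exact ih3⟩
    · rw [if_neg h0, h1]
      simp only [val_pure]
      exact ⟨trivial, hlt, by rw [← add_assoc]; exact hx'⟩

lemma cycle_val {m : ℕ} (hm : 0 < m) {R : List (ℕ × List ℕ)} (hR : Admissible m R) :
    ∀ {n x j : ℕ}, x < m → x ≡ combination m R j [MOD m] →
    (cycle m n x (wheelsAt m R j)).val =
      (List.range n).map (fun i => combination m R (j + 1 + i) % m)
  | 0, x, j, _, _ => by simp [cycle]
  | n + 1, x, j, hx, h => by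
    obtain ⟨h1, h2, h3⟩ := turn_val hm (e := 0) hR hx (by simpa using h)
    rw [zero_add] at h3
    have ih := cycle_val hm hR (n := n) h2 h3
    rw [cycle]
    simp only [val_bind, val_cons]
    rw [h1, ih, List.range_succ_eq_map, List.map_cons, List.map_map]
    congr 1
    · rw [← Nat.mod_eq_of_lt h2]
      exact h3
    · refine List.map_congr_left (fun i _ => ?_)
      simp only [Function.comp]
      congr 2
      omega

lemma wheels_val {m : ℕ} : ∀ {R : List (ℕ × List ℕ)}, Admissible m R →
    (wheels m R).val = (combination m R 0 % m, combinations R, wheelsAt m R 0)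
  | [], _ => by simp [wheels, combination, combinations, wheelsAt]
  | (r, []) :: R, h => absurd rfl (h (r, []) (by simp)).1
  | (r, a :: A) :: R, h => by
    have ih := wheels_val h.tail
    rw [wheels]
    simp only [val_bind, val_quo, val_mul, lastOf_val, distances_val, val_length, ih, val_add,
      val_rem, val_pure]
    refine Prod.ext ?_ (Prod.ext ?_ ?_)
    · simp [combination, coef]
    · simp [combinations]
    · simp only [wheelsAt, dists, List.getLastD_cons]
      simp [coef]

lemma combinations_pos {m : ℕ} {R : List (ℕ × List ℕ)} (h : Admissible m R) :
    0 < combinations R := by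
  refine List.prod_pos (fun n hn => ?_)
  obtain ⟨p, hp, rfl⟩ := List.mem_map.1 hn
  exact List.length_pos_of_ne_nil (h p hp).1

lemma chinese_val {m : ℕ} (hm : 0 < m) {R : List (ℕ × List ℕ)} (hR : Admissible m R) :
    (chinese m R).val = (List.range (combinations R)).map (fun j => combination m R j % m) := by
  have hpos := combinations_pos hR
  rw [chinese]
  simp only [val_bind, wheels_val hR, val_eq, decide_eq_true_eq, hpos.ne', if_false, val_sub,
    val_cons]
  obtain ⟨n, hn⟩ := Nat.exists_eq_succ_of_ne_zero hpos.ne'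
  rw [cycle_val hm hR (Nat.mod_lt _ hm) (Nat.mod_modEq _ _), hn, List.range_succ_eq_map,
    List.map_cons, List.map_map]
  congr 1
  refine List.map_congr_left (fun i _ => ?_)
  simp only [Function.comp]
  congr 2
  omega

/-- The coefficients of the combination behave like idempotents. -/
def Separated (m : ℕ) (R : List (ℕ × List ℕ)) : Prop :=
  (∀ p ∈ R, coef m p.1 ≡ 1 [MOD p.1]) ∧
    R.Pairwise (fun p q => p.1 ∣ coef m q.1 ∧ q.1 ∣ coef m p.1)

lemma Separated.tail {m : ℕ} {p : ℕ × List ℕ} {R : List (ℕ × List ℕ)}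
    (h : Separated m (p :: R)) : Separated m R :=
  ⟨fun q hq => h.1 q (by simp [hq]), (List.pairwise_cons.1 h.2).2⟩

lemma dvd_combination {m r : ℕ} : ∀ {R : List (ℕ × List ℕ)} {j : ℕ}, (∀ p ∈ R, r ∣ coef m p.1) →
    r ∣ combination m R j
  | [], _, _ => by simp [combination]
  | (r', A) :: R, j, h => by
    rw [combination]
    exact dvd_add ((h (r', A) (by simp)).mul_left _)
      (dvd_combination (fun p hp => h p (by simp [hp])))

lemma combination_modEq_head {m r : ℕ} {A : List ℕ} {R : List (ℕ × List ℕ)} {j : ℕ}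
    (h : Separated m ((r, A) :: R)) :
    combination m ((r, A) :: R) j ≡ A.getD (j % A.length) 0 [MOD r] := by
  rw [combination]
  have h1 : coef m r ≡ 1 [MOD r] := h.1 (r, A) (by simp)
  have h2 : r ∣ combination m R (j / A.length) :=
    dvd_combination (fun p hp => ((List.pairwise_cons.1 h.2).1 p hp).1)
  simpa using (h1.mul_left (A.getD (j % A.length) 0)).add (Nat.modEq_zero_iff_dvd.2 h2)

lemma combination_modEq_tail {m r : ℕ} {A : List ℕ} {R : List (ℕ × List ℕ)} {j : ℕ}
    (h : Separated m ((r, A) :: R)) {p : ℕ × List ℕ} (hp : p ∈ R) :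
    combination m ((r, A) :: R) j ≡ combination m R (j / A.length) [MOD p.1] := by
  rw [combination]
  have h2 : p.1 ∣ A.getD (j % A.length) 0 * coef m r :=
    (((List.pairwise_cons.1 h.2).1 p hp).2).mul_left _
  simpa using (Nat.modEq_zero_iff_dvd.2 h2).add_right (combination m R (j / A.length))

lemma exists_mem_combination_modEq {m : ℕ} : ∀ {R : List (ℕ × List ℕ)} {j : ℕ},
    Admissible m R → Separated m R → ∀ p ∈ R, ∃ a ∈ p.2, combination m R j ≡ a [MOD p.1]
  | [], _, _, _, _, h => by simp at h
  | (r, A) :: R, j, hR, hs, p, hp => by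
    rcases List.mem_cons.1 hp with rfl | hp
    · have hlt := Nat.mod_lt j (List.length_pos_of_ne_nil (hR (r, A) (by simp)).1)
      refine ⟨A.getD (j % A.length) 0, ?_, combination_modEq_head hs⟩
      rw [List.getD_eq_getElem _ _ hlt]
      exact List.getElem_mem hlt
    · obtain ⟨a, ha, h⟩ :=
        exists_mem_combination_modEq (j := j / A.length) hR.tail hs.tail p hp
      exact ⟨a, ha, (combination_modEq_tail hs hp).trans h⟩

/-- The index is built digit by digit: if `y mod r` stands at position `i` of `A` and `j` serves the
remaining moduli, then `i + A.length * j` serves all of them. -/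
lemma exists_combination_modEq {m y : ℕ} : ∀ {R : List (ℕ × List ℕ)},
    Separated m R → (∀ p ∈ R, y % p.1 ∈ p.2) →
    ∃ j < combinations R, ∀ p ∈ R, combination m R j ≡ y [MOD p.1]
  | [], _, _ => ⟨0, by simp [combinations], by simp⟩
  | (r, A) :: R, hs, hy => by
    obtain ⟨j, hj, h⟩ := exists_combination_modEq hs.tail (fun p hp => hy p (by simp [hp]))
    obtain ⟨i, hi, hiy⟩ := List.getElem_of_mem (hy (r, A) (by simp))
    simp only at hi hiy
    have hmod : (i + A.length * j) % A.length = i := by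
      rw [Nat.add_mul_mod_self_left, Nat.mod_eq_of_lt hi]
    have hdiv : (i + A.length * j) / A.length = j := by
      rw [Nat.add_mul_div_left _ _ (by omega : 0 < A.length), Nat.div_eq_of_lt hi, zero_add]
    refine ⟨i + A.length * j, ?_, fun p hp => ?_⟩
    · simp only [combinations, List.map_cons, List.prod_cons] at hj ⊢
      have : A.length * (j + 1) ≤ A.length * (List.map (fun p => p.2.length) R).prod :=
        Nat.mul_le_mul_left _ hj
      linarith
    · rcases List.mem_cons.1 hp with rfl | hp
      · refine (combination_modEq_head hs).trans ?_
        rw [hmod, List.getD_eq_getElem _ _ hi, hiy]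
        exact Nat.mod_modEq _ _
      · refine (combination_modEq_tail hs hp).trans ?_
        rw [hdiv]
        exact h p hp

/-- The residue modulo the first modulus determines the lowest digit, since `A` consists of distinct
reduced residues; the other residues determine the quotient by induction. Thus the odometer repeats
nothing, and its running time is governed by the size of the set it lists. -/
lemma combination_injective {m : ℕ} : ∀ {R : List (ℕ × List ℕ)} {j j' : ℕ},
    Admissible m R → Separated m R → j < combinations R → j' < combinations R →
    (∀ p ∈ R, combination m R j ≡ combination m R j' [MOD p.1]) → j = j'
  | [], j, j', _, _, hj, hj', _ => by simp [combinations] at hj hj'; omega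
  | (r, A) :: R, j, j', hR, hs, hj, hj', h => by
    obtain ⟨hA, hlt, hnd, -⟩ := hR (r, A) (by simp)
    have hpos : 0 < A.length := List.length_pos_of_ne_nil hA
    simp only [combinations, List.map_cons, List.prod_cons] at hj hj'
    have h1 : j / A.length = j' / A.length := by
      refine combination_injective hR.tail hs.tail (Nat.div_lt_of_lt_mul hj)
        (Nat.div_lt_of_lt_mul hj') (fun p hp => ?_)
      exact (combination_modEq_tail hs hp).symm.trans
        ((h p (by simp [hp])).trans (combination_modEq_tail hs hp))
    have h2 : A.getD (j % A.length) 0 ≡ A.getD (j' % A.length) 0 [MOD r] :=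
      (combination_modEq_head hs).symm.trans ((h (r, A) (by simp)).trans (combination_modEq_head hs))
    have l1 := Nat.mod_lt j hpos
    have l2 := Nat.mod_lt j' hpos
    rw [List.getD_eq_getElem _ _ l1, List.getD_eq_getElem _ _ l2] at h2
    have h3 := h2.eq_of_lt_of_lt (hlt _ (List.getElem_mem l1)) (hlt _ (List.getElem_mem l2))
    have h4 := (hnd.getElem_inj_iff).1 h3
    rw [← Nat.div_add_mod j A.length, ← Nat.div_add_mod j' A.length, h1, h4]

/-! ### The sieve modulo a product of primes -/

/-- The residue class systems that the algorithm computes. -/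
def systems (N k L : ℕ) (l : List ℕ) : List (ℕ × List ℕ) :=
  l.map (fun r => (r, (residuesBelow r N k L r).val))

lemma admissible_systems {l : List ℕ} (hl : ∀ r ∈ l, 0 < r) (N k L : ℕ) :
    Admissible l.prod (systems N k L l) := by
  intro p hp
  obtain ⟨r, hr, rfl⟩ := List.mem_map.1 hp
  have hpos := hl r hr
  refine ⟨fun h => ?_, fun a ha => ((mem_residuesBelow hpos N k L r a).1 ha).1,
    nodup_residuesBelow hpos N k L r, List.dvd_prod hr⟩
  obtain ⟨t, ht⟩ := exists_inSieve hpos N k L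
  have := (mem_residuesBelow hpos N k L r t).2 ht
  simp only at h
  rw [h] at this
  simp at this

lemma coprime_prod_div {r : ℕ} : ∀ {l : List ℕ}, l.Pairwise Nat.Coprime → (∀ r ∈ l, 0 < r) → r ∈ l →
    Nat.Coprime (l.prod / r) r
  | [], _, _, h => by simp at h
  | x :: l, hl, hpos, h => by
    rw [List.pairwise_cons] at hl
    rcases List.mem_cons.1 h with rfl | h
    · rw [List.prod_cons, Nat.mul_div_cancel_left _ (hpos r (by simp))]
      exact (Nat.coprime_list_prod_right_iff.2 hl.1).symm
    · rw [List.prod_cons, Nat.mul_div_assoc _ (List.dvd_prod h)]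
      exact Nat.Coprime.mul_left (hl.1 r h)
        (coprime_prod_div hl.2 (fun y hy => hpos y (by simp [hy])) h)

lemma dvd_prod_div {r r' : ℕ} {l : List ℕ} (hl : ∀ r ∈ l, 0 < r) (h : r ∈ l) (h' : r' ∈ l)
    (co : Nat.Coprime r r') : r ∣ l.prod / r' := by
  have h1 : r * r' ∣ l.prod := co.mul_dvd_of_dvd_of_dvd (List.dvd_prod h) (List.dvd_prod h')
  obtain ⟨c, hc⟩ := h1
  rw [hc, show r * r' * c = r' * (r * c) by ring, Nat.mul_div_cancel_left _ (hl r' h')]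
  exact dvd_mul_right _ _

lemma separated_systems {l : List ℕ} (co : l.Pairwise Nat.Coprime) (hl : ∀ r ∈ l, 0 < r)
    (N k L : ℕ) : Separated l.prod (systems N k L l) := by
  constructor
  · intro p hp
    obtain ⟨r, hr, rfl⟩ := List.mem_map.1 hp
    have := inv_val (hl r hr) (coprime_prod_div co hl hr)
    rwa [mul_comm] at this
  · rw [systems, List.pairwise_map]
    refine co.imp_of_mem (fun {r r'} hr hr' h => ⟨?_, ?_⟩)
    · exact (dvd_prod_div hl hr hr' h).mul_right _
    · exact (dvd_prod_div hl hr' hr h.symm).mul_right _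

lemma modEq_prod_iff {a b : ℕ} {l : List ℕ} (co : l.Pairwise Nat.Coprime) :
    a ≡ b [MOD l.prod] ↔ ∀ r ∈ l, a ≡ b [MOD r] := by
  have := Nat.modEq_list_map_prod_iff (a := a) (b := b) (s := id) (l := l) co
  simpa using this

lemma mem_chinese_systems {l : List ℕ} (co : l.Pairwise Nat.Coprime) (hl : ∀ r ∈ l, 0 < r)
    (N k L t : ℕ) :
    t ∈ (chinese l.prod (systems N k L l)).val ↔
    t < l.prod ∧ InSieve l.prod N k L t := by
  have hm : 0 < l.prod := List.prod_pos hl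
  have hR := admissible_systems hl N k L
  have hs := separated_systems co hl N k L
  rw [chinese_val hm hR, List.mem_map]
  constructor
  · rintro ⟨j, -, rfl⟩
    refine ⟨Nat.mod_lt _ hm, (inSieve_prod_iff co).2 (fun r hr => ?_)⟩
    obtain ⟨a, ha, h⟩ := exists_mem_combination_modEq (j := j) hR hs
      (r, (residuesBelow r N k L r).val) (List.mem_map.2 ⟨r, hr, rfl⟩)
    refine ((mem_residuesBelow (hl r hr) N k L r a).1 ha).2.congr ?_
    exact h.symm.trans ((Nat.mod_modEq _ l.prod).symm.of_dvd (List.dvd_prod hr))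
  · rintro ⟨ht, h⟩
    rw [inSieve_prod_iff co] at h
    obtain ⟨j, hj, h'⟩ := exists_combination_modEq (y := t) hs (fun p hp => by
      obtain ⟨r, hr, rfl⟩ := List.mem_map.1 hp
      exact (mem_residuesBelow (hl r hr) N k L r _).2
        ⟨Nat.mod_lt _ (hl r hr), (h r hr).congr (Nat.mod_modEq _ _).symm⟩)
    refine ⟨j, List.mem_range.2 hj, ?_⟩
    have : combination l.prod (systems N k L l) j ≡ t [MOD l.prod] :=
      (modEq_prod_iff co).2 (fun r hr => h' _ (List.mem_map.2 ⟨r, hr, rfl⟩))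
    rwa [Nat.ModEq, Nat.mod_eq_of_lt ht] at this

lemma nodup_chinese_systems {l : List ℕ} (co : l.Pairwise Nat.Coprime) (hl : ∀ r ∈ l, 0 < r)
    (N k L : ℕ) : (chinese l.prod (systems N k L l)).val.Nodup := by
  have hm : 0 < l.prod := List.prod_pos hl
  have hR := admissible_systems hl N k L
  have hs := separated_systems co hl N k L
  rw [chinese_val hm hR]
  refine List.Nodup.map_on (fun j hj j' hj' h => ?_) List.nodup_range
  refine combination_injective hR hs (List.mem_range.1 hj) (List.mem_range.1 hj') (fun p hp => ?_)
  exact Nat.ModEq.of_dvd (hR p hp).2.2.2 h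

lemma length_chinese_systems {l : List ℕ} (hl : ∀ r ∈ l, 0 < r) (N k L : ℕ) :
    (chinese l.prod (systems N k L l)).val.length =
    (l.map (fun r => (residuesBelow r N k L r).val.length)).prod := by
  rw [chinese_val (List.prod_pos hl) (admissible_systems hl N k L)]
  simp [combinations, systems, Function.comp_def]

/-! ### The cost of Chinese remaindering -/

lemma length_le_of_forall_lt {A : List ℕ} {r : ℕ} (hnd : A.Nodup) (h : ∀ a ∈ A, a < r) :
    A.length ≤ r := by
  rw [← List.toFinset_card_of_nodup hnd, ← Finset.card_range r]
  exact Finset.card_le_card (fun a ha => by simpa using h a (by simpa using ha))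

lemma coef_le {m r : ℕ} (hr : 0 < r) : coef m r ≤ m :=
  (Nat.mul_le_mul_left _ (inv_lt (m / r) hr).le).trans (Nat.div_mul_le_self m r)

lemma distances_cost {r c m ℓ : ℕ} (hm : 0 < m) (hr : r ≤ m) (hc : c ≤ m) (hl : 3 * len m ≤ ℓ) :
    ∀ {p : ℕ} {l : List ℕ} {D : Array ℕ}, p ≤ r → (∀ a ∈ l, a < r) → D.size + l.length ≤ m →
    (distances r c m p l D).cost ≤ l.length * (6 * unit ℓ)
  | _, [], _, _, _, _ => by simp [distances]
  | p, x :: l, D, hp, h, hD => by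
    have hx := h x (by simp)
    rw [List.length_cons] at hD
    have ih := distances_cost hm hr hc hl (p := x) (l := l)
      (D := D.push ((x + (r - p)) * c % m)) hx.le (fun a ha => h a (by simp [ha]))
      (by simp; omega)
    have lm := len_pos m
    have l1 := len_mono hr
    have l2 := len_mono hc
    have l3 := len_mono (hx.le.trans hr)
    have l4 := len_mono (hp.trans hr)
    have l5 := len_mono ((Nat.sub_le r p).trans hr)
    have l6 := len_add_le x (r - p)
    have l7 := len_mul_le (x + (r - p)) c
    have l8 := len_mono (Nat.mod_lt ((x + (r - p)) * c) hm).le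
    have l9 := len_mono (show D.size ≤ m by omega)
    have c1 := cost_read_le (x := x) (ℓ := ℓ) (by omega)
    have c2 := cost_sub_le (x := r) (y := p) (ℓ := ℓ) (by omega) (by omega)
    have c3 := cost_add_le (x := x) (y := r - p) (ℓ := ℓ) (by omega) (by omega)
    have c4 := cost_mul_le (x := x + (r - p)) (y := c) (ℓ := ℓ) (by omega) (by omega)
    have c5 := cost_rem_le (x := (x + (r - p)) * c) (y := m) (ℓ := ℓ) (by omega) (by omega)
    have c6 := cost_push_le (A := D) (x := (x + (r - p)) * c % m) (ℓ := ℓ) (by omega) (by omega)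
    rw [distances]
    simp only [cost_bind, val_sub, val_add, val_mul, val_rem, val_push, List.length_cons]
    linarith

lemma lastOf_cost {ℓ : ℕ} : ∀ {p : ℕ} {l : List ℕ}, (∀ a ∈ l, len a ≤ ℓ) →
    (lastOf p l).cost ≤ l.length * unit ℓ
  | _, [], _ => by simp [lastOf]
  | p, x :: l, h => by
    have ih := lastOf_cost (p := x) (l := l) (fun a ha => h a (by simp [ha]))
    have c := cost_read_le (h x (by simp))
    rw [lastOf]
    simp only [cost_bind, List.length_cons]
    linarith

lemma combinations_le : ∀ {m : ℕ} {R : List (ℕ × List ℕ)}, Admissible m R →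
    combinations R ≤ (R.map Prod.fst).prod
  | _, [], _ => by simp [combinations]
  | m, (r, A) :: R, h => by
    obtain ⟨-, h1, h2, -⟩ := h (r, A) (by simp)
    have ih := combinations_le h.tail
    simp only [combinations, List.map_cons, List.prod_cons] at ih ⊢
    exact Nat.mul_le_mul (length_le_of_forall_lt h2 h1) ih

/-- For each modulus, `16 * ℓ + 9` units pay for the inverse, at most `7 * B` for the passes of
`lastOf` and `distances` over the residues, and nine for single operations. -/
lemma wheels_cost {m B ℓ : ℕ} (hm : 0 < m) (hl : 4 * len m ≤ ℓ) : ∀ {R : List (ℕ × List ℕ)},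
    Admissible m R → (R.map Prod.fst).prod ≤ m → (∀ p ∈ R, 0 < p.1 ∧ p.1 ≤ B) →
    (wheels m R).cost ≤ R.length * ((16 * ℓ + 18 + 7 * B) * unit ℓ)
  | [], _, _, _ => by simp [wheels]
  | (r, []) :: R, h, _, _ => absurd rfl (h (r, []) (by simp)).1
  | (r, a :: A) :: R, h, hp, hB => by
    obtain ⟨-, h1, h2, h3⟩ := h (r, a :: A) (by simp)
    obtain ⟨hr, hrB⟩ := hB (r, a :: A) (by simp)
    simp only at h1 h2 h3 hr hrB
    simp only [List.map_cons, List.prod_cons] at hp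
    have hRm : (R.map Prod.fst).prod ≤ m := (Nat.le_mul_of_pos_left _ hr).trans hp
    have ih := wheels_cost hm hl h.tail hRm (fun p hp => hB p (by simp [hp]))
    have hval := wheels_val h.tail
    have hlen := length_le_of_forall_lt h2 h1
    rw [List.length_cons] at hlen
    have hrm : r ≤ m := Nat.le_of_dvd hm h3
    have ha : a < r := h1 a (by simp)
    have hlast : A.getLastD a ≤ r := by
      refine (h1 _ ?_).le
      rw [List.getLastD_eq_getLast?]
      rcases h5 : A.getLast? with _ | z
      · simp
      · simp [List.mem_of_getLast? h5]
    have hc : m / r * (inv (m / r) r).val ≤ m := coef_le hr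
    have lm := len_pos m
    have l1 := len_mono hrm
    have l2 := len_mono (ha.le.trans hrm)
    have l3 := len_div_le m r
    have l4 := len_mono ((inv_lt (m / r) hr).le.trans hrm)
    have l5 := len_mono hc
    have l6 := len_mono ((combinations_le h.tail).trans hRm)
    have l7 := len_mono (Nat.mod_lt (combination m R 0) hm).le
    have l8 := len_mono (hlen.trans hrm)
    have l9 := len_mul_le a (m / r * (inv (m / r) r).val)
    have l10 := len_add_le (a * (m / r * (inv (m / r) r).val)) (combination m R 0 % m)
    have c1 := cost_read_le (x := r) (ℓ := ℓ) (by omega)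
    have c2 := cost_read_le (x := a) (ℓ := ℓ) (by omega)
    have c3 := cost_quo_le (x := m) (y := r) (ℓ := ℓ) (by omega) (by omega)
    have c4 := inv_cost (x := m / r) (m := r) (ℓ := ℓ) hr (by omega) (by omega)
    have c5 := cost_mul_le (x := m / r) (y := (inv (m / r) r).val) (ℓ := ℓ) (by omega) (by omega)
    have c6 := lastOf_cost (ℓ := ℓ) (p := a) (l := A) (fun x hx => by
      have := len_mono ((h1 x (by simp [hx])).le.trans hrm)
      omega)
    have c7 := distances_cost (ℓ := ℓ) hm hrm hc (by omega) (p := A.getLastD a) (l := a :: A)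
      (D := #[]) hlast h1 (by simp; omega)
    have c8 := cost_length_le (ℓ := ℓ) (A := (steps r (m / r * (inv (m / r) r).val) m
      (A.getLastD a) (a :: A)).toArray) (by simp; omega)
    have c9 := cost_mul_le (x := a) (y := m / r * (inv (m / r) r).val) (ℓ := ℓ)
      (by omega) (by omega)
    have c10 := cost_add_le (x := a * (m / r * (inv (m / r) r).val)) (y := combination m R 0 % m)
      (ℓ := ℓ) (by omega) (by omega)
    have c11 := cost_rem_le (x := a * (m / r * (inv (m / r) r).val) + combination m R 0 % m) (y := m)
      (ℓ := ℓ) (by omega) (by omega)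
    have c12 := cost_mul_le (x := A.length + 1) (y := combinations R) (ℓ := ℓ) (by omega) (by omega)
    have e1 : (A.length + 1) * unit ℓ ≤ B * unit ℓ := Nat.mul_le_mul_right _ (by omega)
    rw [wheels]
    simp only [cost_bind, val_quo, val_mul, lastOf_val, distances_val, val_length, hval, val_add,
      val_rem, cost_pure, List.length_cons, Array.empty_append, List.size_toArray, length_steps]
      at *
    linarith

/-- A carry through all wheels is charged to every turn, without amortization. The number of wheels
is at most the length of the modulus (`length_primesIn_le_len`), so this costs one logarithmic
factor. -/
lemma turn_cost {m ℓ : ℕ} (hm : 0 < m) (hl : 3 * len m ≤ ℓ) :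
    ∀ {R : List (ℕ × List ℕ)} {x j : ℕ}, Admissible m R → x < m →
    (turn m x (wheelsAt m R j)).cost ≤ R.length * (6 * unit ℓ)
  | [], _, _, _, _ => by simp [turn, wheelsAt]
  | (r, A) :: R, x, j, hR, hx => by
    obtain ⟨hA, hr, hnd, hrm⟩ := hR (r, A) (by simp)
    simp only at hA hr hnd hrm
    have hκ : 0 < A.length := List.length_pos_of_ne_nil hA
    have hAm : A.length ≤ m := (length_le_of_forall_lt hnd hr).trans (Nat.le_of_dvd hm hrm)
    obtain ⟨e1, e2⟩ := succ_div_mod A.length j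
    have hlt := Nat.mod_lt (x + (dists m r A).getD ((j + 1) % A.length) 0) hm
    have hd : (dists m r A).getD ((j + 1) % A.length) 0 ≤ m := by
      have h1 : (dists m r A).getD ((j + 1) % A.length) 0 =
          (steps r (coef m r) m (A.getLastD 0) A).getD ((j + 1) % A.length) 0 := by
        simp [dists]
      rw [h1, getD_steps _ _ _ _ _ _ (Nat.mod_lt _ hκ)]
      exact (Nat.mod_lt _ hm).le
    have ih := turn_cost hm hl (j := j / A.length) hR.tail hlt
    have lm := len_pos m
    have l0 := len_mono (Nat.zero_le m)
    have l1 := len_mono ((Nat.mod_lt j hκ).le.trans hAm)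
    have l2 := len_mono (show j % A.length + 1 ≤ m by have := Nat.mod_lt j hκ; omega)
    have l3 := len_mono hAm
    have l4 := len_mono ((Nat.mod_lt (j + 1) hκ).le.trans hAm)
    have l5 := len_mono hd
    have l6 := len_mono hx.le
    have l7 := len_add_le x ((dists m r A).getD ((j + 1) % A.length) 0)
    have l8 := len_mono (show 1 ≤ m from hm)
    have c1 := cost_add_le (x := j % A.length) (y := 1) (ℓ := ℓ) (by omega) (by omega)
    have c2 := cost_rem_le (x := j % A.length + 1) (y := A.length) (ℓ := ℓ) (by omega) (by omega)
    have c3 := cost_get_le (A := dists m r A) (i := (j + 1) % A.length) (ℓ := ℓ)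
      (by omega) (by omega)
    have c4 := cost_add_le (x := x) (y := (dists m r A).getD ((j + 1) % A.length) 0) (ℓ := ℓ)
      (by omega) (by omega)
    have c5 := cost_rem_le (x := x + (dists m r A).getD ((j + 1) % A.length) 0) (y := m) (ℓ := ℓ)
      (by omega) (by omega)
    have c6 := cost_eq_le (x := (j + 1) % A.length) (y := 0) (ℓ := ℓ) (by omega) (by omega)
    simp only [wheelsAt]
    rw [turn]
    simp only [cost_bind, val_add, val_rem, val_get, val_eq, e1, decide_eq_true_eq, cost_ite,
      List.length_cons, cost_pure]
    split_ifs <;> linarith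

lemma cycle_cost {m ℓ : ℕ} (hm : 0 < m) (hl : 3 * len m ≤ ℓ) {R : List (ℕ × List ℕ)}
    (hR : Admissible m R) : ∀ {n x j : ℕ}, n ≤ m → x < m → x ≡ combination m R j [MOD m] →
    (cycle m n x (wheelsAt m R j)).cost ≤ n * ((6 * R.length + 2) * unit ℓ)
  | 0, _, _, _, _, _ => by simp [cycle]
  | n + 1, x, j, hn, hx, h => by
    obtain ⟨h1, h2, h3⟩ := turn_val hm (e := 0) hR hx (by simpa using h)
    rw [zero_add] at h3
    have ih := cycle_cost hm hl hR (n := n) (by omega) h2 h3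
    have l1 := len_mono hn
    have l2 := len_mono h2.le
    have c1 := cost_read_le (x := n + 1) (ℓ := ℓ) (by omega)
    have c2 := turn_cost hm hl (j := j) hR hx
    have c3 := cost_cons_le (x := (turn m x (wheelsAt m R j)).val.1) (ℓ := ℓ) (by omega)
      (cycle m n (turn m x (wheelsAt m R j)).val.1 (wheelsAt m R (j + 1))).val
    rw [cycle]
    simp only [cost_bind]
    rw [h1]
    linarith

lemma chinese_cost {m B ℓ : ℕ} (hm : 0 < m) (hl : 4 * len m ≤ ℓ) {R : List (ℕ × List ℕ)}
    (hR : Admissible m R) (hp : (R.map Prod.fst).prod ≤ m) (hB : ∀ p ∈ R, 0 < p.1 ∧ p.1 ≤ B) :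
    (chinese m R).cost ≤ R.length * ((16 * ℓ + 18 + 7 * B) * unit ℓ) +
      combinations R * ((6 * R.length + 2) * unit ℓ) + 3 * unit ℓ := by
  have hpos := combinations_pos hR
  have hle := (combinations_le hR).trans hp
  have l0 := len_mono (Nat.zero_le m)
  have l1 := len_mono (show 1 ≤ m from hm)
  have l2 := len_mono hle
  have l3 := len_mono (Nat.mod_lt (combination m R 0) hm).le
  have c1 := wheels_cost hm hl hR hp hB
  have c2 := cost_eq_le (x := combinations R) (y := 0) (ℓ := ℓ) (by omega) (by omega)
  have c3 := cost_sub_le (x := combinations R) (y := 1) (ℓ := ℓ) (by omega) (by omega)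
  have c4 := cycle_cost hm (by omega : 3 * len m ≤ ℓ) hR (n := combinations R - 1) (j := 0)
    (by omega) (Nat.mod_lt _ hm) (Nat.mod_modEq _ _)
  have c5 := cost_cons_le (x := combination m R 0 % m) (ℓ := ℓ) (by omega)
    (cycle m (combinations R - 1) (combination m R 0 % m) (wheelsAt m R 0)).val
  have c6 : (combinations R - 1) * ((6 * R.length + 2) * unit ℓ) ≤
      combinations R * ((6 * R.length + 2) * unit ℓ) := Nat.mul_le_mul_right _ (by omega)
  rw [chinese]
  simp only [cost_bind, wheels_val hR, val_eq, decide_eq_true_eq, hpos.ne', if_false, val_sub]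
  linarith

/-! ### Sorting -/

lemma split_perm : ∀ l : List ℕ, ((split l).val.1 ++ (split l).val.2).Perm l
  | [] => by simp [split]
  | [x] => by simp [split]
  | x :: y :: l => by
    have ih := split_perm l
    simp only [split, val_bind, val_cons, val_pure]
    rw [List.cons_append]
    exact (List.perm_middle.trans (ih.cons y)).cons x

lemma split_length : ∀ l : List ℕ,
    (split l).val.1.length = (l.length + 1) / 2 ∧ (split l).val.2.length = l.length / 2
  | [] => by simp [split]
  | [x] => by simp [split]
  | x :: y :: l => by
    have ih := split_length l
    simp only [split, val_bind, val_cons, val_pure, List.length_cons]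
    omega

lemma split_cost {ℓ : ℕ} : ∀ {l : List ℕ}, (∀ x ∈ l, len x ≤ ℓ) →
    (split l).cost ≤ l.length * (2 * unit ℓ)
  | [], _ => by simp [split]
  | [x], h => by
    have c1 := cost_read_le (h x (by simp))
    have c2 := cost_cons_le (h x (by simp)) []
    simp only [split, cost_bind, cost_pure, List.length_cons, List.length_nil]
    linarith
  | x :: y :: l, h => by
    have ih := split_cost (l := l) (fun z hz => h z (by simp [hz]))
    have c1 := cost_read_le (h x (by simp))
    have c2 := cost_read_le (h y (by simp))
    have c3 := cost_cons_le (h x (by simp)) (split l).val.1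
    have c4 := cost_cons_le (h y (by simp)) (split l).val.2
    simp only [split, cost_bind, cost_pure, List.length_cons]
    linarith

lemma merge_perm (l l' : List ℕ) : (merge l l').val.Perm (l ++ l') := by
  fun_induction merge l l' with
  | case1 l => simp
  | case2 l => simp
  | case3 x l y l' ih1 ih2 =>
    simp only [val_bind, val_lt, decide_eq_true_eq, val_ite, val_cons]
    split_ifs
    · exact (ih1.cons y).trans List.perm_middle.symm
    · exact ih2.cons x

lemma merge_sorted (l l' : List ℕ) (h : l.Pairwise (· ≤ ·)) (h' : l'.Pairwise (· ≤ ·)) :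
    (merge l l').val.Pairwise (· ≤ ·) := by
  fun_induction merge l l' with
  | case1 l => simpa using h'
  | case2 l => simpa using h
  | case3 x l y l' ih1 ih2 =>
    simp only [val_bind, val_lt, decide_eq_true_eq, val_ite, val_cons]
    have hx := List.pairwise_cons.1 h
    have hy := List.pairwise_cons.1 h'
    split_ifs with hc
    · refine List.pairwise_cons.2 ⟨fun z hz => ?_, ih1 h hy.2⟩
      rcases List.mem_append.1 ((merge_perm _ _).mem_iff.1 hz) with hz | hz
      · rcases List.mem_cons.1 hz with rfl | hz
        · exact hc.le
        · exact hc.le.trans (hx.1 z hz)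
      · exact hy.1 z hz
    · refine List.pairwise_cons.2 ⟨fun z hz => ?_, ih2 hx.2 h'⟩
      rcases List.mem_append.1 ((merge_perm _ _).mem_iff.1 hz) with hz | hz
      · exact hx.1 z hz
      · rcases List.mem_cons.1 hz with rfl | hz
        · omega
        · exact (not_lt.1 hc).trans (hy.1 z hz)

lemma merge_cost {ℓ : ℕ} (l l' : List ℕ) (h : ∀ x ∈ l, len x ≤ ℓ) (h' : ∀ x ∈ l', len x ≤ ℓ) :
    (merge l l').cost ≤ (l.length + l'.length) * (4 * unit ℓ) := by
  fun_induction merge l l' with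
  | case1 l => simp
  | case2 l => simp
  | case3 x l y l' ih1 ih2 =>
    have hx := h x (by simp)
    have hy := h' y (by simp)
    have i1 := ih1 h (fun z hz => h' z (by simp [hz]))
    have i2 := ih2 (fun z hz => h z (by simp [hz])) h'
    have c1 := cost_read_le hx
    have c2 := cost_read_le hy
    have c3 := cost_lt_le hy hx
    have c4 := cost_cons_le hy (merge (x :: l) l').val
    have c5 := cost_cons_le hx (merge l (y :: l')).val
    simp only [cost_bind, val_lt, decide_eq_true_eq, cost_ite, List.length_cons] at *
    split_ifs <;> linarith

lemma sortAux_perm : ∀ (f : ℕ) (l : List ℕ), (sortAux f l).val.Perm l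
  | 0, l => by simp [sortAux]
  | _ + 1, [] => by simp [sortAux]
  | _ + 1, [x] => by simp [sortAux]
  | f + 1, x :: y :: l => by
    rw [sortAux]
    simp only [val_bind]
    exact (merge_perm _ _).trans
      (((sortAux_perm f _).append (sortAux_perm f _)).trans (split_perm _))

lemma sortAux_sorted : ∀ (f : ℕ) (l : List ℕ), l.length ≤ f → (sortAux f l).val.Pairwise (· ≤ ·)
  | 0, l, h => by
    have : l = [] := List.length_eq_zero_iff.1 (Nat.le_zero.1 h)
    simp [sortAux, this]
  | _ + 1, [], _ => by simp [sortAux]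
  | _ + 1, [x], _ => by simp [sortAux]
  | f + 1, x :: y :: l, h => by
    have hs := split_length (x :: y :: l)
    simp only [List.length_cons] at h hs
    rw [sortAux]
    simp only [val_bind]
    exact merge_sorted _ _ (sortAux_sorted f _ (by omega)) (sortAux_sorted f _ (by omega))

/-- There are `d` levels of recursion, each charging an element two units for splitting and four for
merging. -/
lemma sortAux_cost {ℓ : ℕ} : ∀ {f d : ℕ} {l : List ℕ}, l.length ≤ 2 ^ d → (∀ x ∈ l, len x ≤ ℓ) →
    (sortAux f l).cost ≤ l.length * (d * (6 * unit ℓ))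
  | 0, _, _, _, _ => by simp [sortAux]
  | _ + 1, _, [], _, _ => by simp [sortAux]
  | _ + 1, _, [x], _, _ => by simp [sortAux]
  | f + 1, 0, x :: y :: l, h, _ => by simp at h
  | f + 1, d + 1, x :: y :: l, h, hl => by
    have hs := split_length (x :: y :: l)
    have hp := split_perm (x :: y :: l)
    have c1 := split_cost hl
    rw [sortAux]
    simp only [cost_bind]
    generalize x :: y :: l = l₀ at *
    have m1 : ∀ z ∈ (split l₀).val.1, len z ≤ ℓ :=
      fun z hz => hl z (hp.mem_iff.1 (List.mem_append_left _ hz))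
    have m2 : ∀ z ∈ (split l₀).val.2, len z ≤ ℓ :=
      fun z hz => hl z (hp.mem_iff.1 (List.mem_append_right _ hz))
    rw [pow_succ] at h
    have c2 := sortAux_cost (f := f) (d := d) (l := (split l₀).val.1) (by omega) m1
    have c3 := sortAux_cost (f := f) (d := d) (l := (split l₀).val.2) (by omega) m2
    have p1 := sortAux_perm f (split l₀).val.1
    have p2 := sortAux_perm f (split l₀).val.2
    have c4 := merge_cost (ℓ := ℓ) (sortAux f (split l₀).val.1).val (sortAux f (split l₀).val.2).val
      (fun z hz => m1 z (p1.mem_iff.1 hz)) (fun z hz => m2 z (p2.mem_iff.1 hz))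
    rw [p1.length_eq, p2.length_eq] at c4
    have e : l₀.length = (split l₀).val.1.length + (split l₀).val.2.length := by omega
    rw [← e] at c4
    have e2 : l₀.length * (d * (6 * unit ℓ)) = (split l₀).val.1.length * (d * (6 * unit ℓ)) +
        (split l₀).val.2.length * (d * (6 * unit ℓ)) := by
      rw [← add_mul, ← e]
    linarith

lemma sort_perm (l : List ℕ) : (sort l).val.Perm l := sortAux_perm _ _

lemma sort_sorted (l : List ℕ) : (sort l).val.Pairwise (· ≤ ·) := sortAux_sorted _ _ le_rfl

lemma sort_cost {ℓ d : ℕ} {l : List ℕ} (h : l.length ≤ 2 ^ d) (hl : ∀ x ∈ l, len x ≤ ℓ) :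
    (sort l).cost ≤ l.length * (d * (6 * unit ℓ)) := sortAux_cost h hl

/-! ### Searching -/

lemma toArray_val : ∀ (l : List ℕ) (A : Array ℕ), (toArray l A).val = A ++ l.toArray
  | [], A => by simp [toArray]
  | x :: l, A => by
    rw [toArray]
    simp only [val_bind, val_push]
    rw [toArray_val l]
    simp

lemma toArray_cost {ℓ : ℕ} : ∀ {l : List ℕ} {A : Array ℕ}, (∀ x ∈ l, len x ≤ ℓ) →
    len (A.size + l.length) ≤ ℓ → (toArray l A).cost ≤ l.length * (2 * unit ℓ)
  | [], A, _, _ => by simp [toArray]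
  | x :: l, A, h, hA => by
    rw [List.length_cons] at hA
    have ih := toArray_cost (ℓ := ℓ) (l := l) (A := A.push x) (fun z hz => h z (by simp [hz])) (by
      rwa [Array.size_push, add_assoc, add_comm 1])
    have c1 := cost_read_le (h x (by simp))
    have c2 := cost_push_le (A := A) (ℓ := ℓ)
      ((len_mono (show A.size ≤ A.size + (l.length + 1) by omega)).trans hA) (h x (by simp))
    rw [toArray]
    simp only [cost_bind, val_push, List.length_cons]
    linarith

lemma getD_mono {s : List ℕ} (hs : s.Pairwise (· ≤ ·)) {i j : ℕ} (hij : i ≤ j)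
    (hj : j < s.length) : s.getD i 0 ≤ s.getD j 0 := by
  rw [List.getD_eq_getElem _ _ hj, List.getD_eq_getElem _ _ (hij.trans_lt hj)]
  rcases hij.lt_or_eq with h | rfl
  · exact List.pairwise_iff_getElem.1 hs i j _ hj h
  · exact le_rfl

lemma countP_eq_of_getD {s : List ℕ} {t n : ℕ} (hn : n ≤ s.length)
    (h1 : ∀ i < n, s.getD i 0 < t) (h2 : ∀ i, n ≤ i → i < s.length → t ≤ s.getD i 0) :
    s.countP (fun x => decide (x < t)) = n := by
  conv_lhs => rw [← List.take_append_drop n s, List.countP_append]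
  have e1 : (s.take n).countP (fun x => decide (x < t)) = (s.take n).length := by
    rw [List.countP_eq_length]
    intro x hx
    obtain ⟨i, hi, rfl⟩ := List.getElem_of_mem hx
    have hi' : i < n := by simp at hi; omega
    have := h1 i hi'
    rw [List.getD_eq_getElem _ _ (by omega)] at this
    simpa using this
  have e2 : (s.drop n).countP (fun x => decide (x < t)) = 0 := by
    rw [List.countP_eq_zero]
    intro x hx
    obtain ⟨i, hi, rfl⟩ := List.getElem_of_mem hx
    have hi' : n + i < s.length := by simp at hi; omega
    have := h2 (n + i) (by omega) hi'
    rw [List.getD_eq_getElem _ _ hi'] at this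
    simpa using this
  rw [e1, e2, List.length_take]
  omega

lemma getD_toArray (s : List ℕ) (i : ℕ) : s.toArray.getD i 0 = s.getD i 0 := by
  simp

/-- The last two hypotheses are the loop invariant: entries before `lo` are below `t`, those from
`hi` on are not. When `lo = hi` it determines the count. -/
lemma searchAux_val {s : List ℕ} (hs : s.Pairwise (· ≤ ·)) (t : ℕ) : ∀ {f lo hi : ℕ},
    lo ≤ hi → hi ≤ s.length → hi - lo ≤ f → (∀ i < lo, s.getD i 0 < t) →
    (∀ i, hi ≤ i → i < s.length → t ≤ s.getD i 0) →
    (searchAux s.toArray t f lo hi).val = s.countP (fun x => decide (x < t))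
  | 0, lo, hi, h1, h2, h3, h4, h5 => by
    have : lo = hi := by omega
    subst this
    rw [searchAux, val_pure, countP_eq_of_getD h2 h4 h5]
  | f + 1, lo, hi, h1, h2, h3, h4, h5 => by
    rw [searchAux]
    simp only [val_bind, val_lt, decide_eq_true_eq, val_add, val_quo, val_get, val_ite, val_pure,
      getD_toArray]
    split_ifs with hc hx
    · refine searchAux_val hs t (by omega) h2 (by omega) (fun i hi' => ?_) h5
      exact (getD_mono hs (show i ≤ (lo + hi) / 2 by omega) (by omega)).trans_lt hx
    · refine searchAux_val hs t (by omega) (by omega) (by omega) h4 (fun i hi' hi'' => ?_)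
      exact (not_lt.1 hx).trans (getD_mono hs hi' hi'')
    · have : lo = hi := by omega
      subst this
      rw [countP_eq_of_getD h2 h4 h5]

lemma search_val {s : List ℕ} (hs : s.Pairwise (· ≤ ·)) (t : ℕ) :
    (search s.toArray t).val = s.countP (fun x => decide (x < t)) := by
  simp only [search, val_bind, val_length, List.size_toArray]
  exact searchAux_val hs t (Nat.zero_le _) le_rfl le_rfl (by simp) (fun i h1 h2 => by omega)

lemma searchAux_cost {s : List ℕ} {t ℓ : ℕ} (hs : ∀ x ∈ s, len x ≤ ℓ) (ht : len t ≤ ℓ)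
    (hl : 2 * len s.length + 3 ≤ ℓ) : ∀ {f d lo hi : ℕ}, hi - lo < 2 ^ d → lo ≤ s.length →
    hi ≤ s.length → (searchAux s.toArray t f lo hi).cost ≤ (d + 1) * (6 * unit ℓ)
  | 0, _, _, _, _, _, _ => by simp [searchAux]
  | f + 1, d, lo, hi, h, h1, h2 => by
    have l1 := len_mono h1
    have l2 := len_mono h2
    have c1 := cost_lt_le (x := lo) (y := hi) (ℓ := ℓ) (by omega) (by omega)
    rw [searchAux]
    simp only [cost_bind, val_lt, decide_eq_true_eq, val_add, val_quo, val_get, cost_ite, cost_pure,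
      getD_toArray]
    by_cases hc : lo < hi
    · obtain _ | d := d
      · omega
      have hi' : (lo + hi) / 2 < s.length := by omega
      have hx : len (s.getD ((lo + hi) / 2) 0) ≤ ℓ := by
        rw [List.getD_eq_getElem _ _ hi']
        exact hs _ (List.getElem_mem hi')
      have l3 := len_mono hi'.le
      have l4 := len_add_le lo hi
      have c2 := cost_add_le (x := lo) (y := hi) (ℓ := ℓ) (by omega) (by omega)
      have c3 := cost_quo_le (x := lo + hi) (y := 2) (ℓ := ℓ) (by omega) (by rw [len_two]; omega)
      have c4 := cost_get_le (A := s.toArray) (i := (lo + hi) / 2) (ℓ := ℓ) (by omega)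
        (by rw [getD_toArray]; exact hx)
      have c5 := cost_lt_le hx ht
      have c6 := cost_add_le (x := (lo + hi) / 2) (y := 1) (ℓ := ℓ) (by omega)
        (by rw [len_one]; omega)
      rw [pow_succ] at h
      have i1 := searchAux_cost hs ht hl (f := f) (d := d) (lo := (lo + hi) / 2 + 1) (hi := hi)
        (by omega) (by omega) h2
      have i2 := searchAux_cost hs ht hl (f := f) (d := d) (lo := lo) (hi := (lo + hi) / 2)
        (by omega) h1 (by omega)
      rw [if_pos hc]
      split_ifs <;> linarith
    · rw [if_neg hc]
      nlinarith

lemma search_cost {s : List ℕ} {t ℓ : ℕ} (hs : ∀ x ∈ s, len x ≤ ℓ) (ht : len t ≤ ℓ)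
    (hl : 2 * len s.length + 3 ≤ ℓ) : (search s.toArray t).cost ≤ (6 * ℓ + 7) * unit ℓ := by
  have c1 := cost_length_le (A := s.toArray) (ℓ := ℓ) (by simp; omega)
  have c2 := searchAux_cost hs ht hl (f := s.length) (d := ℓ) (lo := 0) (hi := s.length)
    ((Nat.sub_le _ _).trans_lt ((Nat.lt_size_self _).trans_le
      (Nat.pow_le_pow_right (by norm_num) (by simp [len] at hl; omega)))) (Nat.zero_le _) le_rfl
  simp only [search, cost_bind, val_length, List.size_toArray] at *
  linarith

/-! ### The final loops -/

lemma weightList_val (m m' i : ℕ) : ∀ l : List ℕ,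
    (weightList m m' i l).val = l.map (fun x => x * i % m * m')
  | [] => by simp [weightList]
  | x :: l => by simp [weightList, weightList_val m m' i l]

lemma weightList_cost {m m' i ℓ : ℕ} (hm : 0 < m) (hi : i ≤ m) (hl : 2 * len m + len m' ≤ ℓ) :
    ∀ {l : List ℕ}, (∀ x ∈ l, x < m) → (weightList m m' i l).cost ≤ l.length * (5 * unit ℓ)
  | [], _ => by simp [weightList]
  | x :: l, h => by
    have ih := weightList_cost hm hi hl (l := l) (fun z hz => h z (by simp [hz]))
    have l1 := len_mono (h x (by simp)).le
    have l2 := len_mono hi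
    have l3 := len_mul_le x i
    have l4 := len_mono (Nat.mod_lt (x * i) hm).le
    have l5 := len_mul_le (x * i % m) m'
    have lm := len_pos m
    have c1 := cost_read_le (x := x) (ℓ := ℓ) (by omega)
    have c2 := cost_mul_le (x := x) (y := i) (ℓ := ℓ) (by omega) (by omega)
    have c3 := cost_rem_le (x := x * i) (y := m) (ℓ := ℓ) (by omega) (by omega)
    have c4 := cost_mul_le (x := x * i % m) (y := m') (ℓ := ℓ) (by omega) (by omega)
    have c5 := cost_cons_le (x := x * i % m * m') (ℓ := ℓ) (by omega) (weightList m m' i l).val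
    rw [weightList]
    simp only [cost_bind, val_mul, val_rem, List.length_cons]
    linarith

lemma try_val (N f L α : ℕ) : (try_ N f L α).val =
    if Nat.sqrt ((α + L) * (α + L) - f) * Nat.sqrt ((α + L) * (α + L) - f) =
        (α + L) * (α + L) - f then
      if 1 < Nat.gcd (α + L - Nat.sqrt ((α + L) * (α + L) - f)) N ∧
          Nat.gcd (α + L - Nat.sqrt ((α + L) * (α + L) - f)) N < N then
        some (Nat.gcd (α + L - Nat.sqrt ((α + L) * (α + L) - f)) N)
      else none
    else none := by
  simp only [try_, val_bind, val_add, val_mul, val_sub, sqrt_val, val_eq, decide_eq_true_eq,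
    val_ite, gcd_val, val_lt, Bool.and_eq_true, val_pure]

/-- Soundness needs nothing from the sieve, as the output is a gcd with `N` that has been tested for
being proper. It therefore suffices for correctness that some trial succeeds. -/
lemma try_some {N f L α d : ℕ} (h : (try_ N f L α).val = some d) : d ∣ N ∧ 1 < d ∧ d < N := by
  rw [try_val] at h
  split_ifs at h with h1 h2
  rw [Option.some_inj] at h
  subst h
  exact ⟨Nat.gcd_dvd_right _ _, h2⟩

lemma try_ne_none {N f L α y : ℕ} (hy : (α + L) * (α + L) - f = y * y)
    (h1 : 1 < Nat.gcd (α + L - y) N) (h2 : Nat.gcd (α + L - y) N < N) :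
    (try_ N f L α).val ≠ none := by
  rw [try_val, hy, Nat.sqrt_eq, if_pos rfl, if_pos ⟨h1, h2⟩]
  simp

lemma try_cost {N f L α ℓ : ℕ} (hN : len N ≤ ℓ) (hf : len f ≤ ℓ)
    (hl : 4 * (len α + len L) + 4 ≤ ℓ) : (try_ N f L α).cost ≤ (10 * ℓ + 18) * unit ℓ := by
  have l1 := len_add_le α L
  have l2 := len_mul_le (α + L) (α + L)
  have l3 := len_sub_le ((α + L) * (α + L)) f
  have l4 := len_mono (Nat.sqrt_le_self ((α + L) * (α + L) - f))
  have l5 := len_mono (Nat.sqrt_le ((α + L) * (α + L) - f))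
  have l6 := len_sub_le (α + L) (Nat.sqrt ((α + L) * (α + L) - f))
  have c1 := cost_add_le (x := α) (y := L) (ℓ := ℓ) (by omega) (by omega)
  have c2 := cost_mul_le (x := α + L) (y := α + L) (ℓ := ℓ) (by omega) (by omega)
  have c3 := cost_sub_le (x := (α + L) * (α + L)) (y := f) (ℓ := ℓ) (by omega) (by omega)
  have c4 := sqrt_cost (n := (α + L) * (α + L) - f) (ℓ := ℓ) (by omega)
  have lg : len (Nat.gcd (α + L - Nat.sqrt ((α + L) * (α + L) - f)) N) ≤ ℓ := by
    rcases Nat.eq_zero_or_pos N with rfl | hp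
    · rw [Nat.gcd_zero_right]; omega
    · exact (len_mono (Nat.gcd_le_right _ hp)).trans hN
  simp only [try_, cost_bind, val_add, val_mul, val_sub, sqrt_val, val_eq, decide_eq_true_eq,
    cost_ite, gcd_val, val_lt, Bool.and_eq_true, cost_pure, ite_self]
  generalize (α + L) * (α + L) - f = d at *
  have c5 := cost_mul_le (x := Nat.sqrt d) (y := Nat.sqrt d) (ℓ := ℓ) (by omega) (by omega)
  have c6 := cost_eq_le (x := Nat.sqrt d * Nat.sqrt d) (y := d) (ℓ := ℓ) (by omega) (by omega)
  have c7 := cost_sub_le (x := α + L) (y := Nat.sqrt d) (ℓ := ℓ) (by omega) (by omega)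
  have c8 := gcd_cost (x := α + L - Nat.sqrt d) (y := N) (ℓ := ℓ) (by omega) hN
  have c9 := cost_lt_le (x := 1) (ℓ := ℓ) (by rw [len_one]; omega) lg
  have c10 := cost_lt_le lg hN
  split_ifs <;> linarith

lemma scan_some {N f L M α₁ d : ℕ} {A : Array ℕ} : ∀ {n i : ℕ},
    (scan N f L M α₁ A n i).val = some d → d ∣ N ∧ 1 < d ∧ d < N
  | 0, _, h => by simp [scan] at h
  | n + 1, i, h => by
    rw [scan] at h
    simp only [val_bind, val_get, val_add, val_rem] at h
    split at h
    · rename_i d' hd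
      rw [val_pure, Option.some_inj] at h
      subst h
      exact try_some hd
    · exact scan_some h

lemma scan_ne_none {N f L M α₁ : ℕ} {A : Array ℕ} : ∀ {n i k : ℕ}, i ≤ k → k < i + n →
    (try_ N f L ((α₁ + A.getD k 0) % M)).val ≠ none → (scan N f L M α₁ A n i).val ≠ none
  | 0, _, _, h1, h2, _ => by omega
  | n + 1, i, k, h1, h2, h => by
    rw [scan]
    simp only [val_bind, val_get, val_add, val_rem]
    split
    · simp
    · rename_i hd
      refine scan_ne_none (k := k) ?_ (by rw [val_add]; omega) h
      rcases h1.lt_or_eq with h3 | rfl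
      · exact h3
      · exact absurd hd h

lemma scan_cost {N f L M α₁ ℓ : ℕ} {s : List ℕ} (hM : 0 < M) (hN : len N ≤ ℓ) (hf : len f ≤ ℓ)
    (hl : 4 * (len M + len L) + 4 ≤ ℓ) (h₁ : α₁ < M) (hs : ∀ x ∈ s, x < M)
    (hsM : len s.length ≤ ℓ) : ∀ {n i : ℕ}, i + n ≤ s.length →
    (scan N f L M α₁ s.toArray n i).cost ≤ n * ((10 * ℓ + 23) * unit ℓ)
  | 0, _, _ => by simp [scan]
  | n + 1, i, h => by
    have hi : i < s.length := by omega
    have hx : s.getD i 0 < M := by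
      rw [List.getD_eq_getElem _ _ hi]
      exact hs _ (List.getElem_mem hi)
    have l1 := len_mono h₁.le
    have l2 := len_mono hx.le
    have l3 := len_add_le α₁ (s.getD i 0)
    have l4 := len_mono (Nat.mod_lt (α₁ + s.getD i 0) hM).le
    have l5 := len_mono hi.le
    have l6 := len_mono (show n + 1 ≤ s.length by omega)
    have c1 := cost_read_le (x := n + 1) (ℓ := ℓ) (by omega)
    have c2 := cost_get_le (A := s.toArray) (i := i) (ℓ := ℓ) (by omega)
      (by rw [getD_toArray]; omega)
    have c3 := cost_add_le (x := α₁) (y := s.getD i 0) (ℓ := ℓ) (by omega) (by omega)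
    have c4 := cost_rem_le (x := α₁ + s.getD i 0) (y := M) (ℓ := ℓ) (by omega) (by omega)
    have c5 := try_cost (α := (α₁ + s.getD i 0) % M) (L := L) hN hf (by omega)
    have c6 := cost_add_le (x := i) (y := 1) (ℓ := ℓ) (by omega) (by rw [len_one]; omega)
    have ih := scan_cost hM hN hf hl h₁ hs hsM (n := n) (i := i + 1) (by omega)
    rw [scan]
    simp only [cost_bind, val_get, val_add, val_rem, getD_toArray]
    split
    · rw [cost_pure]
      linarith
    · simp only [cost_bind, val_add]
      linarith

/-- The number of entries that are tried together with `α₁`. -/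
def tries (M Λ : ℕ) (s : List ℕ) (α₁ : ℕ) : ℕ :=
  s.countP (fun x => decide (x < Λ - α₁)) +
    (s.countP (fun x => decide (x < M + Λ - α₁)) - s.countP (fun x => decide (x < M - α₁)))

lemma meet_some {N f L M Λ d : ℕ} {A : Array ℕ} : ∀ {l : List ℕ},
    (meet N f L M Λ A l).val = some d → d ∣ N ∧ 1 < d ∧ d < N
  | [], h => by simp [meet] at h
  | α₁ :: l, h => by
    rw [meet] at h
    simp only [val_bind] at h
    split at h
    · rename_i d' hd
      rw [val_pure, Option.some_inj] at h
      subst h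
      exact scan_some hd
    · simp only [val_bind] at h
      split at h
      · rename_i d' hd
        rw [val_pure, Option.some_inj] at h
        subst h
        exact scan_some hd
      · exact meet_some h

/-- In a sorted list the entries below `t` form an initial segment, so the counts found by `search`
delimit exactly the index range of each interval of values. -/
lemma index_of_countP {s : List ℕ} (hs : s.Pairwise (· ≤ ·)) {x t : ℕ} {i : ℕ}
    (hi : i < s.length) (hx : s.getD i 0 = x) :
    i < s.countP (fun x => decide (x < t)) ↔ x < t := by
  obtain ⟨n, hn, h1, h2⟩ : ∃ n ≤ s.length, (∀ i < n, s.getD i 0 < t) ∧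
      ∀ i, n ≤ i → i < s.length → t ≤ s.getD i 0 := by
    by_cases h : ∃ n, n < s.length ∧ t ≤ s.getD n 0
    · classical
      refine ⟨Nat.find h, (Nat.find_spec h).1.le, fun i hi => ?_, fun i hi hi' => ?_⟩
      · by_contra hc
        exact Nat.find_min h hi ⟨hi.trans (Nat.find_spec h).1, not_lt.1 hc⟩
      · exact (Nat.find_spec h).2.trans (getD_mono hs hi hi')
    · push Not at h
      exact ⟨s.length, le_rfl, h, fun i h1 h2 => by omega⟩
  rw [countP_eq_of_getD hn h1 h2, ← hx]
  constructor
  · exact h1 i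
  · intro h
    by_contra hc
    exact absurd (h2 i (not_lt.1 hc) hi) (not_le.2 h)

lemma meet_ne_none {N f L M Λ α₁ α₂ : ℕ} {s : List ℕ} (hs : s.Pairwise (· ≤ ·)) (h₂ : α₂ ∈ s)
    (hα : α₂ < Λ - α₁ ∨ (M - α₁ ≤ α₂ ∧ α₂ < M + Λ - α₁))
    (h : (try_ N f L ((α₁ + α₂) % M)).val ≠ none) : ∀ {l : List ℕ}, α₁ ∈ l →
    (meet N f L M Λ s.toArray l).val ≠ none
  | [], h₁ => by simp at h₁
  | x :: l, h₁ => by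
    rw [meet]
    simp only [val_bind, val_sub, search_val hs]
    split
    · simp
    · rename_i hd1
      simp only [val_bind, val_sub, val_add, search_val hs]
      split
      · simp
      · rename_i hd2
        rcases List.mem_cons.1 h₁ with rfl | h₁
        · exfalso
          obtain ⟨i, hi, hi'⟩ := List.getElem_of_mem h₂
          rw [← List.getD_eq_getElem _ 0 hi] at hi'
          have e : s.toArray.getD i 0 = α₂ := by rw [getD_toArray, hi']
          rcases hα with hα | ⟨hα, hα'⟩
          · refine scan_ne_none (k := i) (Nat.zero_le _) ?_ (by rwa [e]) hd1
            rw [zero_add]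
            exact (index_of_countP hs hi hi').2 hα
          · have k1 := (index_of_countP hs hi hi').2 hα'
            have k2 := mt (index_of_countP hs hi hi').1 (not_lt.2 hα)
            exact scan_ne_none (k := i) (not_lt.1 k2) (by omega) (by rwa [e]) hd2
        · exact meet_ne_none hs h₂ hα h h₁

/-- Each `α₁` pays for three binary searches of `6 * ℓ + 7` units and six single operations; the
trials are charged separately, through their total number. -/
lemma meet_cost {N f L M Λ ℓ : ℕ} {s : List ℕ} (hs' : s.Pairwise (· ≤ ·)) (hM : 0 < M)
    (hΛ : Λ ≤ M) (hN : len N ≤ ℓ) (hf : len f ≤ ℓ)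
    (hl : 4 * (len M + len L) + 4 ≤ ℓ) (hs : ∀ x ∈ s, x < M)
    (hsM : 2 * len s.length + 3 ≤ ℓ) : ∀ {l : List ℕ}, (∀ x ∈ l, x < M) →
    (meet N f L M Λ s.toArray l).cost ≤ l.length * ((18 * ℓ + 27) * unit ℓ) +
      (l.map (tries M Λ s)).sum * ((10 * ℓ + 23) * unit ℓ)
  | [], _ => by simp [meet]
  | x :: l, h => by
    have hx := h x (by simp)
    have ih := meet_cost hs' hM hΛ hN hf hl hs hsM (l := l) (fun z hz => h z (by simp [hz]))
    have l1 := len_mono hx.le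
    have l2 := len_mono hΛ
    have l3 := len_sub_le Λ x
    have l4 := len_sub_le M x
    have l5 := len_add_le M Λ
    have l6 := len_sub_le (M + Λ) x
    have hsl : ∀ z ∈ s, len z ≤ ℓ := fun z hz => by
      have := len_mono (hs z hz).le
      omega
    have b1 : s.countP (fun z => decide (z < Λ - x)) ≤ s.length := List.countP_le_length
    have b2 : s.countP (fun z => decide (z < M - x)) ≤ s.length := List.countP_le_length
    have b3 : s.countP (fun z => decide (z < M + Λ - x)) ≤ s.length := List.countP_le_length
    have b4 : s.countP (fun z => decide (z < M - x)) ≤ s.countP (fun z => decide (z < M + Λ - x)) :=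
      List.countP_mono_left (fun z _ hz => by
        simp only [decide_eq_true_eq] at hz ⊢
        omega)
    have l7 := len_mono b2
    have l8 := len_mono b3
    have c1 := cost_read_le (x := x) (ℓ := ℓ) (by omega)
    have c2 := cost_sub_le (x := Λ) (y := x) (ℓ := ℓ) (by omega) (by omega)
    have c3 := search_cost (t := Λ - x) hsl (by omega) hsM
    have c4 := scan_cost hM hN hf hl hx hs (by omega) (i := 0)
      (n := s.countP (fun z => decide (z < Λ - x))) (by omega)
    have c5 := cost_sub_le (x := M) (y := x) (ℓ := ℓ) (by omega) (by omega)
    have c6 := search_cost (t := M - x) hsl (by omega) hsM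
    have c7 := cost_add_le (x := M) (y := Λ) (ℓ := ℓ) (by omega) (by omega)
    have c8 := cost_sub_le (x := M + Λ) (y := x) (ℓ := ℓ) (by omega) (by omega)
    have c9 := search_cost (t := M + Λ - x) hsl (by omega) hsM
    have c10 := cost_sub_le (x := s.countP (fun z => decide (z < M + Λ - x)))
      (y := s.countP (fun z => decide (z < M - x))) (ℓ := ℓ) (by omega) (by omega)
    have c11 := scan_cost hM hN hf hl hx hs (by omega)
      (i := s.countP (fun z => decide (z < M - x)))
      (n := s.countP (fun z => decide (z < M + Λ - x)) - s.countP (fun z => decide (z < M - x)))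
      (by omega)
    rw [meet]
    simp only [cost_bind, val_sub, search_val hs', List.length_cons, List.map_cons, List.sum_cons]
    have e : tries M Λ s x = s.countP (fun z => decide (z < Λ - x)) +
      (s.countP (fun z => decide (z < M + Λ - x)) - s.countP (fun z => decide (z < M - x))) := rfl
    rw [add_mul (tries M Λ s x), e, add_mul (List.countP _ s)]
    split
    · rw [cost_pure]
      linarith
    · simp only [cost_bind, val_sub, val_add, search_val hs']
      split
      · rw [cost_pure]
        linarith
      · linarith

/-! ### Sieve sets and lists -/

lemma natCast_mem_shiftedSieve {m N a b t : ℕ} (hm : 0 < m) :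
    (t : ZMod m) ∈ HypSieve.shiftedSieve N m a b ↔
      InSieve m N (a * b) (HypSieve.shift N a b) t := by
  have : NeZero m := ⟨hm.ne'⟩
  simp only [HypSieve.shiftedSieve, HypSieve.sieve, HypSieve.hyperbola, Set.mem_ofPred_eq, InSieve,
    ← ZMod.natCast_eq_natCast_iff]
  constructor
  · rintro ⟨s, ⟨⟨x, y⟩, h1, rfl⟩, h2⟩
    refine ⟨x.val, y.val, ?_, ?_⟩
    · push_cast
      simpa using h1
    · push_cast
      simp only [ZMod.natCast_val, ZMod.cast_id', id_eq, h2]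
      push_cast
      ring
  · rintro ⟨x, y, h1, h2⟩
    refine ⟨_, ⟨(x, y), by push_cast at h1; exact h1, rfl⟩, ?_⟩
    push_cast at h2 ⊢
    rw [h2]
    ring

lemma mem_smallSieve {N M a b Λ s : ℕ} (hM : 0 < M) : s ∈ HypSieve.smallSieve N M a b Λ ↔
    s < Λ ∧ s < M ∧ InSieve M N (a * b) (HypSieve.shift N a b) s := by
  have : NeZero M := ⟨hM.ne'⟩
  simp only [HypSieve.smallSieve, Set.mem_ofPred_eq, ← natCast_mem_shiftedSieve hM]
  constructor
  · rintro ⟨h1, x, hx, rfl⟩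
    exact ⟨h1, ZMod.val_lt x, by simpa using hx⟩
  · rintro ⟨h1, h2, h3⟩
    exact ⟨h1, _, h3, (ZMod.val_cast_of_lt h2).symm⟩

/-- The unsorted list of weights that the algorithm computes for the primes in `l`. -/
def weightsOf (N k L : ℕ) (l : List ℕ) (m' : ℕ) : List ℕ :=
  (weightList l.prod m' (inv m' l.prod).val (chinese l.prod (systems N k L l)).val).val

section

variable {l : List ℕ} {m' : ℕ}

/-- The number `(x m'⁻¹ mod m) m'` is the solution in `[0, m m')` of `α ≡ x` modulo `m` and `α ≡ 0`
modulo `m'`. This description by congruences replaces the formula in everything about sums `α₁ +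
α₂`. -/
lemma mem_weightsOf (co : l.Pairwise Nat.Coprime) (hl : ∀ r ∈ l, 0 < r) (hm' : 0 < m')
    (hco : Nat.Coprime m' l.prod) (N k L α : ℕ) : α ∈ weightsOf N k L l m' ↔
      α < l.prod * m' ∧ m' ∣ α ∧ InSieve l.prod N k L α := by
  have hm : 0 < l.prod := List.prod_pos hl
  have hinv := inv_val hm hco
  rw [weightsOf, weightList_val, List.mem_map]
  constructor
  · rintro ⟨x, hx, rfl⟩
    rw [mem_chinese_systems co hl] at hx
    refine ⟨Nat.mul_lt_mul_of_pos_right (Nat.mod_lt _ hm) hm', dvd_mul_left _ _, hx.2.congr ?_⟩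
    have h1 := (Nat.mod_modEq (x * (inv m' l.prod).val) l.prod).mul_right m'
    have h2 := hinv.mul_left x
    rw [mul_one, ← mul_assoc] at h2
    exact (h1.trans h2).symm
  · rintro ⟨h1, ⟨j, rfl⟩, h2⟩
    have hj : j < l.prod := by
      rw [mul_comm] at h1
      exact lt_of_mul_lt_mul_right h1 (Nat.zero_le _)
    refine ⟨m' * j % l.prod, ?_, ?_⟩
    · rw [mem_chinese_systems co hl]
      exact ⟨Nat.mod_lt _ hm, h2.congr (Nat.mod_modEq _ _).symm⟩
    · rw [mul_comm m' j]
      congr 1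
      have h3 : j * m' % l.prod * (inv m' l.prod).val ≡ j [MOD l.prod] := by
        refine ((Nat.mod_modEq _ _).mul_right _).trans ?_
        have h4 := hinv.mul_left j
        rwa [mul_one, mul_comm (inv _ _).val, ← mul_assoc] at h4
      rwa [Nat.ModEq, Nat.mod_eq_of_lt hj] at h3

lemma nodup_weightsOf (co : l.Pairwise Nat.Coprime) (hl : ∀ r ∈ l, 0 < r) (hm' : 0 < m')
    (hco : Nat.Coprime m' l.prod) (N k L : ℕ) : (weightsOf N k L l m').Nodup := by
  have hinv := inv_val (List.prod_pos hl) hco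
  rw [weightsOf, weightList_val]
  refine List.Nodup.map_on (fun x hx y hy h => ?_) (nodup_chinese_systems co hl N k L)
  rw [mem_chinese_systems co hl] at hx hy
  have h1 : x * (inv m' l.prod).val ≡ y * (inv m' l.prod).val [MOD l.prod] :=
    Nat.eq_of_mul_eq_mul_right hm' h
  have h2 : ∀ z, z * (inv m' l.prod).val * m' ≡ z [MOD l.prod] := fun z => by
    simpa [mul_assoc] using hinv.mul_left z
  exact (((h2 x).symm.trans (h1.mul_right m')).trans (h2 y)).eq_of_lt_of_lt hx.1 hy.1

lemma length_weightsOf (N k L : ℕ) : (weightsOf N k L l m').length =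
    (chinese l.prod (systems N k L l)).val.length := by
  rw [weightsOf, weightList_val, List.length_map]

/-- The computed list enumerates the set without repetition, so the quantities in the cost bound are
those in the definition of `S`. -/
lemma ncard_weights (co : l.Pairwise Nat.Coprime) (hl : ∀ r ∈ l, 0 < r) (hm' : 0 < m')
    (hco : Nat.Coprime m' l.prod) {N a b k : ℕ} (hk : k ≡ a * b [MOD l.prod]) :
    (HypSieve.weights N l.prod m' a b).ncard =
      (weightsOf N k (HypSieve.shift N a b) l m').length := by
  have hm : 0 < l.prod := List.prod_pos hl
  have : NeZero l.prod := ⟨hm.ne'⟩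
  have hinv : ((inv m' l.prod).val : ZMod l.prod) = (m' : ZMod l.prod)⁻¹ := by
    have h := (ZMod.natCast_eq_natCast_iff _ _ _).2 (inv_val hm hco)
    push_cast at h
    rw [mul_comm] at h
    exact (ZMod.inv_eq_of_mul_eq_one _ _ _ h).symm
  have : HypSieve.weights N l.prod m' a b =
      ((weightsOf N k (HypSieve.shift N a b) l m').toFinset : Set ℕ) := by
    ext w
    rw [Finset.mem_coe, List.mem_toFinset, weightsOf, weightList_val, List.mem_map]
    simp only [mem_chinese_systems co hl, HypSieve.weights, Set.mem_ofPred_eq]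
    constructor
    · rintro ⟨x, hx, rfl⟩
      refine ⟨x.val, ⟨ZMod.val_lt x, ?_⟩, ?_⟩
      · refine InSieve.congr_coeff (k := a * b) ?_ hk.symm
        rw [← natCast_mem_shiftedSieve hm]
        simpa using hx
      · rw [← ZMod.val_natCast, ← hinv]
        push_cast
        simp
    · rintro ⟨x, ⟨hx, hx'⟩, rfl⟩
      refine ⟨x, (natCast_mem_shiftedSieve hm).2 (hx'.congr_coeff hk), ?_⟩
      rw [← ZMod.val_natCast, ← hinv]
      push_cast
      rfl
  rw [this, Set.ncard_coe_finset, List.toFinset_card_of_nodup (nodup_weightsOf co hl hm' hco _ _ _)]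

end

/-! ### Lower bounds for the sieve -/

/-- Every nonzero `x` modulo `r` yields the sieve element `kx + N/x - L`, and each value is taken at
most twice. The case `r ∣ N` needs no separate treatment. -/
lemma pred_le_two_mul_residues {r N k L : ℕ} (hr : r.Prime) (hk : Nat.Coprime k r) :
    r - 1 ≤ 2 * (residuesBelow r N k L r).val.length := by
  have : Fact r.Prime := ⟨hr⟩
  rw [← List.toFinset_card_of_nodup (nodup_residuesBelow hr.pos N k L r)]
  have hk0 : (k : ZMod r) ≠ 0 := by
    intro h
    rw [ZMod.natCast_eq_zero_iff] at h
    exact hr.one_lt.ne' (Nat.eq_one_of_dvd_coprimes hk h dvd_rfl)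
  have hcard : (Finset.univ.erase (0 : ZMod r)).card = r - 1 := by
    rw [Finset.card_erase_of_mem (Finset.mem_univ _), Finset.card_univ, ZMod.card]
  rw [← hcard]
  refine Finset.card_le_mul_card_image_of_maps_to
    (f := fun x : ZMod r => ((k : ZMod r) * x + N * x⁻¹ - L).val) (fun x hx => ?_) 2 (fun t _ => ?_)
  · have hx0 : x ≠ 0 := Finset.ne_of_mem_erase hx
    rw [List.mem_toFinset, mem_residuesBelow hr.pos]
    refine ⟨ZMod.val_lt _, x.val, ((N : ZMod r) * x⁻¹).val, ?_, ?_⟩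
    · rw [← ZMod.natCast_eq_natCast_iff]
      push_cast
      simp only [ZMod.natCast_val, ZMod.cast_id', id_eq]
      field_simp
    · rw [← ZMod.natCast_eq_natCast_iff]
      push_cast
      simp only [ZMod.natCast_val, ZMod.cast_id', id_eq]
      ring
  · rcases Finset.eq_empty_or_nonempty ((Finset.univ.erase (0 : ZMod r)).filter
      (fun x => ((k : ZMod r) * x + N * x⁻¹ - L).val = t)) with h | ⟨x, hx⟩
    · rw [h]; simp
    -- If `kx + N/x = ky + N/y`, then `(y - x)(kxy - N) = 0`, so `y = x` or `y = N/(kx)`.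
    · refine (Finset.card_le_card (t := {x, (N : ZMod r) * (k * x)⁻¹}) (fun y hy => ?_)).trans
        Finset.card_le_two
      simp only [Finset.mem_filter, Finset.mem_erase, Finset.mem_univ, and_true] at hx hy
      obtain ⟨hx0, hx⟩ := hx
      obtain ⟨hy0, hy⟩ := hy
      have h := ZMod.val_injective r (hx.trans hy.symm)
      rw [Finset.mem_insert, Finset.mem_singleton, or_iff_not_imp_left]
      intro hne
      have h1 : (y - x) * (k * x * y - N) = 0 := by
        field_simp at h
        linear_combination -h
      rcases mul_eq_zero.1 h1 with h2 | h2
      · exact absurd (sub_eq_zero.1 h2) hne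
      · field_simp
        linear_combination h2

/-- A factor that makes up for the primes `2` and `3`. -/
def smallFactor (r : ℕ) : ℕ := if r = 2 ∨ r = 3 then r else 1

/-- For `r ≥ 5` the number `κ` of residues is at least `2`, whence `r ≤ 2κ + 1 ≤ 4κ ≤ κ³`. For `r =
2, 3` only `κ ≥ 1` is known, and the factor `r` itself is needed. -/
lemma prime_le_residues_pow {r N k L : ℕ} (hr : r.Prime) (hk : Nat.Coprime k r) :
    r ≤ smallFactor r * (residuesBelow r N k L r).val.length ^ 3 := by
  have h := pred_le_two_mul_residues (N := N) (L := L) hr hk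
  have h2 := hr.two_le
  generalize (residuesBelow r N k L r).val.length = κ at *
  have hκ : 1 ≤ κ := by omega
  rw [smallFactor]
  split_ifs with h3
  · exact Nat.le_mul_of_pos_right _ (by positivity)
  · have h4 : r ≠ 4 := fun h => by subst h; exact absurd hr (by decide)
    have h5 : 2 ≤ κ := by omega
    have h6 : r ≤ 2 * κ + 1 := by omega
    have h7 : 2 * 2 * κ ≤ κ * κ * κ := Nat.mul_le_mul_right κ (Nat.mul_le_mul h5 h5)
    rw [one_mul, pow_succ, pow_two]
    omega

lemma prod_smallFactor_le {l : List ℕ} (hl : l.Nodup) : (l.map smallFactor).prod ≤ 6 := by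
  rw [← List.prod_toFinset _ hl]
  have h1 : ∏ r ∈ l.toFinset, smallFactor r =
      ∏ r ∈ l.toFinset.filter (fun r => r = 2 ∨ r = 3), smallFactor r := by
    refine (Finset.prod_filter_of_ne (fun r _ h => ?_)).symm
    by_contra hc
    exact h (by rw [smallFactor, if_neg hc])
  have h2 : ∏ r ∈ ({2, 3} : Finset ℕ), smallFactor r = 6 := by decide
  rw [h1, ← h2]
  refine Finset.prod_le_prod_of_subset_of_one_le' (fun r hr => ?_) (fun r hr _ => ?_)
  · simpa using (Finset.mem_filter.1 hr).2
  · simp only [Finset.mem_insert, Finset.mem_singleton] at hr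
    rcases hr with rfl | rfl <;> decide

/-- The sizes of the sieve sets multiply, and the exceptional primes occur at most once each, which
costs the factor `6`. The prime `2` has to be admitted, since it divides `m₂` when `B₁ < 2 ≤ B₂`. -/
lemma prod_le_length_pow {l : List ℕ} (hnd : l.Nodup) (hl : ∀ r ∈ l, r.Prime) {N k L : ℕ}
    (hk : Nat.Coprime k l.prod) :
    l.prod ≤ 6 * (chinese l.prod (systems N k L l)).val.length ^ 3 := by
  rw [length_chinese_systems (fun r hr => (hl r hr).pos)]
  rw [Nat.coprime_list_prod_right_iff] at hk
  have h1 : l.prod ≤ (l.map smallFactor).prod *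
      (l.map (fun r => (residuesBelow r N k L r).val.length)).prod ^ 3 := by
    clear hnd
    induction l with
    | nil => simp
    | cons r l ih =>
      have h2 := prime_le_residues_pow (N := N) (L := L) (hl r (by simp)) (hk r (by simp))
      have h3 := ih (fun x hx => hl x (by simp [hx])) (fun x hx => hk x (by simp [hx]))
      simp only [List.prod_cons, List.map_cons]
      refine (Nat.mul_le_mul h2 h3).trans (le_of_eq ?_)
      ring
  exact h1.trans (Nat.mul_le_mul_right _ (prod_smallFactor_le hnd))

/-! ### The size of the modulus -/

lemma primeProd_pos (lo hi : ℕ) : 0 < HypSieve.primeProd lo hi :=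
  Finset.prod_pos (fun _ hr => (Finset.mem_filter.1 hr).2.pos)

lemma mul_primeProd_half_le {n p : ℕ} (hp : p.Prime) (h1 : n / 2 < p) (h2 : p ≤ n) :
    p * HypSieve.primeProd 0 (n / 2) ≤ HypSieve.primeProd 0 n := by
  have hp' : p ∉ (Finset.Ioc 0 (n / 2)).filter Nat.Prime := by
    simp only [Finset.mem_filter, Finset.mem_Ioc]; omega
  rw [HypSieve.primeProd, HypSieve.primeProd, ← Finset.prod_insert (f := fun r => r) hp']
  refine Finset.prod_le_prod_of_subset_of_one_le' (fun r hr => ?_)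
    (fun r hr _ => (Finset.mem_filter.1 hr).2.one_lt.le)
  rcases Finset.mem_insert.1 hr with rfl | hr
  · exact Finset.mem_filter.2 ⟨Finset.mem_Ioc.2 ⟨hp.pos, h2⟩, hp⟩
  · simp only [Finset.mem_filter, Finset.mem_Ioc] at hr ⊢
    exact ⟨⟨hr.1.1, by omega⟩, hr.2⟩

/-- Induction on the exponent: Bertrand's postulate supplies a prime in `(n/2, n]`, which
contributes one more factor of size `n/2` to the bound already known at `n/2`. -/
lemma exists_pow_le_primeProd (J : ℕ) : ∃ C, ∀ n, n ^ J ≤ C * HypSieve.primeProd 0 n := by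
  induction J with
  | zero =>
    refine ⟨1, fun n => ?_⟩
    have := primeProd_pos 0 n
    rw [pow_zero]; omega
  | succ J ih =>
    obtain ⟨C, hC⟩ := ih
    -- The power of `3` comes from `n ≤ 3 ⌊n/2⌋`, valid for `n ≥ 2`; the summand `1` takes care of
    -- `n < 2`.
    refine ⟨3 ^ (J + 1) * C + 1, fun n => ?_⟩
    have hpos := primeProd_pos 0 n
    rcases Nat.lt_or_ge n 2 with hn | hn
    · have : n ^ (J + 1) ≤ 1 := pow_le_one₀ (Nat.zero_le _) (by omega)
      nlinarith [Nat.zero_le (3 ^ (J + 1) * C * HypSieve.primeProd 0 n)]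
    · obtain ⟨p, hp, h1, h2⟩ := Nat.exists_prime_lt_and_le_two_mul (n / 2) (by omega)
      have h3 := mul_primeProd_half_le hp h1 (by omega : p ≤ n)
      have h4 := hC (n / 2)
      calc n ^ (J + 1) ≤ (3 * (n / 2)) ^ (J + 1) := Nat.pow_le_pow_left (by omega) _
        _ = 3 ^ (J + 1) * ((n / 2) ^ J * (n / 2)) := by rw [mul_pow, pow_succ (n / 2)]
        _ ≤ 3 ^ (J + 1) * (C * HypSieve.primeProd 0 (n / 2) * p) :=
          Nat.mul_le_mul_left _ (Nat.mul_le_mul h4 h1.le)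
        _ = 3 ^ (J + 1) * C * (p * HypSieve.primeProd 0 (n / 2)) := by ring
        _ ≤ 3 ^ (J + 1) * C * HypSieve.primeProd 0 n := Nat.mul_le_mul_left _ h3
        _ ≤ (3 ^ (J + 1) * C + 1) * HypSieve.primeProd 0 n :=
          Nat.mul_le_mul_right _ (Nat.le_succ _)

lemma prod_union_le {s t : Finset ℕ} (h : ∀ r ∈ s ∩ t, 0 < r) :
    ∏ r ∈ s ∪ t, r ≤ (∏ r ∈ s, r) * ∏ r ∈ t, r := by
  rw [← Finset.prod_union_inter]
  exact Nat.le_mul_of_pos_right _ (Finset.prod_pos h)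

lemma primeProd_zero_le (B₁ B₂ : ℕ) :
    HypSieve.primeProd 0 B₂ ≤ 2 * (HypSieve.primeProd 2 B₁ * HypSieve.primeProd B₁ B₂) := by
  set s := (Finset.Ioc 2 B₁).filter Nat.Prime with hs
  set t := (Finset.Ioc B₁ B₂).filter Nat.Prime with ht
  have h1 : HypSieve.primeProd 0 B₂ ≤ ∏ r ∈ ({2} ∪ (s ∪ t) : Finset ℕ), r := by
    refine Finset.prod_le_prod_of_subset_of_one_le' (fun r hr => ?_) (fun r hr _ => ?_)
    · simp only [Finset.mem_filter, Finset.mem_Ioc, hs, ht, Finset.mem_union,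
        Finset.mem_singleton] at hr ⊢
      have := hr.2.two_le
      by_cases h2 : r = 2
      · exact .inl h2
      · rcases Nat.lt_or_ge B₁ r with h3 | h3
        · exact .inr (.inr ⟨⟨h3, hr.1.2⟩, hr.2⟩)
        · exact .inr (.inl ⟨⟨by omega, h3⟩, hr.2⟩)
    · simp only [Finset.mem_filter, Finset.mem_Ioc, hs, ht, Finset.mem_union,
        Finset.mem_singleton] at hr
      rcases hr with rfl | hr | hr
      · norm_num
      · exact hr.2.one_lt.le
      · exact hr.2.one_lt.le
  refine h1.trans ((prod_union_le (fun r hr => ?_)).trans ?_)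
  · simp only [Finset.mem_inter, Finset.mem_singleton] at hr
    omega
  · rw [Finset.prod_singleton]
    refine Nat.mul_le_mul_left _ (prod_union_le (fun r hr => ?_))
    exact (Finset.mem_filter.1 (Finset.mem_inter.1 hr).1).2.pos

/-! ### The number of candidates -/

lemma countP_eq_card_filter {s : List ℕ} (hs : s.Nodup) (p : ℕ → Prop) [DecidablePred p] :
    s.countP (fun x => decide (p x)) = (s.toFinset.filter p).card := by
  rw [List.countP_eq_length_filter, ← List.toFinset_card_of_nodup (hs.filter _)]
  congr 1
  ext x
  simp

/-- Because `Λ ≤ M`, the two ranges are disjoint, so no entry is counted twice. Truncated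
subtraction makes the first one empty when `α₁ ≥ Λ`. -/
lemma tries_eq_card {M Λ α₁ : ℕ} {s : List ℕ} (hs : s.Nodup) (hΛ : Λ ≤ M) :
    tries M Λ s α₁ = (s.toFinset.filter
      (fun x => x < Λ - α₁ ∨ (M - α₁ ≤ x ∧ x < M + Λ - α₁))).card := by
  have hsub : s.toFinset.filter (fun x => x < M - α₁) ⊆
      s.toFinset.filter (fun x => x < M + Λ - α₁) :=
    Finset.monotone_filter_right _ (fun x _ hx => by omega)
  rw [tries, countP_eq_card_filter hs, countP_eq_card_filter hs, countP_eq_card_filter hs,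
    ← Finset.card_sdiff_of_subset hsub, ← Finset.card_union_of_disjoint]
  · congr 1
    ext x
    simp only [Finset.mem_union, Finset.mem_filter, Finset.mem_sdiff]
    constructor
    · rintro (⟨h1, h2⟩ | ⟨⟨h1, h2⟩, h3⟩)
      · exact ⟨h1, .inl h2⟩
      · exact ⟨h1, .inr ⟨not_lt.1 (fun h => h3 ⟨h1, h⟩), h2⟩⟩
    · rintro ⟨h1, h2 | ⟨h2, h3⟩⟩
      · exact .inl ⟨h1, h2⟩
      · exact .inr ⟨⟨h1, h3⟩, fun h => absurd h.2 (not_lt.2 h2)⟩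
  · rw [Finset.disjoint_left]
    simp only [Finset.mem_filter, Finset.mem_sdiff]
    rintro x ⟨h1, h2⟩ ⟨-, h4⟩
    exact h4 ⟨h1, by omega⟩

/-- The tried pairs inject into the small sieve set by `(α, β) ↦ (α + β) mod M`. Modulo `m₁` the sum
is `α` and modulo `m₂` it is `β`; hence it determines both and lies in both sieves, while the ranges
make its residue smaller than `Λ`. -/
lemma sum_tries_le {N k a b m₁ m₂ Λ : ℕ} {l s : List ℕ} (hm₁ : 0 < m₁) (hm₂ : 0 < m₂)
    (co : Nat.Coprime m₁ m₂) (hk : k ≡ a * b [MOD m₁ * m₂]) (hΛ : Λ ≤ m₁ * m₂)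
    (hl : l.Nodup) (hs : s.Nodup)
    (hl' : ∀ α ∈ l, α < m₁ * m₂ ∧ m₂ ∣ α ∧ InSieve m₁ N k (HypSieve.shift N a b) α)
    (hs' : ∀ α ∈ s, α < m₁ * m₂ ∧ m₁ ∣ α ∧ InSieve m₂ N k (HypSieve.shift N a b) α) :
    (l.map (tries (m₁ * m₂) Λ s)).sum ≤ (HypSieve.smallSieve N (m₁ * m₂) a b Λ).ncard := by
  have hM : 0 < m₁ * m₂ := Nat.mul_pos hm₁ hm₂
  rw [← List.sum_toFinset _ hl, Finset.sum_congr rfl (fun α _ => tries_eq_card hs hΛ),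
    ← Finset.card_sigma]
  have hinj : Set.InjOn (fun p : (_ : ℕ) × ℕ => (p.1 + p.2) % (m₁ * m₂))
      (l.toFinset.sigma fun α₁ => s.toFinset.filter
        (fun x => x < Λ - α₁ ∨ (m₁ * m₂ - α₁ ≤ x ∧ x < m₁ * m₂ + Λ - α₁)) : Set _) := by
    rintro ⟨α, β⟩ h ⟨α', β'⟩ h' (e : α + β ≡ α' + β' [MOD m₁ * m₂])
    simp only [Finset.mem_coe, Finset.mem_sigma, List.mem_toFinset, Finset.mem_filter] at h h'
    obtain ⟨a1, a2, a3⟩ := hl' α h.1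
    obtain ⟨b1, b2, b3⟩ := hs' β h.2.1
    obtain ⟨a1', a2', a3'⟩ := hl' α' h'.1
    obtain ⟨b1', b2', b3'⟩ := hs' β' h'.2.1
    rw [← Nat.modEq_zero_iff_dvd] at a2 b2 a2' b2'
    have e1 : α + β ≡ α' + β' [MOD m₁] := e.of_dvd (dvd_mul_right _ _)
    have e2 : α + β ≡ α' + β' [MOD m₂] := e.of_dvd (dvd_mul_left _ _)
    have f1 : α ≡ α' [MOD m₁] := Nat.ModEq.add_right_cancel (b2.trans b2'.symm) e1
    have f2 : β ≡ β' [MOD m₂] := Nat.ModEq.add_left_cancel (a2.trans a2'.symm) e2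
    have g1 := ((Nat.modEq_and_modEq_iff_modEq_mul co).1 ⟨f1, a2.trans a2'.symm⟩).eq_of_lt_of_lt
      a1 a1'
    have g2 := ((Nat.modEq_and_modEq_iff_modEq_mul co).1 ⟨b2.trans b2'.symm, f2⟩).eq_of_lt_of_lt
      b1 b1'
    rw [g1, g2]
  rw [← Finset.card_image_of_injOn hinj, ← Set.ncard_coe_finset]
  refine Set.ncard_le_ncard ?_ ((Set.finite_lt_nat Λ).subset (fun x hx => hx.1))
  intro x hx
  rw [Finset.mem_coe, Finset.mem_image] at hx
  obtain ⟨⟨α, β⟩, h, rfl⟩ := hx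
  simp only [Finset.mem_sigma, List.mem_toFinset, Finset.mem_filter] at h ⊢
  obtain ⟨a1, a2, a3⟩ := hl' α h.1
  obtain ⟨b1, b2, b3⟩ := hs' β h.2.1
  rw [mem_smallSieve hM]
  refine ⟨?_, Nat.mod_lt _ hM, InSieve.congr_coeff (InSieve.congr (InSieve.mul co ?_ ?_)
    (Nat.mod_modEq _ _).symm) hk⟩
  · rcases h.2.2 with h | ⟨h, h'⟩
    · rw [Nat.mod_eq_of_lt (by omega)]
      omega
    · rw [Nat.mod_eq_sub_mod (by omega), Nat.mod_eq_of_lt (by omega)]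
      omega
  · refine a3.congr ?_
    simpa using ((Nat.modEq_zero_iff_dvd.2 b2).symm).add_left α
  · refine b3.congr ?_
    simpa using ((Nat.modEq_zero_iff_dvd.2 a2).symm).add_right β

/-! ### The lists of primes -/

lemma primesIn_prime {lo n r : ℕ} (h : r ∈ (primesIn lo n).val) : r.Prime :=
  ((mem_primesIn lo n r).1 h).2.2

lemma primesIn_pos {lo n : ℕ} : ∀ r ∈ (primesIn lo n).val, 0 < r :=
  fun _ h => (primesIn_prime h).pos

lemma pairwise_coprime_primesIn (lo n : ℕ) : (primesIn lo n).val.Pairwise Nat.Coprime :=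
  (nodup_primesIn lo n).imp_of_mem
    (fun ha hb h => (Nat.coprime_primes (primesIn_prime ha) (primesIn_prime hb)).2 h)

lemma coprime_prod_primesIn (lo B₁ B₂ : ℕ) :
    Nat.Coprime (primesIn lo B₁).val.prod (primesIn B₁ B₂).val.prod := by
  rw [Nat.coprime_list_prod_left_iff]
  intro p hp
  rw [Nat.coprime_list_prod_right_iff]
  intro q hq
  refine (Nat.coprime_primes (primesIn_prime hp) (primesIn_prime hq)).2 ?_
  have h1 := ((mem_primesIn _ _ _).1 hp).2.1
  have h2 := ((mem_primesIn _ _ _).1 hq).1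
  omega

lemma length_primesIn_le (lo n : ℕ) : (primesIn lo n).val.length ≤ n + 1 :=
  length_le_of_forall_lt (nodup_primesIn lo n)
    (fun _ hr => Nat.lt_succ_of_le ((mem_primesIn _ _ _).1 hr).2.1)

lemma two_pow_length_le_prod : ∀ {l : List ℕ}, (∀ r ∈ l, 2 ≤ r) → 2 ^ l.length ≤ l.prod
  | [], _ => by simp
  | r :: l, h => by
    have ih := two_pow_length_le_prod (l := l) (fun x hx => h x (by simp [hx]))
    rw [List.length_cons, List.prod_cons, pow_succ, mul_comm]
    exact Nat.mul_le_mul (h r (by simp)) ih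

/-- As all primes are at least `2`, a factor equal to the number of primes costs no more than a
length. -/
lemma length_primesIn_le_len (lo n : ℕ) :
    (primesIn lo n).val.length ≤ len (primesIn lo n).val.prod := by
  have h1 := two_pow_length_le_prod (fun r hr => (primesIn_prime (lo := lo) (n := n) hr).two_le)
  have h2 := (Nat.lt_size.2 h1)
  rw [len]
  omega

/-! ### The value of the algorithm -/

/-- The value of the algorithm in terms of the values of its parts. -/
lemma factor_val (N Λ B₁ B₂ a b : ℕ) {P₁ P₂ : List ℕ} {m₁ m₂ k L : ℕ}
    (hP₁ : (primesIn 2 B₁).val = P₁) (hP₂ : (primesIn B₁ B₂).val = P₂)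
    (hm₁ : P₁.prod = m₁) (hm₂ : P₂.prod = m₂) (hk : a * b % (m₁ * m₂) = k)
    (hL : HypSieve.shift N a b = L) :
    (factor N Λ B₁ B₂ a b).val =
      if 1 < Nat.gcd N (m₁ * m₂) then
        if Nat.gcd N (m₁ * m₂) < N then some (Nat.gcd N (m₁ * m₂))
        else (P₁.find? (fun x => decide (x ∣ N))).or (P₂.find? (fun x => decide (x ∣ N)))
      else (meet N (4 * (a * b * N)) L (m₁ * m₂) Λ (sort (weightsOf N k L P₂ m₁)).val.toArray
        (sort (weightsOf N k L P₁ m₂)).val).val := by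
  subst hP₁ hP₂ hm₁ hm₂ hk hL
  simp only [factor, val_bind, prod_val, val_mul, gcd_val, val_lt, decide_eq_true_eq, val_ite,
    val_pure, sqrtUp_eq_shift, val_rem, residues_val, toArray_val, Array.empty_append,
    firstDivisor_val]
  congr 1
  congr 1
  rcases List.find? (fun x => decide (x ∣ N)) (primesIn 2 B₁).val with _ | d
  · simp [firstDivisor_val]
  · simp

/-- The cost of the algorithm in terms of the costs of its parts. -/
lemma factor_cost_eq (N Λ B₁ B₂ a b : ℕ) {P₁ P₂ : List ℕ} {m₁ m₂ k L : ℕ}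
    (hP₁ : (primesIn 2 B₁).val = P₁) (hP₂ : (primesIn B₁ B₂).val = P₂)
    (hm₁ : P₁.prod = m₁) (hm₂ : P₂.prod = m₂) (hk : a * b % (m₁ * m₂) = k)
    (hL : HypSieve.shift N a b = L) :
    (factor N Λ B₁ B₂ a b).cost ≤
      (primesIn 2 B₁).cost + (primesIn B₁ B₂).cost + (prod P₁).cost + (prod P₂).cost +
      (mul m₁ m₂).cost + (gcd N (m₁ * m₂)).cost + (lt 1 (Nat.gcd N (m₁ * m₂))).cost +
      (lt (Nat.gcd N (m₁ * m₂)) N).cost + (firstDivisor N P₁).cost + (firstDivisor N P₂).cost +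
      (mul a b).cost + (mul (a * b) N).cost + (mul 4 (a * b * N)).cost +
      (sqrtUp (4 * (a * b * N))).cost + (rem (a * b) (m₁ * m₂)).cost +
      (residues N k L P₁).cost + (residues N k L P₂).cost +
      (chinese m₁ (systems N k L P₁)).cost + (chinese m₂ (systems N k L P₂)).cost +
      (inv m₂ m₁).cost +
      (weightList m₁ m₂ (inv m₂ m₁).val (chinese m₁ (systems N k L P₁)).val).cost +
      (sort (weightsOf N k L P₁ m₂)).cost + (inv m₁ m₂).cost +
      (weightList m₂ m₁ (inv m₁ m₂).val (chinese m₂ (systems N k L P₂)).val).cost +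
      (sort (weightsOf N k L P₂ m₁)).cost +
      (toArray (sort (weightsOf N k L P₂ m₁)).val #[]).cost +
      (meet N (4 * (a * b * N)) L (m₁ * m₂) Λ (sort (weightsOf N k L P₂ m₁)).val.toArray
        (sort (weightsOf N k L P₁ m₂)).val).cost := by
  subst hP₁ hP₂ hm₁ hm₂ hk hL
  simp only [factor, cost_bind, prod_val, val_mul, gcd_val, val_lt, decide_eq_true_eq, cost_ite,
    cost_pure, sqrtUp_eq_shift, val_rem, residues_val, toArray_val, Array.empty_append,
    firstDivisor_val]
  split_ifs
  · omega
  · split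
    · rw [cost_pure]
      omega
    · omega
  · simp only [weightsOf, systems]
    omega

/-! ### Correctness -/

lemma exists_of_fermatBound_lt {N a b Λ : ℕ} (h1 : 1 < N) (hN : ¬ N.Prime)
    (h : HypSieve.fermatBound N a b < Λ) : ∃ u v : ℕ, N = u * v ∧ u ≠ 1 ∧ v ≠ 1 ∧
      ((a : ℝ) * u - b * v) ^ 2 / (4 * √((a : ℝ) * b * N)) < Λ := by
  -- Only some element below `Λ` is needed, not that the infimum is attained. Nonemptiness matters,
  -- and is supplied by the smallest prime factor of the composite `N`.
  obtain ⟨x, ⟨u, v, huv, hu, hv, rfl⟩, hx⟩ := exists_lt_of_csInf_lt (by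
    refine ⟨_, N.minFac, N / N.minFac, (Nat.mul_div_cancel' N.minFac_dvd).symm,
      (Nat.minFac_prime h1.ne').one_lt.ne', fun h => ?_, rfl⟩
    have h2 := Nat.mul_div_cancel' N.minFac_dvd
    rw [h, mul_one] at h2
    exact hN (h2 ▸ Nat.minFac_prime h1.ne')) h
  exact ⟨u, v, huv, hu, hv, hx⟩

/-- With `w = √(abN)` and `s = au + bv`, factor `(au - bv)² = (s - 2w)(s + 2w)`. Nonnegativity of
the square gives `s ≥ 2w`, and then `s + 2w ≥ 4w` gives `s - 2w < Λ`. Since `s` is an integer, `2w`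
may be rounded up to `L` in the first inequality; in the second this only helps. -/
lemma shift_le_and_lt {N a b u v Λ : ℕ} (ha : 0 < a) (hb : 0 < b) (hN : 0 < N) (huv : N = u * v)
    (h : ((a : ℝ) * u - b * v) ^ 2 / (4 * √((a : ℝ) * b * N)) < Λ) :
    HypSieve.shift N a b ≤ a * u + b * v ∧ a * u + b * v < HypSieve.shift N a b + Λ := by
  have hpos : (0 : ℝ) < (a : ℝ) * b * N := by positivity
  have hw := Real.sqrt_pos.2 hpos
  have hw2 := Real.sq_sqrt hpos.le
  have hL := Nat.le_ceil (2 * √((a : ℝ) * b * N))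
  change _ ≤ (HypSieve.shift N a b : ℝ) at hL
  rw [HypSieve.shift] at hL ⊢
  set w := √((a : ℝ) * b * N)
  have hN' : (N : ℝ) = u * v := by exact_mod_cast huv
  have hs : (0 : ℝ) ≤ (a : ℝ) * u + b * v := by positivity
  have hsq : ((a : ℝ) * u - b * v) ^ 2 = (a * u + b * v - 2 * w) * (a * u + b * v + 2 * w) := by
    have : (2 * w) ^ 2 = 4 * (a * b * (u * v)) := by rw [mul_pow, hw2, hN']; ring
    linear_combination this
  have h2 : 2 * w ≤ (a : ℝ) * u + b * v := by
    by_contra hc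
    have : (a * u + b * v - 2 * w) * (a * u + b * v + 2 * w) < 0 :=
      mul_neg_of_neg_of_pos (by linarith) (by linarith)
    linarith [sq_nonneg ((a : ℝ) * u - b * v)]
  constructor
  · rw [Nat.ceil_le]
    push_cast
    exact h2
  · rw [div_lt_iff₀ (by linarith), hsq] at h
    have h3 : (a * u + b * v - 2 * w) * (4 * w) ≤
        (a * u + b * v - 2 * w) * (a * u + b * v + 2 * w) :=
      mul_le_mul_of_nonneg_left (by linarith) (by linarith)
    have h4 : (a : ℝ) * u + b * v - 2 * w < Λ :=
      lt_of_mul_lt_mul_right (h3.trans_lt h) (by linarith)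
    have h5 : ((a * u + b * v : ℕ) : ℝ) < (⌈2 * w⌉₊ + Λ : ℕ) := by
      push_cast
      linarith
    exact_mod_cast h5

/-- Passing from `(u, v)` to the point `(u/b, bv)` turns the form `au + bv` into `(ab) x + y`, on
the same hyperbola. -/
lemma inSieve_linear {M N a b u v L α : ℕ} (hM : 0 < M) (hb : Nat.Coprime b M) (huv : N = u * v)
    (h : α + L = a * u + b * v) : InSieve M N (a * b) L α := by
  have hinv := inv_val hM hb
  set c := (inv b M).val
  refine ⟨u * c, b * v, ?_, ?_⟩
  · have := hinv.mul_left (u * v)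
    rw [mul_one, ← huv] at this
    convert this using 1
    rw [huv]; ring
  · rw [h]
    refine Nat.ModEq.add_right _ ?_
    have := hinv.mul_left (a * u)
    rw [mul_one] at this
    convert this using 1
    ring

lemma gcd_two_mul {N b u v : ℕ} (hN : Odd N) (hb : Nat.Coprime b N) (huv : N = u * v) :
    Nat.gcd (2 * (b * v)) N = v := by
  rw [← mul_assoc, Nat.Coprime.gcd_mul_left_cancel _
    (Nat.Coprime.mul_left (Nat.coprime_two_left.2 hN) hb), huv, Nat.gcd_mul_left_right]

/-- With `e = au - bv` one has `(au + bv)² - 4abN = e²` and `(au + bv) - e = 2bv`, and `2b` is a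
unit modulo `N`. The order of `au` and `bv` decides which factor is found. -/
lemma try_ne_none_of_le {N a b u v L α : ℕ} (hN : Odd N) (h1 : 1 < N) (hb : Nat.Coprime b N)
    (huv : N = u * v) (hu : u ≠ 1) (hv : v ≠ 1) (h : α + L = a * u + b * v) (hle : b * v ≤ a * u) :
    (try_ N (4 * (a * b * N)) L α).val ≠ none := by
  obtain ⟨e, he⟩ := Nat.exists_eq_add_of_le hle
  have hv0 : v ≠ 0 := fun h => by simp [h] at huv; omega
  have hu0 : u ≠ 0 := fun h => by simp [h] at huv; omega
  have hsub : α + L - e = 2 * (b * v) := by rw [h, he]; omega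
  have hg : Nat.gcd (α + L - e) N = v := by rw [hsub, gcd_two_mul hN hb huv]
  refine try_ne_none (y := e) ?_ (by rw [hg]; omega) ?_
  · have h4 : 4 * (a * b * N) = 4 * ((a * u) * (b * v)) := by rw [huv]; ring
    rw [h, h4, he]
    refine Nat.sub_eq_of_eq_add ?_
    ring
  · rw [hg, huv]
    exact lt_mul_of_one_lt_left (by omega) (by omega)

lemma factor_correct {N Λ B₁ B₂ a b m₁ m₂ : ℕ} (hodd : Odd N) (h1 : 1 < N) (hN : ¬ N.Prime)
    (hm₁ : m₁ = HypSieve.primeProd 2 B₁) (hm₂ : m₂ = HypSieve.primeProd B₁ B₂)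
    (hΛ : Λ < m₁ * m₂) (hab : Nat.Coprime (a * b) (m₁ * m₂ * N))
    (h : HypSieve.fermatBound N a b < Λ) :
    ∃ d : ℕ, (factor N Λ B₁ B₂ a b).val = some d ∧ d ∣ N ∧ 1 < d ∧ d < N := by
  rw [← prod_primesIn] at hm₁ hm₂
  have hco : Nat.Coprime m₁ m₂ := by rw [hm₁, hm₂]; exact coprime_prod_primesIn _ _ _
  rw [factor_val N Λ B₁ B₂ a b rfl rfl hm₁.symm hm₂.symm rfl rfl]
  split_ifs with hg hg'
  · exact ⟨_, rfl, Nat.gcd_dvd_left _ _, hg, hg'⟩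
  -- Here the gcd is `N`. The smallest prime factor of `N` divides `M`, hence is a prime of one of
  -- the lists, so the search finds a divisor; being prime, it differs from the composite `N`.
  · have hdvd : N ∣ m₁ * m₂ := by
      have := Nat.gcd_le_left (m₁ * m₂) (show 0 < N by omega)
      have e : Nat.gcd N (m₁ * m₂) = N := by omega
      exact e ▸ Nat.gcd_dvd_right _ _
    have hp := Nat.minFac_prime h1.ne'
    have key : ∀ {lo n : ℕ}, N.minFac ∣ (primesIn lo n).val.prod → N.minFac ∈ (primesIn lo n).val :=
      fun {lo n} hd => by
        obtain ⟨r, hr, hd⟩ := (hp.prime.dvd_prod_iff).1 hd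
        rwa [(Nat.prime_dvd_prime_iff_eq hp (primesIn_prime hr)).1 hd]
    have hmem : N.minFac ∈ (primesIn 2 B₁).val ∨ N.minFac ∈ (primesIn B₁ B₂).val := by
      rcases (hp.dvd_mul).1 (N.minFac_dvd.trans hdvd) with hd | hd
      · exact .inl (key (hm₁ ▸ hd))
      · exact .inr (key (hm₂ ▸ hd))
    have good : ∀ {lo n d : ℕ}, (primesIn lo n).val.find? (fun x => decide (x ∣ N)) = some d →
        d ∣ N ∧ 1 < d ∧ d < N := fun {lo n d} hd => by
      have hd1 : d ∣ N := by simpa using List.find?_some hd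
      have hd2 := primesIn_prime (List.mem_of_find?_eq_some hd)
      exact ⟨hd1, hd2.one_lt, lt_of_le_of_ne (Nat.le_of_dvd (by omega) hd1)
        (fun e => hN (e ▸ hd2))⟩
    rcases h2 : (primesIn 2 B₁).val.find? (fun x => decide (x ∣ N)) with _ | d
    · rcases h3 : (primesIn B₁ B₂).val.find? (fun x => decide (x ∣ N)) with _ | d
      · exfalso
        rw [List.find?_eq_none] at h2 h3
        rcases hmem with hm | hm
        · exact h2 _ hm (by simpa using N.minFac_dvd)
        · exact h3 _ hm (by simpa using N.minFac_dvd)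
      · exact ⟨d, by simp, good h3⟩
    · exact ⟨d, by simp, good h2⟩
  · have hpos₁ : 0 < m₁ := by rw [hm₁]; exact List.prod_pos primesIn_pos
    have hpos₂ : 0 < m₂ := by rw [hm₂]; exact List.prod_pos primesIn_pos
    have hM : 0 < m₁ * m₂ := Nat.mul_pos hpos₁ hpos₂
    have ha0 : a ≠ 0 := fun h => by simp [h] at hab; omega
    have hb0 : b ≠ 0 := fun h => by simp [h] at hab; omega
    have haN : Nat.Coprime a N := (hab.coprime_mul_right).coprime_mul_left_right
    have hbN : Nat.Coprime b N := (hab.coprime_mul_left).coprime_mul_left_right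
    have hbM : Nat.Coprime b (m₁ * m₂) := (hab.coprime_mul_left).coprime_mul_right_right
    obtain ⟨u, v, huv, hu, hv, hx⟩ := exists_of_fermatBound_lt h1 hN h
    obtain ⟨hle, hlt⟩ := shift_le_and_lt (by omega) (by omega) (by omega) huv hx
    obtain ⟨α, hα⟩ := Nat.exists_eq_add_of_le hle
    set L := HypSieve.shift N a b
    have hαL : α + L = a * u + b * v := by omega
    have hαΛ : α < Λ := by omega
    have htry : (try_ N (4 * (a * b * N)) L α).val ≠ none := by
      rcases le_total (b * v) (a * u) with hc | hc
      · exact try_ne_none_of_le hodd h1 hbN huv hu hv hαL hc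
      -- The same lemma with `(a, u)` and `(b, v)` exchanged.
      · rw [mul_comm a b]
        exact try_ne_none_of_le hodd h1 haN (huv.trans (mul_comm u v)) hv hu
          (hαL.trans (add_comm _ _)) hc
    have hin : InSieve (m₁ * m₂) N (a * b % (m₁ * m₂)) L α :=
      (inSieve_linear hM hbM huv hαL).congr_coeff (Nat.mod_modEq _ _).symm
    -- The two components of `α`: congruent to `(α, 0)` and to `(0, α)` modulo `(m₁, m₂)`.
    obtain ⟨α₁, a1, a2⟩ := Nat.chineseRemainder hco α 0
    obtain ⟨α₂, b1, b2⟩ := Nat.chineseRemainder hco 0 α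
    have w₁ : α₁ % (m₁ * m₂) ∈ weightsOf N (a * b % (m₁ * m₂)) L (primesIn 2 B₁).val m₂ := by
      have hred := Nat.mod_modEq α₁ (m₁ * m₂)
      rw [mem_weightsOf (pairwise_coprime_primesIn _ _) primesIn_pos hpos₂ (hm₁ ▸ hco.symm), ← hm₁]
      exact ⟨Nat.mod_lt _ hM,
        Nat.modEq_zero_iff_dvd.1 ((hred.of_dvd (dvd_mul_left _ _)).trans a2),
        (hin.mono (dvd_mul_right _ _)).congr ((hred.of_dvd (dvd_mul_right _ _)).trans a1).symm⟩
    have w₂ : α₂ % (m₁ * m₂) ∈ weightsOf N (a * b % (m₁ * m₂)) L (primesIn B₁ B₂).val m₁ := by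
      have hred := Nat.mod_modEq α₂ (m₁ * m₂)
      rw [mem_weightsOf (pairwise_coprime_primesIn _ _) primesIn_pos hpos₁ (hm₂ ▸ hco), ← hm₂,
        mul_comm m₂ m₁]
      exact ⟨Nat.mod_lt _ hM,
        Nat.modEq_zero_iff_dvd.1 ((hred.of_dvd (dvd_mul_right _ _)).trans b1),
        (hin.mono (dvd_mul_left _ _)).congr ((hred.of_dvd (dvd_mul_left _ _)).trans b2).symm⟩
    have hsum : (α₁ % (m₁ * m₂) + α₂ % (m₁ * m₂)) % (m₁ * m₂) = α := by
      rw [← Nat.add_mod]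
      have : α₁ + α₂ ≡ α [MOD m₁ * m₂] := by
        rw [← Nat.modEq_and_modEq_iff_modEq_mul hco]
        exact ⟨by simpa using a1.add b1, by simpa using a2.add b2⟩
      rwa [Nat.ModEq, Nat.mod_eq_of_lt (hαΛ.trans hΛ)] at this
    have l1 := Nat.mod_lt α₁ hM
    have l2 := Nat.mod_lt α₂ hM
    generalize α₁ % (m₁ * m₂) = β₁ at *
    generalize α₂ % (m₁ * m₂) = β₂ at *
    -- Since `β₁, β₂ < M`, their sum is either `α` or `α + M`; these are the two search ranges.
    have hcond : β₂ < Λ - β₁ ∨ (m₁ * m₂ - β₁ ≤ β₂ ∧ β₂ < m₁ * m₂ + Λ - β₁) := by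
      rcases Nat.lt_or_ge (β₁ + β₂) (m₁ * m₂) with hc | hc
      · rw [Nat.mod_eq_of_lt hc] at hsum
        exact .inl (by omega)
      · rw [Nat.mod_eq_sub_mod hc, Nat.mod_eq_of_lt (by omega)] at hsum
        exact .inr (by omega)
    have hne := meet_ne_none (N := N) (f := 4 * (a * b * N)) (L := L) (sort_sorted _)
      ((sort_perm _).mem_iff.2 w₂) hcond (by rwa [hsum]) ((sort_perm _).mem_iff.2 w₁)
    obtain ⟨d, hd⟩ := Option.ne_none_iff_exists'.1 hne
    exact ⟨d, hd, meet_some hd⟩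

/-! ### The running time -/

lemma chinese_systems_cost {l : List ℕ} {N k L B ℓ n : ℕ} (hl : ∀ r ∈ l, 0 < r)
    (hB : ∀ r ∈ l, r ≤ B) (hlen : 4 * len l.prod ≤ ℓ) (h1 : l.length ≤ B) (h2 : l.length ≤ ℓ)
    (hℓ : 1 ≤ ℓ) (hB1 : 1 ≤ B)
    (hn : (chinese l.prod (systems N k L l)).val.length = n) :
    (chinese l.prod (systems N k L l)).cost ≤
      41 * (B ^ 2 * (ℓ * unit ℓ)) + 8 * (n * (ℓ * unit ℓ)) + 3 * (ℓ * unit ℓ) := by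
  have hm : 0 < l.prod := List.prod_pos hl
  have hR := admissible_systems hl N k L
  have hfst : (systems N k L l).map Prod.fst = l := by
    rw [systems, List.map_map]
    exact List.map_id _
  have hlen' : (systems N k L l).length = l.length := by simp [systems]
  have h := chinese_cost (B := B) hm hlen hR (by rw [hfst]) (fun p hp => by
    obtain ⟨r, hr, rfl⟩ := List.mem_map.1 hp
    exact ⟨hl r hr, hB r hr⟩)
  have hcomb : combinations (systems N k L l) = n := by
    rw [← hn, chinese_val hm hR, List.length_map, List.length_range]
  rw [hlen', hcomb] at h
  have e1 : l.length * ((16 * ℓ + 18 + 7 * B) * unit ℓ) ≤ 41 * (B ^ 2 * (ℓ * unit ℓ)) := by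
    have : l.length * (16 * ℓ + 18 + 7 * B) ≤ 41 * (B ^ 2 * ℓ) := by
      have h3 : 16 * ℓ + 18 + 7 * B ≤ 41 * (B * ℓ) := by nlinarith [Nat.mul_le_mul hB1 hℓ]
      calc l.length * (16 * ℓ + 18 + 7 * B) ≤ B * (41 * (B * ℓ)) := Nat.mul_le_mul h1 h3
        _ = 41 * (B ^ 2 * ℓ) := by ring
    calc l.length * ((16 * ℓ + 18 + 7 * B) * unit ℓ)
        = l.length * (16 * ℓ + 18 + 7 * B) * unit ℓ := by ring
      _ ≤ 41 * (B ^ 2 * ℓ) * unit ℓ := Nat.mul_le_mul_right _ this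
      _ = 41 * (B ^ 2 * (ℓ * unit ℓ)) := by ring
  have e2 : n * ((6 * l.length + 2) * unit ℓ) ≤ 8 * (n * (ℓ * unit ℓ)) := by
    have : 6 * l.length + 2 ≤ 8 * ℓ := by omega
    calc n * ((6 * l.length + 2) * unit ℓ) ≤ n * (8 * ℓ * unit ℓ) :=
          Nat.mul_le_mul_left _ (Nat.mul_le_mul_right _ this)
      _ = 8 * (n * (ℓ * unit ℓ)) := by ring
  have e3 : unit ℓ ≤ ℓ * unit ℓ := Nat.le_mul_of_pos_left _ hℓ
  omega

lemma mul_const_le {c d ℓ x : ℕ} (h : c ≤ d * ℓ) : x * (c * unit ℓ) ≤ d * (x * (ℓ * unit ℓ)) := by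
  calc x * (c * unit ℓ) ≤ x * (d * ℓ * unit ℓ) :=
        Nat.mul_le_mul_left _ (Nat.mul_le_mul_right _ h)
    _ = d * (x * (ℓ * unit ℓ)) := by ring

/-- The term `B + 1 + 2` is what `primesIn_cost` yields at the bound `B₂ + 1`. Everything polynomial
in `B₂` is compared with `(B₂ + 2)⁴`, which stems from at most `B₂ + 1` primes at cubic cost. -/
lemma quadratic_le {x B u V : ℕ} (hx : x ≤ B) (hu : u ≤ V) :
    x * ((B + 1 + 2) * (3 * u)) ≤ 3 * ((B + 2) ^ 4 * V) := by
  have h : x * (B + 1 + 2) ≤ (B + 2) ^ 4 :=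
    calc x * (B + 1 + 2) ≤ B * (B + 1 + 2) := Nat.mul_le_mul_right _ hx
      _ ≤ (B + 2) ^ 2 := by nlinarith
      _ ≤ (B + 2) ^ 4 := Nat.pow_le_pow_right (by omega) (by norm_num)
  calc x * ((B + 1 + 2) * (3 * u)) = 3 * (x * (B + 1 + 2) * u) := by ring
    _ ≤ 3 * ((B + 2) ^ 4 * V) := Nat.mul_le_mul_left _ (Nat.mul_le_mul h hu)

lemma quartic_le {x B u V : ℕ} (hx : x ≤ B + 1) (hu : u ≤ V) :
    x * ((B + 1 + 1) ^ 3 * (11 * u)) ≤ 11 * ((B + 2) ^ 4 * V) := by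
  have h : x * (B + 2) ^ 3 ≤ (B + 2) ^ 4 := by
    rw [pow_succ (B + 2) 3, mul_comm]
    exact Nat.mul_le_mul_left _ (by omega)
  calc x * ((B + 1 + 1) ^ 3 * (11 * u)) = 11 * (x * (B + 2) ^ 3 * u) := by ring
    _ ≤ 11 * ((B + 2) ^ 4 * V) := Nat.mul_le_mul_left _ (Nat.mul_le_mul h hu)

lemma square_le (B V : ℕ) : (B + 1) ^ 2 * V ≤ (B + 2) ^ 4 * V :=
  Nat.mul_le_mul_right _ ((Nat.pow_le_pow_left (by omega) 2).trans
    (Nat.pow_le_pow_right (by omega) (by norm_num)))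

-- The coefficient `12` in the requirement on `ℓ` comes from the trials: there `L ≤ 4abN` has length
-- at most `3 * len N + 4`, and `try_cost` asks for four times the lengths of `α` and `L`.
set_option maxHeartbeats 1000000 in
lemma factor_cost_le {N Λ B₁ B₂ a b : ℕ} {P₁ P₂ : List ℕ} {m₁ m₂ k ℓ n₁ n₂ n : ℕ}
    (hN : 1 < N) (hB : B₁ < B₂) (ha : a < N) (hb : b < N)
    (hP₁ : (primesIn 2 B₁).val = P₁) (hP₂ : (primesIn B₁ B₂).val = P₂)
    (hm₁ : P₁.prod = m₁) (hm₂ : P₂.prod = m₂) (hk : a * b % (m₁ * m₂) = k)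
    (hΛ : Λ < m₁ * m₂)
    (hℓ : 12 * (len (m₁ * m₂) + len N + len (B₂ + 1)) + 24 ≤ ℓ)
    (hn₁ : (weightsOf N k (HypSieve.shift N a b) P₁ m₂).length = n₁)
    (hn₂ : (weightsOf N k (HypSieve.shift N a b) P₂ m₁).length = n₂)
    (hn : ((sort (weightsOf N k (HypSieve.shift N a b) P₁ m₂)).val.map (tries (m₁ * m₂) Λ
      (sort (weightsOf N k (HypSieve.shift N a b) P₂ m₁)).val)).sum = n) :
    (factor N Λ B₁ B₂ a b).cost ≤ 300 * (((B₂ + 2) ^ 4 + n₁ + n₂ + n) * (ℓ * unit ℓ)) := by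
  have main := factor_cost_eq N Λ B₁ B₂ a b hP₁ hP₂ hm₁ hm₂ hk rfl
  have hpos₁ : ∀ r ∈ P₁, 0 < r := hP₁ ▸ primesIn_pos
  have hpos₂ : ∀ r ∈ P₂, 0 < r := hP₂ ▸ primesIn_pos
  have hco₁ : P₁.Pairwise Nat.Coprime := hP₁ ▸ pairwise_coprime_primesIn _ _
  have hco₂ : P₂.Pairwise Nat.Coprime := hP₂ ▸ pairwise_coprime_primesIn _ _
  have hco : Nat.Coprime m₁ m₂ := by
    rw [← hm₁, ← hm₂, ← hP₁, ← hP₂]; exact coprime_prod_primesIn _ _ _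
  have hle₁ : ∀ r ∈ P₁, r ≤ B₂ + 1 := fun r hr => by
    rw [← hP₁] at hr
    have := ((mem_primesIn _ _ _).1 hr).2.1
    omega
  have hle₂ : ∀ r ∈ P₂, r ≤ B₂ + 1 := fun r hr => by
    rw [← hP₂] at hr
    have := ((mem_primesIn _ _ _).1 hr).2.1
    omega
  have q₁ : P₁.length ≤ B₂ + 1 := by
    have := length_primesIn_le 2 B₁
    rw [hP₁] at this; omega
  have q₂ : P₂.length ≤ B₂ + 1 := by
    have := length_primesIn_le B₁ B₂
    rw [hP₂] at this; omega
  have q₁' : P₁.length ≤ len m₁ := by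
    have := length_primesIn_le_len 2 B₁
    rwa [hP₁, hm₁] at this
  have q₂' : P₂.length ≤ len m₂ := by
    have := length_primesIn_le_len B₁ B₂
    rwa [hP₂, hm₂] at this
  have hm₁0 : 0 < m₁ := hm₁ ▸ List.prod_pos hpos₁
  have hm₂0 : 0 < m₂ := hm₂ ▸ List.prod_pos hpos₂
  have hM : 0 < m₁ * m₂ := Nat.mul_pos hm₁0 hm₂0
  set L := HypSieve.shift N a b with hLdef
  have hLf : L ≤ 4 * (a * b * N) := by rw [hLdef, ← sqrtUp_eq_shift]; exact sqrtUp_le _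
  have lN := len_pos N
  have lM := len_pos (m₁ * m₂)
  have lB := len_pos (B₂ + 1)
  have lm₁ := len_mono (Nat.le_mul_of_pos_right m₁ hm₂0)
  have lm₂ := len_mono (Nat.le_mul_of_pos_left m₂ hm₁0)
  have la := len_mono ha.le
  have lb := len_mono hb.le
  have lab := len_mul_le a b
  have labN := len_mul_le (a * b) N
  have lf := len_mul_le 4 (a * b * N)
  rw [len_four] at lf
  have lL := len_mono hLf
  have lk : len k ≤ len (m₁ * m₂) := len_mono (hk ▸ (Nat.mod_lt _ hM).le)
  have lg := len_mono (Nat.gcd_le_left (m₁ * m₂) (show 0 < N by omega))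
  have l1 : len 1 ≤ ℓ := by rw [len_one]; omega
  have hx₁ : (chinese P₁.prod (systems N k L P₁)).val.length = n₁ := by
    rw [← hn₁, length_weightsOf]
  have hx₂ : (chinese P₂.prod (systems N k L P₂)).val.length = n₂ := by
    rw [← hn₂, length_weightsOf]
  have hX₁ : ∀ x ∈ (chinese m₁ (systems N k L P₁)).val, x < m₁ := fun x hx => by
    rw [← hm₁] at hx ⊢
    exact ((mem_chinese_systems hco₁ hpos₁ _ _ _ _).1 hx).1
  have hX₂ : ∀ x ∈ (chinese m₂ (systems N k L P₂)).val, x < m₂ := fun x hx => by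
    rw [← hm₂] at hx ⊢
    exact ((mem_chinese_systems hco₂ hpos₂ _ _ _ _).1 hx).1
  have hW₁ : ∀ x ∈ weightsOf N k L P₁ m₂, x < m₁ * m₂ := fun x hx => by
    rw [mem_weightsOf hco₁ hpos₁ hm₂0 (hm₁ ▸ hco.symm), hm₁] at hx
    exact hx.1
  have hW₂ : ∀ x ∈ weightsOf N k L P₂ m₁, x < m₁ * m₂ := fun x hx => by
    rw [mem_weightsOf hco₂ hpos₂ hm₁0 (hm₂ ▸ hco), hm₂, mul_comm] at hx
    exact hx.1
  have hlW₁ : ∀ x ∈ weightsOf N k L P₁ m₂, len x ≤ ℓ := fun x hx => by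
    have := len_mono (hW₁ x hx).le
    omega
  have hlW₂ : ∀ x ∈ weightsOf N k L P₂ m₁, len x ≤ ℓ := fun x hx => by
    have := len_mono (hW₂ x hx).le
    omega
  have hn₁m : n₁ ≤ m₁ * m₂ := by
    rw [← hn₁]
    exact length_le_of_forall_lt (nodup_weightsOf hco₁ hpos₁ hm₂0 (hm₁ ▸ hco.symm) _ _ _) hW₁
  have hn₂m : n₂ ≤ m₁ * m₂ := by
    rw [← hn₂]
    exact length_le_of_forall_lt (nodup_weightsOf hco₂ hpos₂ hm₁0 (hm₂ ▸ hco) _ _ _) hW₂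
  -- So the lists have at most `2 ^ ℓ` entries, and `ℓ` bounds the depth of merge sort.
  have hMpow : m₁ * m₂ ≤ 2 ^ ℓ := (Nat.lt_size_self _).le.trans
    (Nat.pow_le_pow_right (by norm_num) (by simp only [len] at hℓ; omega))
  have ln₁ := len_mono hn₁m
  have ln₂ := len_mono hn₂m
  have p₁ := sort_perm (weightsOf N k L P₁ m₂)
  have p₂ := sort_perm (weightsOf N k L P₂ m₁)
  -- The common bound is `B₂ + 1` instead of `B₂` because it must also dominate `lo = 2`, and `B₂`
  -- may be `1`.
  have c1 := primesIn_cost (ℓ := ℓ) (B := B₂ + 1) (lo := 2) (by omega) (by omega)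
    (show B₁ ≤ B₂ + 1 by omega)
  have c2 := primesIn_cost (ℓ := ℓ) (B := B₂ + 1) (lo := B₁) (by omega) (by omega)
    (show B₂ ≤ B₂ + 1 by omega)
  have c3 := prod_cost (ℓ := ℓ) (l := P₁) hpos₁ (by rw [hm₁]; omega)
  have c4 := prod_cost (ℓ := ℓ) (l := P₂) hpos₂ (by rw [hm₂]; omega)
  have c5 := cost_mul_le (x := m₁) (y := m₂) (ℓ := ℓ) (by omega) (by omega)
  have c6 := gcd_cost (x := N) (y := m₁ * m₂) (ℓ := ℓ) (by omega) (by omega)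
  have c7 := cost_lt_le (x := 1) (y := Nat.gcd N (m₁ * m₂)) (ℓ := ℓ) l1 (by omega)
  have c8 := cost_lt_le (x := Nat.gcd N (m₁ * m₂)) (y := N) (ℓ := ℓ) (by omega) (by omega)
  have c9 := firstDivisor_cost (N := N) (ℓ := ℓ) (by omega) (l := P₁)
    (fun x hx => by have := len_mono (hle₁ x hx); omega)
  have c10 := firstDivisor_cost (N := N) (ℓ := ℓ) (by omega) (l := P₂)
    (fun x hx => by have := len_mono (hle₂ x hx); omega)
  have c11 := cost_mul_le (x := a) (y := b) (ℓ := ℓ) (by omega) (by omega)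
  have c12 := cost_mul_le (x := a * b) (y := N) (ℓ := ℓ) (by omega) (by omega)
  have c13 := cost_mul_le (x := 4) (y := a * b * N) (ℓ := ℓ) (by rw [len_four]; omega) (by omega)
  have c14 := sqrtUp_cost (n := 4 * (a * b * N)) (ℓ := ℓ) (by omega)
  have c15 := cost_rem_le (x := a * b) (y := m₁ * m₂) (ℓ := ℓ) (by omega) (by omega)
  have c16 := residues_cost (B := B₂ + 1) (N := N) (k := k) (L := L) (ℓ := ℓ) (by omega) hle₁
  have c17 := residues_cost (B := B₂ + 1) (N := N) (k := k) (L := L) (ℓ := ℓ) (by omega) hle₂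
  have c18 := chinese_systems_cost (ℓ := ℓ) hpos₁ hle₁ (by rw [hm₁]; omega) q₁ (by omega)
    (by omega) (by omega) hx₁
  have c19 := chinese_systems_cost (ℓ := ℓ) hpos₂ hle₂ (by rw [hm₂]; omega) q₂ (by omega)
    (by omega) (by omega) hx₂
  rw [hm₁] at hx₁ c18
  rw [hm₂] at hx₂ c19
  have c20 := inv_cost (x := m₂) (m := m₁) (ℓ := ℓ) hm₁0 (by omega) (by omega)
  have c21 := weightList_cost (m := m₁) (m' := m₂) (ℓ := ℓ) hm₁0 (inv_lt m₂ hm₁0).le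
    (by omega) hX₁
  have c22 := sort_cost (hn₁.le.trans (hn₁m.trans hMpow)) hlW₁
  have c23 := inv_cost (x := m₁) (m := m₂) (ℓ := ℓ) hm₂0 (by omega) (by omega)
  have c24 := weightList_cost (m := m₂) (m' := m₁) (ℓ := ℓ) hm₂0 (inv_lt m₁ hm₂0).le
    (by omega) hX₂
  have c25 := sort_cost (hn₂.le.trans (hn₂m.trans hMpow)) hlW₂
  have c26 := toArray_cost (ℓ := ℓ) (l := (sort (weightsOf N k L P₂ m₁)).val) (A := #[])
    (fun x hx => hlW₂ x (p₂.mem_iff.1 hx)) (by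
      rw [p₂.length_eq, hn₂]
      simp only [List.size_toArray, List.length_nil, zero_add]
      omega)
  have c27 := meet_cost (N := N) (f := 4 * (a * b * N)) (L := L) (M := m₁ * m₂) (Λ := Λ) (ℓ := ℓ)
    (sort_sorted (weightsOf N k L P₂ m₁)) hM hΛ.le (by omega) (by omega) (by omega)
    (fun x hx => hW₂ x (p₂.mem_iff.1 hx)) (by rw [p₂.length_eq, hn₂]; omega)
    (l := (sort (weightsOf N k L P₁ m₂)).val) (fun x hx => hW₁ x (p₁.mem_iff.1 hx))
  rw [hx₁] at c21
  rw [hx₂] at c24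
  rw [hn₁] at c22
  rw [hn₂] at c25
  rw [p₂.length_eq, hn₂] at c26
  rw [p₁.length_eq, hn₁, hn] at c27
  have hℓ1 : 24 ≤ ℓ := by omega
  have hu : unit ℓ ≤ ℓ * unit ℓ := Nat.le_mul_of_pos_left _ (by omega)
  set V := ℓ * unit ℓ with hV
  have d1 := quadratic_le hB.le hu
  have d2 := quadratic_le (le_refl B₂) hu
  have d8 := quartic_le q₁ hu
  have d9 := quartic_le q₂ hu
  have d5 := square_le B₂ V
  have hB1 : B₂ + 2 ≤ (B₂ + 2) ^ 4 := Nat.le_self_pow (by norm_num) _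
  set X := (B₂ + 2) ^ 4 with hX
  have hX1 : V ≤ X * V := Nat.le_mul_of_pos_left _ (by omega)
  have d3 : ∀ {x : ℕ}, x ≤ B₂ + 1 → x * unit ℓ ≤ X * V :=
    fun hx => Nat.mul_le_mul (by omega) hu
  have d6 := d3 q₁
  have d7 := d3 q₂
  have d10 : ∀ {x : ℕ}, x * unit ℓ ≤ x * V := fun {x} => Nat.mul_le_mul_left _ hu
  have d11 := d10 (x := n₁)
  have d12 := d10 (x := n₂)
  have d13 : n₁ * ((18 * ℓ + 27) * unit ℓ) ≤ 20 * (n₁ * V) := mul_const_le (by omega)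
  have d14 : n * ((10 * ℓ + 23) * unit ℓ) ≤ 11 * (n * V) := mul_const_le (by omega)
  have d15 : (4 * ℓ + 4) * unit ℓ = 4 * V + 4 * unit ℓ := by rw [hV]; ring
  have d16 : (6 * ℓ + 9) * unit ℓ = 6 * V + 9 * unit ℓ := by rw [hV]; ring
  have d17 : (16 * ℓ + 9) * unit ℓ = 16 * V + 9 * unit ℓ := by rw [hV]; ring
  have d18 : n₁ * (ℓ * (6 * unit ℓ)) = 6 * (n₁ * V) := by rw [hV]; ring
  have d19 : n₂ * (ℓ * (6 * unit ℓ)) = 6 * (n₂ * V) := by rw [hV]; ring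
  have d20 : (X + n₁ + n₂ + n) * V = X * V + n₁ * V + n₂ * V + n * V := by ring
  have z1 := Nat.zero_le (n₁ * V)
  have z2 := Nat.zero_le (n₂ * V)
  have z3 := Nat.zero_le (n * V)
  rw [d20]
  linarith

lemma len_le_log {n : ℕ} (hn : 0 < n) : (len n : ℝ) ≤ 2 * Real.log n + 2 := by
  have h1 : 2 ^ (n.size - 1) ≤ n := by
    rw [← Nat.lt_size]
    have := Nat.size_pos.2 hn
    omega
  have h2 : ((n.size - 1 : ℕ) : ℝ) * Real.log 2 ≤ Real.log n := by
    rw [← Real.log_pow]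
    exact Real.log_le_log (by positivity) (by exact_mod_cast h1)
  have h3 : ((len n : ℕ) : ℝ) ≤ ((n.size - 1 : ℕ) : ℝ) + 2 := by
    rw [len]
    exact_mod_cast (by omega : n.size + 1 ≤ n.size - 1 + 2)
  have h4 : (1 : ℝ) / 2 ≤ Real.log 2 := by linarith [Real.log_two_gt_d9]
  have h5 : (0 : ℝ) ≤ ((n.size - 1 : ℕ) : ℝ) := Nat.cast_nonneg _
  nlinarith

/-- Additive constants can thus be absorbed into `log N`. -/
lemma one_le_log {N : ℕ} (hN : 3 ≤ N) : 1 ≤ Real.log N := by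
  have h : (3 : ℝ) ≤ N := by exact_mod_cast hN
  rw [Real.le_log_iff_exp_le (by linarith)]
  linarith [Real.exp_one_lt_d9]

/-- If all modulus data are polynomially bounded in `S`, then so are their lengths in `log S`. -/
lemma len_bound {N M B S D : ℕ} (hN : 3 ≤ N) (hM0 : 0 < M) (hB : 0 < B) (hS : 0 < S)
    (hM : M ≤ 36 * S ^ 6) (hBS : B ≤ D * S) :
    ((12 * (len M + len N + len B) + 24 : ℕ) : ℝ) ≤
      (500 + 24 * D : ℕ) * (Real.log N + Real.log S) := by
  have hD : 0 < D := Nat.pos_of_ne_zero (fun h => by subst h; omega)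
  have l1 := len_le_log hM0
  have l2 := len_le_log (show 0 < N by omega)
  have l3 := len_le_log hB
  have lN := one_le_log hN
  have lS : 0 ≤ Real.log S := Real.log_natCast_nonneg S
  have hM' : Real.log M ≤ Real.log 36 + 6 * Real.log S := by
    have : Real.log M ≤ Real.log (36 * (S : ℝ) ^ 6) :=
      Real.log_le_log (by exact_mod_cast hM0) (by exact_mod_cast hM)
    rwa [Real.log_mul (by norm_num) (by positivity), Real.log_pow] at this
  have hB' : Real.log B ≤ D + Real.log S := by
    have h1 : Real.log B ≤ Real.log ((D : ℝ) * S) :=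
      Real.log_le_log (by exact_mod_cast hB) (by exact_mod_cast hBS)
    rw [Real.log_mul (by positivity) (by positivity)] at h1
    have h2 := Real.log_le_self (show (0 : ℝ) ≤ D by positivity)
    linarith
  have h36 : Real.log 36 ≤ 6 := by
    have : Real.log 36 ≤ Real.log (2 ^ 6) := Real.log_le_log (by norm_num) (by norm_num)
    rw [Real.log_pow] at this
    push_cast at this
    linarith [Real.log_two_lt_d9]
  have hD0 : (0 : ℝ) ≤ D := Nat.cast_nonneg D
  push_cast
  -- The constant terms add up to `240 + 24 D` and go into `log N`; the coefficient of `log S` is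
  -- `168`.
  nlinarith [mul_le_mul_of_nonneg_left lN hD0, mul_nonneg hD0 lS]

lemma nonempty_weightsOf {l : List ℕ} {m' : ℕ} (co : l.Pairwise Nat.Coprime)
    (hl : ∀ r ∈ l, 0 < r) (N k L : ℕ) : 0 < (weightsOf N k L l m').length := by
  rw [length_weightsOf]
  obtain ⟨t, ht⟩ := exists_inSieve (List.prod_pos hl) N k L
  exact List.length_pos_of_mem ((mem_chinese_systems co hl N k L t).2 ht)

lemma cost_cast_le {t A S ℓ K : ℕ} {T : ℝ} (h : t ≤ A * S * ℓ ^ 3) (hℓ : (ℓ : ℝ) ≤ K * T) :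
    (t : ℝ) ≤ (A * K ^ 3 : ℕ) * S * T ^ 3 := by
  calc (t : ℝ) ≤ ((A * S * ℓ ^ 3 : ℕ) : ℝ) := by exact_mod_cast h
    _ = A * S * (ℓ : ℝ) ^ 3 := by push_cast; ring
    _ ≤ A * S * (K * T) ^ 3 := by gcongr
    _ = (A * K ^ 3 : ℕ) * S * T ^ 3 := by push_cast; ring

lemma exists_factor_cost_le : ∃ C c : ℕ, ∀ N Λ B₁ B₂ a b m₁ m₂ S : ℕ, 3 ≤ N → B₁ < B₂ →
    m₁ = HypSieve.primeProd 2 B₁ → m₂ = HypSieve.primeProd B₁ B₂ → Λ < m₁ * m₂ →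
    a < N → b < N → Nat.Coprime (a * b) (m₁ * m₂ * N) →
    S = (HypSieve.weights N m₁ m₂ a b).ncard + (HypSieve.weights N m₂ m₁ a b).ncard +
      (HypSieve.smallSieve N (m₁ * m₂) a b Λ).ncard →
    ((factor N Λ B₁ B₂ a b).cost : ℝ) ≤
      C * S * (Real.log N + Real.log Λ + Real.log S) ^ c := by
  -- The exponent is `4 · 6`: the fourth power of `B₂` has to be `O(S)`, while `M` is known to be
  -- `O(S⁶)`.
  obtain ⟨C₀, hC₀⟩ := exists_pow_le_primeProd 24
  set D := 3 * (72 * C₀ + 1) with hD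
  set K := 500 + 24 * D with hK
  -- Of the three logarithms two come from the quadratic cost of a primitive operation, and one from
  -- the depth of Euclid's algorithm, square roots, sorting, searching and carries.
  refine ⟨600 * (81 * D + 1) * K ^ 3, 3, ?_⟩
  intro N Λ B₁ B₂ a b m₁ m₂ S hN3 hB hm₁ hm₂ hΛ ha hb hab hS
  have hprim := primeProd_zero_le B₁ B₂
  rw [← hm₁, ← hm₂] at hprim
  rw [← prod_primesIn] at hm₁ hm₂
  have hco : Nat.Coprime m₁ m₂ := by rw [hm₁, hm₂]; exact coprime_prod_primesIn _ _ _
  have hpos₁ : 0 < m₁ := by rw [hm₁]; exact List.prod_pos primesIn_pos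
  have hpos₂ : 0 < m₂ := by rw [hm₂]; exact List.prod_pos primesIn_pos
  have hM : 0 < m₁ * m₂ := Nat.mul_pos hpos₁ hpos₂
  obtain ⟨k, hk⟩ : ∃ k, a * b % (m₁ * m₂) = k := ⟨_, rfl⟩
  have hkM : k ≡ a * b [MOD m₁ * m₂] := hk ▸ Nat.mod_modEq _ _
  have hk₁ : k ≡ a * b [MOD m₁] := hkM.of_dvd (dvd_mul_right _ _)
  have hk₂ : k ≡ a * b [MOD m₂] := hkM.of_dvd (dvd_mul_left _ _)
  have habM : Nat.Coprime (a * b) (m₁ * m₂) := hab.coprime_mul_right_right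
  have hkc₁ : Nat.Coprime k m₁ := (hk₁.gcd_eq).trans habM.coprime_mul_right_right
  have hkc₂ : Nat.Coprime k m₂ := (hk₂.gcd_eq).trans habM.coprime_mul_left_right
  set P₁ := (primesIn 2 B₁).val with hP₁
  set P₂ := (primesIn B₁ B₂).val with hP₂
  have co₁ : P₁.Pairwise Nat.Coprime := pairwise_coprime_primesIn _ _
  have co₂ : P₂.Pairwise Nat.Coprime := pairwise_coprime_primesIn _ _
  have pos₁ : ∀ r ∈ P₁, 0 < r := primesIn_pos
  have pos₂ : ∀ r ∈ P₂, 0 < r := primesIn_pos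
  have e₁ := ncard_weights co₁ pos₁ hpos₂ (hm₁ ▸ hco.symm) (N := N) (hm₁ ▸ hk₁)
  have e₂ := ncard_weights co₂ pos₂ hpos₁ (hm₂ ▸ hco) (N := N) (hm₂ ▸ hk₂)
  rw [← hm₁] at e₁
  rw [← hm₂] at e₂
  set L := HypSieve.shift N a b
  have len₁ := prod_le_length_pow (nodup_primesIn 2 B₁) (fun r hr => primesIn_prime hr) (N := N)
    (L := L) (hP₁ ▸ hm₁ ▸ hkc₁)
  have len₂ := prod_le_length_pow (nodup_primesIn B₁ B₂) (fun r hr => primesIn_prime hr) (N := N)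
    (L := L) (hP₂ ▸ hm₂ ▸ hkc₂)
  rw [← hP₁, ← length_weightsOf (m' := m₂), ← hm₁] at len₁
  rw [← hP₂, ← length_weightsOf (m' := m₁), ← hm₂] at len₂
  have ne₁ := nonempty_weightsOf co₁ pos₁ N k L (m' := m₂)
  have pw₁ := sort_perm (weightsOf N k L P₁ m₂)
  have pw₂ := sort_perm (weightsOf N k L P₂ m₁)
  have htries := sum_tries_le (N := N) hpos₁ hpos₂ hco hkM hΛ.le
    (l := (sort (weightsOf N k L P₁ m₂)).val) (s := (sort (weightsOf N k L P₂ m₁)).val)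
    (pw₁.nodup_iff.2 (nodup_weightsOf co₁ pos₁ hpos₂ (hm₁ ▸ hco.symm) _ _ _))
    (pw₂.nodup_iff.2 (nodup_weightsOf co₂ pos₂ hpos₁ (hm₂ ▸ hco) _ _ _))
    (fun α hα => by
      rw [pw₁.mem_iff, mem_weightsOf co₁ pos₁ hpos₂ (hm₁ ▸ hco.symm), ← hm₁] at hα
      exact hα)
    (fun α hα => by
      rw [pw₂.mem_iff, mem_weightsOf co₂ pos₂ hpos₁ (hm₂ ▸ hco), ← hm₂, mul_comm m₂] at hα
      exact hα)
  obtain ⟨n, hn⟩ : ∃ n, ((sort (weightsOf N k L P₁ m₂)).val.map (tries (m₁ * m₂) Λ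
      (sort (weightsOf N k L P₂ m₁)).val)).sum = n := ⟨_, rfl⟩
  rw [hn] at htries
  have hcost := factor_cost_le (by omega : 1 < N) hB ha hb hP₁.symm hP₂.symm hm₁.symm hm₂.symm hk
    hΛ le_rfl rfl rfl hn
  rw [e₁, e₂] at hS
  set n₁ := (weightsOf N k L P₁ m₂).length
  set n₂ := (weightsOf N k L P₂ m₁).length
  -- The sieve sets are never empty, so `log S` is the logarithm of a positive integer.
  have hS0 : 0 < S := by omega
  have hMS : m₁ * m₂ ≤ 36 * S ^ 6 := by
    have s₁ : m₁ ≤ 6 * S ^ 3 :=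
      len₁.trans (Nat.mul_le_mul_left _ (Nat.pow_le_pow_left (by omega) 3))
    have s₂ : m₂ ≤ 6 * S ^ 3 :=
      len₂.trans (Nat.mul_le_mul_left _ (Nat.pow_le_pow_left (by omega) 3))
    calc m₁ * m₂ ≤ 6 * S ^ 3 * (6 * S ^ 3) := Nat.mul_le_mul s₁ s₂
      _ = 36 * S ^ 6 := by ring
  have hB4 : B₂ ^ 4 ≤ (72 * C₀ + 1) * S := by
    have h6 : (B₂ ^ 4) ^ 6 ≤ ((72 * C₀ + 1) * S) ^ 6 :=
      calc (B₂ ^ 4) ^ 6 = B₂ ^ 24 := by rw [← pow_mul]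
        _ ≤ C₀ * HypSieve.primeProd 0 B₂ := hC₀ B₂
        _ ≤ C₀ * (2 * (36 * S ^ 6)) :=
          Nat.mul_le_mul_left _ (hprim.trans (Nat.mul_le_mul_left _ hMS))
        _ = 72 * C₀ * S ^ 6 := by ring
        _ ≤ (72 * C₀ + 1) ^ 6 * S ^ 6 := Nat.mul_le_mul_right _
          ((Nat.le_succ _).trans (Nat.le_self_pow (by norm_num) _))
        _ = ((72 * C₀ + 1) * S) ^ 6 := (mul_pow _ _ _).symm
    -- Sixth roots are taken.
    exact (Nat.pow_le_pow_iff_left (by norm_num)).1 h6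
  have hBD : B₂ + 1 ≤ D * S := by
    have : B₂ ≤ B₂ ^ 4 := Nat.le_self_pow (by norm_num) _
    have : S ≤ (72 * C₀ + 1) * S := Nat.le_mul_of_pos_left _ (by omega)
    rw [hD, mul_assoc]
    omega
  have hB24 : (B₂ + 2) ^ 4 ≤ 81 * D * S := by
    calc (B₂ + 2) ^ 4 ≤ (3 * B₂) ^ 4 := Nat.pow_le_pow_left (by omega) 4
      _ = 81 * B₂ ^ 4 := by ring
      _ ≤ 81 * (D * S) := Nat.mul_le_mul_left _ (hB4.trans (Nat.mul_le_mul_right _ (by omega)))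
      _ = 81 * D * S := by ring
  have hlen := len_bound hN3 hM (Nat.succ_pos B₂) hS0 hMS hBD
  set ℓ := 12 * (len (m₁ * m₂) + len N + len (B₂ + 1)) + 24
  have hcost' : (factor N Λ B₁ B₂ a b).cost ≤ 600 * (81 * D + 1) * S * ℓ ^ 3 := by
    refine hcost.trans ?_
    have : (B₂ + 2) ^ 4 + n₁ + n₂ + n ≤ (81 * D + 1) * S := by
      rw [add_mul, one_mul]
      omega
    calc _ ≤ 300 * ((81 * D + 1) * S * (ℓ * unit ℓ)) :=
          Nat.mul_le_mul_left _ (Nat.mul_le_mul_right _ this)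
      _ = 600 * (81 * D + 1) * S * ℓ ^ 3 := by rw [unit]; ring
  have hlogΛ : 0 ≤ Real.log Λ := Real.log_natCast_nonneg Λ
  have hlogN : 0 ≤ Real.log N := Real.log_natCast_nonneg N
  have hlogS : 0 ≤ Real.log S := Real.log_natCast_nonneg S
  -- The lengths are already controlled by `log N` and `log S`; of `log Λ` only nonnegativity
  -- enters, which holds for `Λ = 0` too as `Real.log 0 = 0`.
  have hℓ : (ℓ : ℝ) ≤ K * (Real.log N + Real.log Λ + Real.log S) :=
    hlen.trans (mul_le_mul_of_nonneg_left (by linarith) (Nat.cast_nonneg _))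
  exact cost_cast_le hcost' hℓ

end Tradeoff

/-! ### The main theorem. -/

theorem mainTheorem9 :
    ∃ C c : ℕ, ∀ N Λ B₁ B₂ a b m₁ m₂ M : ℕ,
      Odd N → 1 < N → ¬ N.Prime →
      B₁ < B₂ →
      m₁ = HypSieve.primeProd 2 B₁ → m₂ = HypSieve.primeProd B₁ B₂ → M = m₁ * m₂ →
      Λ < M →
      a < N → b < N → Nat.Coprime (a * b) (M * N) →
      (HypSieve.fermatBound N a b < (Λ : ℝ) →
        ∃ d : ℕ, (Tradeoff.factor N Λ B₁ B₂ a b).val = some d ∧ d ∣ N ∧ 1 < d ∧ d < N) ∧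
      ∀ S : ℕ,
        S = (HypSieve.weights N m₁ m₂ a b).ncard + (HypSieve.weights N m₂ m₁ a b).ncard +
          (HypSieve.smallSieve N M a b Λ).ncard →
        ((Tradeoff.factor N Λ B₁ B₂ a b).cost : ℝ) ≤
          C * S * (Real.log N + Real.log Λ + Real.log S) ^ c := by
  obtain ⟨C, c, h⟩ := Tradeoff.exists_factor_cost_le
  refine ⟨C, c, fun N Λ B₁ B₂ a b m₁ m₂ M hodd h1 hN hB hm₁ hm₂ hM hΛ ha hb hab => ?_⟩
  subst hM
  have hN3 : 3 ≤ N := by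
    obtain ⟨j, rfl⟩ := hodd
    omega
  exact ⟨Tradeoff.factor_correct hodd h1 hN hm₁ hm₂ hΛ hab,
    fun S hS => h N Λ B₁ B₂ a b m₁ m₂ S hN3 hB hm₁ hm₂ hΛ ha hb hab hS⟩
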